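/- Let $0\le\alpha<\beta$, let $U\sim\mathrm{Unif}[\alpha,\beta]$ and let $r\in\mathbb R$. Say that a random variable $T$ has a tower distribution if there is an i.i.d. sequence $A_1,A_2,\dots$ of positive random variables such that the power towers $T_n=A_1^{A_2^{\cdot^{\cdot^{A_n}}}}$ converge almost surely, as $n\to\infty$, to a finite limit that has the same distribution as $T$; the law of such an $A_1$ is then called an inverse tower distribution of $T$. If $r=0$, then $U^r=1$ has a tower distribution, and its only inverse tower distribution is the point mass at $1$. If $r\neq0$, then $U^r$ has a tower distribution if and only if $1\in[\alpha,\beta]$ and $r\in\left[0,\frac1{1+\log\beta}\right]$. When these conditions hold (and $r\ne 0$), the inverse tower distribution is unique, and its distribution function is the unique function $F:\mathbb R\to\mathbb R$ satisfying $$F(x)=\begin{cases}\dfrac{x^{\beta^r/r}}{\beta}\,(1-\beta^r\log x)-\dfrac\alpha\beta+\dfrac\alpha\beta\,F\!\left(x^{\beta^r/\alpha^r}\right) & x\in[\alpha^{r/\beta^r},\beta^{r/\beta^r})\setminus\{1\},\\ 0 & x<\alpha^{r/\beta^r},\\ 1 & x\ge\beta^{r/\beta^r},\\ \dfrac{1-\alpha}{\beta-\alpha}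 & x=1,\end{cases}$$ where for $\alpha=0$ the last summand in the first line is read as $0$, and the first line at $x=0$ is read as its limit $0$. -/

import Mathlib

open MeasureTheory ProbabilityTheory Filter Topology Set

/-- The finite power tower `a 0 ^ (a 1 ^ (⋯ ^ a (n - 1)))` with `n` entries, associated to the
right; the empty tower is `1`. -/
noncomputable def powerTower : (ℕ → ℝ) → ℕ → ℝ
  | _, 0 => 1
  | a, n + 1 => a 0 ^ powerTower (fun i => a (i + 1)) n

/-- `A` is an i.i.d. sequence of (almost surely) positive random variables whose random power
towers `A 0`, `A 0 ^ A 1`, `A 0 ^ (A 1 ^ A 2)`, … converge almost surely to the finite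
random variable `L`. -/
structure IsTowerLimit {Ω : Type*} [MeasurableSpace Ω] (P : Measure Ω)
    (A : ℕ → Ω → ℝ) (L : Ω → ℝ) : Prop where
  indep : iIndepFun A P
  identDistrib : ∀ i, IdentDistrib (A i) (A 0) P P
  pos : ∀ i, ∀ᵐ ω ∂P, 0 < A i ω
  tendsto : ∀ᵐ ω ∂P, Tendsto (fun n => powerTower (fun i => A i ω) n) atTop (𝓝 (L ω))

/-- `μ` is an inverse tower distribution of the random variable `T`: some i.i.d. sequence with
common law `μ` has an almost surely convergent power tower whose limit is distributed as `T`. -/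
def IsInverseTowerDistribution {Ω₀ : Type*} [MeasurableSpace Ω₀] (T : Ω₀ → ℝ) (P₀ : Measure Ω₀)
    (μ : Measure ℝ) : Prop :=
  ∃ (Ω : Type) (_ : MeasurableSpace Ω) (P : Measure Ω) (_ : IsProbabilityMeasure P)
    (A : ℕ → Ω → ℝ) (L : Ω → ℝ),
    IsTowerLimit P A L ∧ P.map (A 0) = μ ∧ IdentDistrib L T P P₀

/-- `T` has a tower distribution: `T` is distributed as the infinite power tower of some i.i.d.
sequence. -/
def HasTowerDistribution {Ω₀ : Type*} [MeasurableSpace Ω₀] (T : Ω₀ → ℝ) (P₀ : Measure Ω₀) :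
    Prop :=
  ∃ μ : Measure ℝ, IsInverseTowerDistribution T P₀ μ

/-- `F` satisfies the recursive formula of the inverse tower distribution function of `U ^ r`, for
`U` uniform on `[α, β]`, `0 ≤ α ≤ 1 ≤ β`, `α < β`, `0 < r`. For `α = 0` the last summand is `0`,
and the value at `x = 0` is then `0`, the limit of the formula as `x → 0+`. -/
def SatisfiesTowerRecursion (α β r : ℝ) (F : ℝ → ℝ) : Prop :=
  ∀ x : ℝ, F x =
    if x < α ^ (r / β ^ r) then 0
    else if β ^ (r / β ^ r) ≤ x then 1
    else if x = 1 then (1 - α) / (β - α)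
    else x ^ (β ^ r / r) / β * (1 - β ^ r * Real.log x) - α / β
      + α / β * F (x ^ (β ^ r / α ^ r))

/-! A convergent tower satisfies T = A ^ T' with T' a copy of T independent of A. Hence every
inverse tower distribution of U ^ r solves the fixed-point equation A ^ (U ^ r) ~ U ^ r
(`IsInverseTowerDistribution.fixed_point`, `IsPowerFixed`), and everything is read off this
equation. After logarithms it is multiplicative, U ^ r * log A ~ r * log U, and since U ^ r > 0
almost surely it splits into separate equations for log A > 0 and log A < 0. The case r = 0 is
immediate.

Existence: with Z = |log A| ^ (1 / r) and Y = |log (U ^ r)| ^ (1 / r), each side reads U * Z ~ Y. By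
Khinchine's representation (`exists_mixture_of_antitoneOn`) this is solvable once the density y ^ (r
- 1) * exp (± y ^ r / r) of Y, cut off to its support, is nonincreasing; this follows from 1 ∈ [α,
β] and r * (1 + log β) ≤ 1.

From the equation back to towers: the maps x ↦ A ^ x contract on average in the coordinate √x. Their
Lipschitz constants are √(S * |log A|), and the fixed-point equation itself evaluates the mean as
the ratio of E √(S * |log (U ^ r)|) to E √(U ^ r), which is below 1
(`TowerParam.lintegral_sqrt_lt_one`). So the tower converges and its limit has the stationary law
(`isInverseTowerDistribution_of_contracting`).

Necessity: in density form, and after reweighting the law of |log A|, the equation prescribes the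
mass of every window (v, v / c], where c = (α / β) ^ |r|. It is v ^ (1 - 1 / r) * exp (± v) when v
is a value of |log U| on the side in question, and zero otherwise. Monotonicity of these masses near
the edges, or summation over windows tiling the half-line, rules out all other parameters
(`IsPowerFixed.towerParam`).

Uniqueness: adding the tail form and the density form of the equation gives the recursion for the
distribution function, first almost everywhere and then by right continuity. Iterating it raises x
to powers of β ^ r / α ^ r > 1, which leaves the interval outside which F is prescribed, so only one
F is possible. -/

/-! ### Stationarity: from random towers to the fixed-point equation. -/

/-- Prepend a term to a sequence. -/
def seqCons (x : ℝ) (a : ℕ → ℝ) : ℕ → ℝ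
  | 0 => x
  | n + 1 => a n

lemma measurable_seqCons : Measurable fun p : ℝ × (ℕ → ℝ) => seqCons p.1 p.2 := by
  refine measurable_pi_iff.2 fun n => ?_
  cases n with
  | zero => exact measurable_fst
  | succ n => exact (measurable_pi_apply n).comp measurable_snd

/-- The law of an i.i.d. sequence is preserved when an independent copy is prepended. -/
lemma map_seqCons_infinitePi (μ : Measure ℝ) [IsProbabilityMeasure μ] :
    (μ.prod (Measure.infinitePi fun _ : ℕ => μ)).map (fun p => seqCons p.1 p.2) =
      Measure.infinitePi fun _ : ℕ => μ := by
  classical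
  refine Measure.eq_infinitePi _ fun s t ht => ?_
  obtain ⟨N, hN⟩ : ∃ N, s ⊆ Finset.range (N + 1) :=
    ⟨s.sup id, fun i hi => Finset.mem_range.2 (Nat.lt_succ_of_le (Finset.le_sup (f := id) hi))⟩
  -- Padding with `univ` to a full initial segment, which contains the index 0, makes the preimage
  -- of the cylinder a rectangle.
  set t' : ℕ → Set ℝ := fun i => if i ∈ s then t i else univ with ht'
  have ht'm : ∀ i, MeasurableSet (t' i) := by
    intro i
    by_cases h : i ∈ s
    · simpa [ht', h] using ht i
    · simp [ht', h]
  have h1 : Set.pi (s : Set ℕ) t = Set.pi (Finset.range (N + 1) : Set ℕ) t' := by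
    ext a
    simp only [Set.mem_pi, Finset.mem_coe, ht']
    constructor
    · intro h i _
      by_cases hi : i ∈ s
      · simpa [hi] using h i hi
      · simp [hi]
    · intro h i hi
      simpa [hi] using h i (hN hi)
  have h2 : ∏ i ∈ s, μ (t i) = ∏ i ∈ Finset.range (N + 1), μ (t' i) := by
    rw [← Finset.prod_subset hN (f := fun i => μ (t' i))]
    · exact Finset.prod_congr rfl fun i hi => by simp [ht', hi]
    · intro i _ hi
      simp [ht', hi]
  have h3 : (fun p : ℝ × (ℕ → ℝ) => seqCons p.1 p.2) ⁻¹'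
      Set.pi (Finset.range (N + 1) : Set ℕ) t' =
      t' 0 ×ˢ Set.pi (Finset.range N : Set ℕ) (fun i => t' (i + 1)) := by
    ext ⟨x, a⟩
    simp only [Set.mem_preimage, Set.mem_pi, Finset.mem_coe, Finset.mem_range, Set.mem_prod]
    constructor
    · intro h
      exact ⟨h 0 (by omega), fun i hi => h (i + 1) (by omega)⟩
    · rintro ⟨h0, h⟩ i hi
      cases i with
      | zero => exact h0
      | succ i => exact h i (by omega)
  rw [h1, h2, Measure.map_apply measurable_seqCons
    (MeasurableSet.pi (Finset.countable_toSet _) fun i _ => ht'm i), h3, Measure.prod_prod,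
    Measure.infinitePi_pi _ (fun i _ => ht'm (i + 1)), Finset.prod_range_succ', mul_comm]

lemma measurable_powerTower (n : ℕ) : Measurable fun a : ℕ → ℝ => powerTower a n := by
  induction n with
  | zero => exact measurable_const
  | succ n ih =>
    exact (measurable_pi_apply 0).pow
      (ih.comp (measurable_pi_iff.2 fun i => measurable_pi_apply (i + 1)))

/-- The law `ρ` of an infinite random power tower is a fixed point: if `A` has law `μ` and `T` has
law `ρ` independently, then `A ^ T` has law `ρ`. -/
lemma IsInverseTowerDistribution.fixed_point {Ω₀ : Type*} [MeasurableSpace Ω₀] {T : Ω₀ → ℝ}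
    {P₀ : Measure Ω₀} {μ : Measure ℝ} (h : IsInverseTowerDistribution T P₀ μ) :
    IsProbabilityMeasure μ ∧ μ (Iic 0) = 0 ∧
      (μ.prod (P₀.map T)).map (fun p => p.1 ^ p.2) = P₀.map T := by
  obtain ⟨Ω, mΩ, P, hP, A, L, hA, rfl, hL⟩ := h
  have hAm : ∀ i, AEMeasurable (A i) P := fun i => (hA.identDistrib i).aemeasurable_fst
  have : IsProbabilityMeasure (P.map (A 0)) := Measure.isProbabilityMeasure_map (hAm 0)
  set μ := P.map (A 0) with hμ
  have hpos : μ (Iic 0) = 0 := by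
    rw [hμ, Measure.map_apply_of_aemeasurable (hAm 0) measurableSet_Iic]
    have := hA.pos 0
    rw [ae_iff] at this
    simpa [Set.preimage, not_lt] using this
  refine ⟨this, hpos, ?_⟩
  set Q := Measure.infinitePi fun _ : ℕ => μ with hQ
  have hSm : AEMeasurable (fun ω i => A i ω) P := aemeasurable_pi_iff.2 hAm
  have hS : P.map (fun ω i => A i ω) = Q := by
    rw [hA.indep.map_fun_eq_infinitePi_map₀' hAm]
    congr 1
    funext i
    exact (hA.identDistrib i).map_eq
  -- The `limsup` is a measurable function of the whole sequence that agrees with the limit wherever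
  -- the latter exists, so the problem moves to the product space.
  set Λ : (ℕ → ℝ) → ℝ := fun a => limsup (fun n => powerTower a n) atTop with hΛ
  have hΛm : Measurable Λ := Measurable.limsup measurable_powerTower
  have hconv : ∀ᵐ a ∂Q, Tendsto (fun n => powerTower a n) atTop (𝓝 (Λ a)) := by
    have hmeas : MeasurableSet {a : ℕ → ℝ | ∃ c, Tendsto (fun n => powerTower a n) atTop (𝓝 c)} :=
      MeasureTheory.measurableSet_exists_tendsto measurable_powerTower
    have : ∀ᵐ a ∂Q, ∃ c, Tendsto (fun n => powerTower a n) atTop (𝓝 c) := by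
      rw [← hS, ae_map_iff hSm hmeas]
      filter_upwards [hA.tendsto] with ω hω using ⟨_, hω⟩
    filter_upwards [this] with a ⟨c, hc⟩
    have : Λ a = c := hc.limsup_eq
    rwa [this]
  have hlaw : Q.map Λ = P₀.map T := by
    rw [← hS, AEMeasurable.map_map_of_aemeasurable hΛm.aemeasurable hSm, ← hL.map_eq]
    refine Measure.map_congr ?_
    filter_upwards [hA.tendsto] with ω hω
    exact hω.limsup_eq
  have hQs : Q = (μ.prod Q).map (fun p => seqCons p.1 p.2) := (map_seqCons_infinitePi μ).symm
  have hconv2 : ∀ᵐ p ∂(μ.prod Q), Tendsto (fun n => powerTower p.2 n) atTop (𝓝 (Λ p.2)) :=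
    Measure.quasiMeasurePreserving_snd.ae hconv
  have hconv1 : ∀ᵐ p ∂(μ.prod Q), Tendsto (fun n => powerTower (seqCons p.1 p.2) n) atTop
      (𝓝 (Λ (seqCons p.1 p.2))) := by
    rw [hQs] at hconv
    exact ae_of_ae_map measurable_seqCons.aemeasurable hconv
  have hpos1 : ∀ᵐ p ∂(μ.prod Q), 0 < p.1 := by
    refine Measure.quasiMeasurePreserving_fst.ae (p := fun x => 0 < x) ?_
    rw [ae_iff]
    simpa [not_lt, Set.Iic] using hpos
  have hrec : (fun p : ℝ × (ℕ → ℝ) => Λ (seqCons p.1 p.2)) =ᵐ[μ.prod Q] fun p => p.1 ^ Λ p.2 := by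
    filter_upwards [hconv1, hconv2, hpos1] with p h1 h2 h3
    -- After the index shift, the tower of the prepended sequence is by definition `p.1` raised to
    -- the tower of `p.2`.
    have h4 := h1.comp (tendsto_add_atTop_nat 1)
    refine tendsto_nhds_unique h4 ?_
    exact (Real.continuousAt_const_rpow h3.ne').tendsto.comp h2
  have : (μ.prod Q).map (Prod.map id Λ) = μ.prod (P₀.map T) := by
    rw [← Measure.map_prod_map _ _ measurable_id hΛm, Measure.map_id, hlaw]
  rw [← this, Measure.map_map (by fun_prop) (by fun_prop)]
  have h5 : P₀.map T = (μ.prod Q).map (fun p => Λ (seqCons p.1 p.2)) := by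
    rw [← hlaw]
    conv_lhs => rw [hQs]
    exact Measure.map_map hΛm measurable_seqCons
  rw [h5]
  exact (Measure.map_congr hrec).symm

/-- `μ` is a law on `(0, ∞)`-valued reals such that `A ^ (U ^ r)` is distributed as `U ^ r`, for
independent `A` of law `μ` and `U` uniform on `[α, β]` (all integrals over `U` unnormalized). -/
structure IsPowerFixed (α β r : ℝ) (μ : Measure ℝ) : Prop where
  prob : IsProbabilityMeasure μ
  pos : μ (Iic 0) = 0
  fixed : ∀ k : ℝ → ENNReal, Measurable k →
    ∫⁻ a, (∫⁻ u in Icc α β, k (a ^ (u ^ r))) ∂μ = ∫⁻ u in Icc α β, k (u ^ r)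

lemma IsPowerFixed.ae_pos {α β r : ℝ} {μ : Measure ℝ} (h : IsPowerFixed α β r μ) :
    ∀ᵐ a ∂μ, 0 < a := by
  rw [ae_iff]
  simpa [not_lt, Set.Iic] using h.pos

lemma map_rpow_of_isUniform {Ω₀ : Type*} [MeasurableSpace Ω₀] {P₀ : Measure Ω₀}
    {α β r : ℝ} (hαβ : α < β) {U : Ω₀ → ℝ} (hU : pdf.IsUniform U (Icc α β) P₀ volume) :
    P₀.map (fun ω => U ω ^ r) =
      (ENNReal.ofReal (β - α))⁻¹ • (volume.restrict (Icc α β)).map (fun u => u ^ r) := by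
  have hUm : AEMeasurable U P₀ := pdf.IsUniform.aemeasurable (by simp [hαβ]) (by simp) hU
  have : P₀.map (fun ω => U ω ^ r) = (P₀.map U).map (fun u => u ^ r) := by
    rw [AEMeasurable.map_map_of_aemeasurable (by fun_prop) hUm]
    rfl
  rw [this, hU, ProbabilityTheory.cond, Measure.map_smul, Real.volume_Icc]

lemma IsInverseTowerDistribution.isPowerFixed {Ω₀ : Type*} [MeasurableSpace Ω₀]
    {P₀ : Measure Ω₀} {α β r : ℝ} (hαβ : α < β)
    {U : Ω₀ → ℝ} (hU : pdf.IsUniform U (Icc α β) P₀ volume) {μ : Measure ℝ}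
    (h : IsInverseTowerDistribution (fun ω => U ω ^ r) P₀ μ) : IsPowerFixed α β r μ := by
  obtain ⟨h1, h2, h3⟩ := h.fixed_point
  refine ⟨h1, h2, fun k hk => ?_⟩
  rw [map_rpow_of_isUniform hαβ hU] at h3
  set ν := (volume.restrict (Icc α β)).map (fun u : ℝ => u ^ r) with hν
  have hc0 : (ENNReal.ofReal (β - α))⁻¹ ≠ 0 := ENNReal.inv_ne_zero.2 ENNReal.ofReal_ne_top
  have hct : (ENNReal.ofReal (β - α))⁻¹ ≠ ⊤ :=
    ENNReal.inv_ne_top.2 (by simpa using hαβ)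
  have h4 : ∫⁻ t, k t ∂((ENNReal.ofReal (β - α))⁻¹ • ν) =
      ∫⁻ a, (∫⁻ t, k (a ^ t) ∂((ENNReal.ofReal (β - α))⁻¹ • ν)) ∂μ := by
    rw [← h3, lintegral_map hk (by fun_prop), h3, lintegral_prod _ (by fun_prop)]
  simp only [lintegral_smul_measure, smul_eq_mul] at h4
  rw [lintegral_const_mul' _ _ hct, ENNReal.mul_right_inj hc0 hct, hν,
    lintegral_map hk (by fun_prop)] at h4
  rw [h4]
  refine lintegral_congr fun a => ?_
  rw [lintegral_map (f := fun t => k (a ^ t)) (by fun_prop) (by fun_prop)]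

/-! ### Average contraction and convergence of the towers. -/

/-- The power tower `a 0 ^ (⋯ ^ (a (n - 1) ^ x))` with topmost exponent `x`. -/
noncomputable def towerFrom : (ℕ → ℝ) → ℕ → ℝ → ℝ
  | _, 0, x => x
  | a, n + 1, x => a 0 ^ towerFrom (fun i => a (i + 1)) n x

lemma powerTower_eq_towerFrom (a : ℕ → ℝ) (n : ℕ) : powerTower a n = towerFrom a n 1 := by
  induction n generalizing a with
  | zero => rfl
  | succ n ih => simp only [powerTower, towerFrom, ih]

/-- A further entry at the top only moves the starting point of the same `n` maps; this is what
makes consecutive towers comparable. -/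
lemma towerFrom_succ_right (a : ℕ → ℝ) (n : ℕ) (x : ℝ) :
    towerFrom a (n + 1) x = towerFrom a n (a n ^ x) := by
  induction n generalizing a with
  | zero => rfl
  | succ n ih =>
    rw [towerFrom, ih]
    rfl

lemma measurable_towerFrom (n : ℕ) : Measurable fun p : (ℕ → ℝ) × ℝ => towerFrom p.1 n p.2 := by
  induction n with
  | zero => exact measurable_snd
  | succ n ih =>
    have h : Measurable fun p : (ℕ → ℝ) × ℝ => ((fun i => p.1 (i + 1), p.2) : (ℕ → ℝ) × ℝ) :=
      (measurable_pi_iff.2 fun i => (measurable_pi_apply (i + 1)).comp measurable_fst).prodMk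
        measurable_snd
    exact ((measurable_pi_apply 0).comp measurable_fst).pow (ih.comp h)

/-- `a` is a base for which `x ↦ a ^ x` preserves `(0, b]` and is Lipschitz there, in the square
root coordinate, with constant `ℓ a`. -/
def IsContractingBase (b : ℝ) (ℓ : ℝ → ℝ) (a : ℝ) : Prop :=
  0 < a ∧ (∀ x ∈ Ioc 0 b, a ^ x ≤ b) ∧
    ∀ x ∈ Ioc 0 b, ∀ y ∈ Ioc 0 b, |√(a ^ x) - √(a ^ y)| ≤ ℓ a * |√x - √y|

lemma towerFrom_mem_Ioc {b : ℝ} {ℓ : ℝ → ℝ} {a : ℕ → ℝ} (ha : ∀ i, IsContractingBase b ℓ (a i))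
    {x : ℝ} (hx : x ∈ Ioc 0 b) (n : ℕ) : towerFrom a n x ∈ Ioc 0 b := by
  induction n generalizing a with
  | zero => exact hx
  | succ n ih =>
    have := ih (a := fun i => a (i + 1)) (fun i => ha (i + 1))
    exact ⟨Real.rpow_pos_of_pos (ha 0).1 _, (ha 0).2.1 _ this⟩

lemma abs_sqrt_towerFrom_sub_le {b : ℝ} {ℓ : ℝ → ℝ} (hℓ : ∀ a, 0 ≤ ℓ a) {a : ℕ → ℝ}
    (ha : ∀ i, IsContractingBase b ℓ (a i)) {x y : ℝ} (hx : x ∈ Ioc 0 b) (hy : y ∈ Ioc 0 b)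
    (n : ℕ) :
    |√(towerFrom a n x) - √(towerFrom a n y)| ≤
      (∏ i ∈ Finset.range n, ℓ (a i)) * |√x - √y| := by
  induction n generalizing a with
  | zero => simp [towerFrom]
  | succ n ih =>
    have h := ih (a := fun i => a (i + 1)) (fun i => ha (i + 1))
    have hs : ∀ i, IsContractingBase b ℓ (a (i + 1)) := fun i => ha (i + 1)
    calc |√(towerFrom a (n + 1) x) - √(towerFrom a (n + 1) y)|
        ≤ ℓ (a 0) * |√(towerFrom (fun i => a (i + 1)) n x) -
            √(towerFrom (fun i => a (i + 1)) n y)| :=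
          (ha 0).2.2 _ (towerFrom_mem_Ioc hs hx n) _ (towerFrom_mem_Ioc hs hy n)
      _ ≤ ℓ (a 0) * ((∏ i ∈ Finset.range n, ℓ (a (i + 1))) * |√x - √y|) :=
          mul_le_mul_of_nonneg_left h (hℓ _)
      _ = _ := by rw [Finset.prod_range_succ']; ring

lemma abs_sqrt_sub_le {b x y : ℝ} (hx : x ∈ Ioc 0 b) (hy : y ∈ Ioc 0 b) : |√x - √y| ≤ √b := by
  have h1 := Real.sqrt_le_sqrt hx.2
  have h2 := Real.sqrt_le_sqrt hy.2
  have h3 := Real.sqrt_nonneg x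
  have h4 := Real.sqrt_nonneg y
  rw [abs_le]
  constructor <;> linarith

/-- If the products of the Lipschitz constants are summable, the power tower converges, whatever
its topmost exponent in `(0, b]`, to a limit not depending on that exponent. -/
lemma exists_tendsto_towerFrom {b : ℝ} (hb : 1 ≤ b) {ℓ : ℝ → ℝ} (hℓ : ∀ a, 0 ≤ ℓ a) {a : ℕ → ℝ}
    (ha : ∀ i, IsContractingBase b ℓ (a i))
    (hs : Summable fun n => ∏ i ∈ Finset.range n, ℓ (a i)) :
    ∃ l, ∀ x ∈ Ioc 0 b, Tendsto (fun n => towerFrom a n x) atTop (𝓝 l) := by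
  have h1 : (1 : ℝ) ∈ Ioc 0 b := ⟨one_pos, hb⟩
  have hc : CauchySeq fun n => √(towerFrom a n 1) := by
    refine cauchySeq_of_dist_le_of_summable _ (fun n => ?_) (hs.mul_right (√b))
    have h2 : a n ^ (1 : ℝ) ∈ Ioc 0 b := ⟨Real.rpow_pos_of_pos (ha n).1 _, (ha n).2.1 _ h1⟩
    rw [Real.dist_eq, Nat.succ_eq_add_one, towerFrom_succ_right]
    exact (abs_sqrt_towerFrom_sub_le hℓ ha h1 h2 n).trans (mul_le_mul_of_nonneg_left
      (abs_sqrt_sub_le h1 h2) (Finset.prod_nonneg fun i _ => hℓ _))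
  obtain ⟨s, hs1⟩ := cauchySeq_tendsto_of_complete hc
  refine ⟨s ^ 2, fun x hx => ?_⟩
  have hd : Tendsto (fun n => √(towerFrom a n x) - √(towerFrom a n 1)) atTop (𝓝 0) := by
    refine squeeze_zero_norm (fun n => ?_) (by simpa using hs.tendsto_atTop_zero.mul_const (√b))
    exact (abs_sqrt_towerFrom_sub_le hℓ ha hx h1 n).trans (mul_le_mul_of_nonneg_left
      (abs_sqrt_sub_le hx h1) (Finset.prod_nonneg fun i _ => hℓ _))
  have h3 := (hd.add hs1).pow 2
  simp only [zero_add, sub_add_cancel] at h3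
  refine h3.congr fun n => Real.sq_sqrt (towerFrom_mem_Ioc ha hx n).1.le

/-- By independence the product of `n` constants has mean `K ^ n`, so the sum has finite mean, a
geometric series. -/
lemma ae_summable_prod {μ : Measure ℝ} [IsProbabilityMeasure μ] {ℓ : ℝ → ℝ} (hℓ : ∀ a, 0 ≤ ℓ a)
    (hℓm : Measurable ℓ) (hK : ∫⁻ a, ENNReal.ofReal (ℓ a) ∂μ < 1) :
    ∀ᵐ a ∂Measure.infinitePi fun _ : ℕ => μ, Summable fun n => ∏ i ∈ Finset.range n, ℓ (a i) := by
  set Q := Measure.infinitePi fun _ : ℕ => μ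
  set K := ∫⁻ a, ENNReal.ofReal (ℓ a) ∂μ
  have hind : iIndepFun (fun (i : ℕ) (a : ℕ → ℝ) => ENNReal.ofReal (ℓ (a i))) Q :=
    iIndepFun_infinitePi (X := fun _ x => ENNReal.ofReal (ℓ x)) fun _ => hℓm.ennreal_ofReal
  have h1 : ∀ n : ℕ, ∫⁻ a, ENNReal.ofReal (∏ i ∈ Finset.range n, ℓ (a i)) ∂Q = K ^ n := by
    intro n
    simp_rw [ENNReal.ofReal_prod_of_nonneg fun i _ => hℓ _]
    rw [lintegral_prod_eq_prod_lintegral_of_indepFun _ _ hind fun i =>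
      hℓm.ennreal_ofReal.comp (measurable_pi_apply i)]
    have h2 : ∀ i : ℕ, ∫⁻ a, ENNReal.ofReal (ℓ (a i)) ∂Q = K := fun i =>
      (measurePreserving_eval_infinitePi (fun _ : ℕ => μ) i).lintegral_comp
        (f := fun x => ENNReal.ofReal (ℓ x)) hℓm.ennreal_ofReal
    simp [h2]
  have hm : ∀ n : ℕ, Measurable fun a : ℕ → ℝ =>
      ENNReal.ofReal (∏ i ∈ Finset.range n, ℓ (a i)) := fun n =>
    (Finset.measurable_prod _ fun i _ => hℓm.comp (measurable_pi_apply i)).ennreal_ofReal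
  have h3 : ∫⁻ a, ∑' n : ℕ, ENNReal.ofReal (∏ i ∈ Finset.range n, ℓ (a i)) ∂Q ≠ ⊤ := by
    rw [lintegral_tsum fun n => (hm n).aemeasurable]
    simp_rw [h1]
    rw [ENNReal.tsum_geometric]
    exact ENNReal.inv_ne_top.2 (tsub_pos_of_lt hK).ne'
  filter_upwards [ae_lt_top (Measurable.tsum hm) h3] with a ha
  have h4 := ENNReal.summable_toReal ha.ne
  exact h4.congr fun n => by
    rw [ENNReal.toReal_ofReal (Finset.prod_nonneg fun i _ => hℓ _)]

/-- Stationarity of `ρ` under `n` independent maps. The outermost base is split off by prepending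
and absorbed into the test function, then removed by `hfix`. -/
lemma lintegral_towerFrom {μ ρ : Measure ℝ} [IsProbabilityMeasure μ] [IsProbabilityMeasure ρ]
    (hfix : ∀ k : ℝ → ENNReal, Measurable k →
      ∫⁻ a, (∫⁻ t, k (a ^ t) ∂ρ) ∂μ = ∫⁻ t, k t ∂ρ)
    (n : ℕ) {k : ℝ → ENNReal} (hk : Measurable k) :
    ∫⁻ a, (∫⁻ x, k (towerFrom a n x) ∂ρ) ∂(Measure.infinitePi fun _ : ℕ => μ) =
      ∫⁻ x, k x ∂ρ := by
  induction n generalizing k with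
  | zero => simp [towerFrom]
  | succ n ih =>
    have hm := hk.comp (measurable_towerFrom (n + 1))
    have hm2 : Measurable fun a : ℕ → ℝ => ∫⁻ x, k (towerFrom a (n + 1) x) ∂ρ :=
      hm.lintegral_prod_right'
    have hm3 : Measurable fun p : ℝ × (ℕ → ℝ) =>
        ∫⁻ x, k (towerFrom (seqCons p.1 p.2) (n + 1) x) ∂ρ := hm2.comp measurable_seqCons
    rw [← map_seqCons_infinitePi μ, lintegral_map hm2 measurable_seqCons,
      lintegral_prod _ hm3.aemeasurable, ← hfix k hk]
    refine lintegral_congr fun a => ?_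
    exact ih (k := fun t => k (a ^ t)) (by fun_prop)

/-- If `ρ` is a fixed point of the random map `x ↦ a ^ x`, which contracts on average in the square
root coordinate, then the random power tower converges and its limit has law `ρ`. -/
theorem isInverseTowerDistribution_of_contracting {Ω₀ : Type*} [MeasurableSpace Ω₀] {T : Ω₀ → ℝ}
    {P₀ : Measure Ω₀} [IsProbabilityMeasure P₀] (hT : AEMeasurable T P₀)
    {μ : Measure ℝ} [IsProbabilityMeasure μ] {b : ℝ} (hb : 1 ≤ b) {ℓ : ℝ → ℝ}
    (hℓ : ∀ a, 0 ≤ ℓ a) (hℓm : Measurable ℓ) (hK : ∫⁻ a, ENNReal.ofReal (ℓ a) ∂μ < 1)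
    (hμ : ∀ᵐ a ∂μ, IsContractingBase b ℓ a) (hTb : ∀ᵐ t ∂P₀.map T, t ∈ Ioc 0 b)
    (hfix : ∀ k : ℝ → ENNReal, Measurable k →
      ∫⁻ a, (∫⁻ t, k (a ^ t) ∂P₀.map T) ∂μ = ∫⁻ t, k t ∂P₀.map T) :
    IsInverseTowerDistribution T P₀ μ := by
  set Q := Measure.infinitePi fun _ : ℕ => μ with hQ
  set ρ := P₀.map T with hρ
  have : IsProbabilityMeasure ρ := Measure.isProbabilityMeasure_map hT
  have heval : ∀ i : ℕ, Q.map (fun a => a i) = μ := fun i => Measure.infinitePi_map_eval _ i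
  have hgood : ∀ᵐ a ∂Q, ∀ i : ℕ, IsContractingBase b ℓ (a i) := by
    refine ae_all_iff.2 fun i => ?_
    have h1 : ∀ᵐ x ∂Q.map (fun a => a i), IsContractingBase b ℓ x := by rwa [heval]
    exact ae_of_ae_map (measurable_pi_apply i).aemeasurable h1
  set L : (ℕ → ℝ) → ℝ := fun a => limsup (fun n => powerTower a n) atTop with hL
  have hLm : Measurable L := Measurable.limsup measurable_powerTower
  have hlim : ∀ᵐ a ∂Q, ∀ x ∈ Ioc 0 b, Tendsto (fun n => towerFrom a n x) atTop (𝓝 (L a)) := by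
    filter_upwards [hgood, ae_summable_prod hℓ hℓm hK] with a h1 h2
    obtain ⟨l, hl⟩ := exists_tendsto_towerFrom hb hℓ h1 h2
    have : L a = l := by
      have := hl 1 ⟨one_pos, hb⟩
      simp_rw [← powerTower_eq_towerFrom] at this
      exact this.limsup_eq
    rwa [this]
  have hlaw : Q.map L = ρ := by
    have : IsProbabilityMeasure (Q.map L) := Measure.isProbabilityMeasure_map hLm.aemeasurable
    refine ext_of_forall_lintegral_eq_of_IsFiniteMeasure fun f => ?_
    have hfm : Measurable fun x => (f x : ENNReal) := f.continuous.measurable.coe_nnreal_ennreal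
    -- Started at an independent point of law `ρ`, the tower has law `ρ` for every `n`. Since the
    -- limit forgets the starting point, `ρ` is also the law of `L`.
    have h1 : ∀ n : ℕ, ∫⁻ p, f (towerFrom p.1 n p.2) ∂(Q.prod ρ) = ∫⁻ x, f x ∂ρ := fun n => by
      have hm : Measurable fun p : (ℕ → ℝ) × ℝ => (f (towerFrom p.1 n p.2) : ENNReal) :=
        hfm.comp (measurable_towerFrom n)
      rw [lintegral_prod _ hm.aemeasurable]
      exact lintegral_towerFrom hfix n hfm
    have h2 : Tendsto (fun n : ℕ => ∫⁻ p, f (towerFrom p.1 n p.2) ∂(Q.prod ρ)) atTop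
        (𝓝 (∫⁻ p, f (L p.1) ∂(Q.prod ρ))) := by
      refine tendsto_lintegral_of_dominated_convergence (fun _ => (nndist f 0 : ENNReal))
        (fun n => hfm.comp (measurable_towerFrom n)) (fun n => ae_of_all _ fun p => ?_)
        (by simp) ?_
      · exact ENNReal.coe_le_coe.2 (BoundedContinuousFunction.NNReal.upper_bound f _)
      · filter_upwards [Measure.quasiMeasurePreserving_fst.ae hlim,
          Measure.quasiMeasurePreserving_snd.ae hTb] with p h3 h4
        exact ENNReal.tendsto_coe.2 ((f.continuous.tendsto _).comp (h3 _ h4))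
    simp_rw [h1] at h2
    rw [tendsto_nhds_unique tendsto_const_nhds h2, lintegral_map hfm hLm,
      lintegral_prod _ (by fun_prop)]
    simp
  refine ⟨ℕ → ℝ, inferInstance, Q, inferInstance, fun i a => a i, L, ⟨?_, ?_, ?_, ?_⟩, heval 0, ?_⟩
  · exact iIndepFun_infinitePi (X := fun _ x => x) fun _ => measurable_id
  · exact fun i => ⟨(measurable_pi_apply i).aemeasurable, (measurable_pi_apply 0).aemeasurable,
      (heval i).trans (heval 0).symm⟩
  · intro i
    filter_upwards [hgood] with a ha using (ha i).1
  · filter_upwards [hlim] with a ha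
    simp_rw [powerTower_eq_towerFrom]
    exact ha 1 ⟨one_pos, hb⟩
  · exact ⟨hLm.aemeasurable, hT, hlaw⟩

/-! ### The contraction estimate in the admissible parameter range. -/

/-- An upper bound of `|ξ| * exp ξ` for `ξ ≤ τ`. -/
noncomputable def expBound (τ : ℝ) : ℝ := max (Real.exp (-1)) (τ * Real.exp τ)

lemma expBound_pos (τ : ℝ) : 0 < expBound τ := lt_max_of_lt_left (Real.exp_pos _)

/-- For ξ ≤ 0 the function peaks at ξ = -1 with value exp (-1); for ξ ≥ 0 it increases up to `τ`. -/
lemma abs_mul_exp_le_expBound {ξ τ : ℝ} (h : ξ ≤ τ) : |ξ| * Real.exp ξ ≤ expBound τ := by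
  rcases le_total 0 ξ with h0 | h0
  · rw [abs_of_nonneg h0]
    exact le_max_of_le_right (mul_le_mul h (Real.exp_le_exp.2 h) (Real.exp_pos _).le (h0.trans h))
  · rw [abs_of_nonpos h0]
    refine le_max_of_le_left ?_
    have h1 := Real.add_one_le_exp (-ξ - 1)
    have h2 : Real.exp (-1) = Real.exp (-ξ - 1) * Real.exp ξ := by
      rw [← Real.exp_add]; ring_nf
    rw [h2]
    exact mul_le_mul_of_nonneg_right (by linarith) (Real.exp_pos _).le

/-- In the coordinate q = √x the map becomes exp (c q² / 2) with c = log a. Its squared derivative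
is |c| times |c q²| exp (c q²), and c q² ≤ τ bounds the second factor uniformly in `a`. -/
lemma isContractingBase_of_log_mul_exp_le {τ a : ℝ} (hτ : 0 ≤ τ) (ha : 0 < a)
    (h : Real.log a * Real.exp τ ≤ τ) :
    IsContractingBase (Real.exp τ) (fun a => √(expBound τ * |Real.log a|)) a := by
  set c := Real.log a with hc
  have hle : ∀ x, 0 ≤ x → x ≤ Real.exp τ → c * x ≤ τ := by
    intro x hx hx2
    rcases le_total 0 c with h0 | h0
    · exact (mul_le_mul_of_nonneg_left hx2 h0).trans h
    · exact (mul_nonpos_of_nonpos_of_nonneg h0 hx).trans hτ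
  refine ⟨ha, fun x hx => ?_, fun x hx y hy => ?_⟩
  · rw [Real.rpow_def_of_pos ha]
    exact Real.exp_le_exp.2 (hle x hx.1.le hx.2)
  have hs : ∀ x, 0 ≤ x → √(a ^ x) = Real.exp (c * (√x) ^ 2 / 2) := by
    intro x hx
    rw [Real.rpow_def_of_pos ha, ← hc, Real.sq_sqrt hx, Real.exp_half]
  rw [hs x hx.1.le, hs y hy.1.le]
  have hd : ∀ q ∈ Icc 0 (√(Real.exp τ)), HasDerivWithinAt (fun q => Real.exp (c * q ^ 2 / 2))
      (Real.exp (c * q ^ 2 / 2) * (c * q)) (Icc 0 (√(Real.exp τ))) q := by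
    intro q _
    have h1 : HasDerivAt (fun q : ℝ => c * q ^ 2 / 2) (c * q) q := by
      refine (((hasDerivAt_pow 2 q).const_mul c).div_const 2).congr_deriv ?_
      norm_num
      ring
    exact h1.exp.hasDerivWithinAt
  have hb : ∀ q ∈ Icc 0 (√(Real.exp τ)),
      ‖Real.exp (c * q ^ 2 / 2) * (c * q)‖ ≤ √(expBound τ * |c|) := by
    intro q hq
    have hq2 : q ^ 2 ≤ Real.exp τ := by
      have := pow_le_pow_left₀ hq.1 hq.2 2
      rwa [Real.sq_sqrt (Real.exp_pos _).le] at this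
    refine Real.le_sqrt_of_sq_le ?_
    have h1 := abs_mul_exp_le_expBound (hle (q ^ 2) (sq_nonneg _) hq2)
    have h2 : ‖Real.exp (c * q ^ 2 / 2) * (c * q)‖ ^ 2 =
        |c * q ^ 2| * Real.exp (c * q ^ 2) * |c| := by
      rw [Real.norm_eq_abs, sq_abs, mul_pow, ← Real.exp_nat_mul, abs_mul, abs_of_nonneg (sq_nonneg q)]
      have h3 : |c| * |c| = c * c := abs_mul_abs_self c
      have h4 : ((2 : ℕ) : ℝ) * (c * q ^ 2 / 2) = c * q ^ 2 := by push_cast; ring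
      rw [h4]
      linear_combination (- q ^ 2 * Real.exp (c * q ^ 2)) * h3
    rw [h2]
    exact mul_le_mul_of_nonneg_right h1 (abs_nonneg _)
  exact (convex_Icc _ _).norm_image_sub_le_of_norm_hasDerivWithin_le hd hb
    ⟨Real.sqrt_nonneg _, Real.sqrt_le_sqrt hy.2⟩ ⟨Real.sqrt_nonneg _, Real.sqrt_le_sqrt hx.2⟩

/-- The parameter range of the theorem, for a nonzero exponent. -/
structure TowerParam (α β r : ℝ) : Prop where
  nonneg : 0 ≤ α
  lt : α < β
  le_one : α ≤ 1
  one_le : 1 ≤ β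
  pos : 0 < r
  le : r * (1 + Real.log β) ≤ 1

namespace TowerParam

variable {α β r : ℝ} (h : TowerParam α β r)
include h

lemma log_nonneg : 0 ≤ Real.log β := Real.log_nonneg h.one_le

lemma beta_pos : 0 < β := one_pos.trans_le h.one_le

lemma exp_eq : Real.exp (r * Real.log β) = β ^ r := by
  rw [Real.rpow_def_of_pos h.beta_pos, mul_comm]

lemma mul_log_nonneg : 0 ≤ r * Real.log β := mul_nonneg h.pos.le h.log_nonneg

lemma mul_log_le : r * Real.log β ≤ 1 - r := by linarith [h.le, mul_add r 1 (Real.log β)]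

lemma r_le_one : r ≤ 1 := by linarith [h.mul_log_le, h.mul_log_nonneg]

/-- The factor 1 / (1 + r / 2) is the integral of u ^ (r / 2) over [0, 1], against which the side u
≤ 1 is compared. If the maximum is exp (-1), the numbers 0.37 and 1.5² suffice. Otherwise r ≤ 1 - τ
≤ exp (-τ) reduces the claim to a polynomial inequality. -/
lemma mul_expBound_lt : r * expBound (r * Real.log β) * (1 + r / 2) ^ 2 < 1 := by
  have h0 := h.pos
  have h1 := h.r_le_one
  set τ := r * Real.log β
  have hτ : τ ≤ 1 - r := h.mul_log_le
  have hτ0 : 0 ≤ τ := h.mul_log_nonneg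
  rcases max_choice (Real.exp (-1)) (τ * Real.exp τ) with hm | hm
  · rw [expBound, hm]
    have h2 : Real.exp (-1) < 0.37 := by
      rw [Real.exp_neg, inv_lt_comm₀ (Real.exp_pos _) (by norm_num)]
      exact lt_trans (by norm_num) Real.exp_one_gt_d9
    have h3 : (1 + r / 2) ^ 2 ≤ (1.5 : ℝ) ^ 2 := pow_le_pow_left₀ (by linarith) (by linarith) 2
    have h4 : r * Real.exp (-1) ≤ 0.37 := by
      calc r * Real.exp (-1) ≤ 1 * 0.37 :=
            mul_le_mul h1 h2.le (Real.exp_pos _).le zero_le_one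
        _ = 0.37 := by norm_num
    calc _ ≤ (0.37 : ℝ) * 1.5 ^ 2 := mul_le_mul h4 h3 (sq_nonneg _) (by norm_num)
      _ < 1 := by norm_num
  · rw [expBound, hm]
    have h2 : r * Real.exp τ ≤ 1 := by
      have := Real.add_one_le_exp (-τ)
      have h3 : Real.exp (-τ) * Real.exp τ = 1 := by rw [← Real.exp_add]; simp
      rw [← h3]
      exact mul_le_mul_of_nonneg_right (by linarith) (Real.exp_pos _).le
    have h3 : r * (τ * Real.exp τ) ≤ 1 - r := by
      calc r * (τ * Real.exp τ) = τ * (r * Real.exp τ) := by ring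
        _ ≤ τ * 1 := mul_le_mul_of_nonneg_left h2 hτ0
        _ ≤ 1 - r := by linarith
    calc _ ≤ (1 - r) * (1 + r / 2) ^ 2 := mul_le_mul_of_nonneg_right h3 (sq_nonneg _)
      _ = 1 - (3 * r ^ 2 / 4 + r ^ 3 / 4) := by ring
      _ < 1 := by linarith [pow_pos h0 2, pow_pos h0 3]

/-- Above 1 the comparison is pointwise: with ξ = r log u in [0, τ], convexity of exp gives S ξ ≤ κ
exp ξ for κ = max (exp (-1)) τ, which is below 1 because τ ≤ 1 - r. -/
lemma exists_lintegral_Ioc_le : ∃ K < 1, 0 ≤ K ∧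
    ∫⁻ u in Ioc 1 β, ENNReal.ofReal (√(expBound (r * Real.log β) * |Real.log (u ^ r)|)) ≤
      ENNReal.ofReal K * ∫⁻ u in Ioc 1 β, ENNReal.ofReal (√(u ^ r)) := by
  set τ := r * Real.log β
  have hτ : τ ≤ 1 - r := h.mul_log_le
  have hr := h.pos
  set κ := max (Real.exp (-1)) τ
  have hκ1 : κ < 1 := max_lt (by simp) (by linarith)
  have hκ0 : 0 < κ := lt_max_of_lt_left (Real.exp_pos _)
  refine ⟨√κ, by rw [Real.sqrt_lt' one_pos]; simpa using hκ1, Real.sqrt_nonneg _, ?_⟩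
  rw [← lintegral_const_mul' _ _ ENNReal.ofReal_ne_top]
  refine setLIntegral_mono' measurableSet_Ioc fun u hu => ?_
  have hu0 : 0 < u := one_pos.trans hu.1
  rw [← ENNReal.ofReal_mul (Real.sqrt_nonneg _), ← Real.sqrt_mul hκ0.le]
  refine ENNReal.ofReal_le_ofReal (Real.sqrt_le_sqrt ?_)
  rw [Real.log_rpow hu0, Real.rpow_def_of_pos hu0, mul_comm (Real.log u)]
  set ξ := r * Real.log u
  have hξ0 : 0 ≤ ξ := mul_nonneg hr.le (Real.log_nonneg hu.1.le)
  have hξτ : ξ ≤ τ := mul_le_mul_of_nonneg_left (Real.log_le_log hu0 hu.2) hr.le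
  rw [abs_of_nonneg hξ0]
  rcases max_choice (Real.exp (-1)) (τ * Real.exp τ) with hm | hm
  · rw [expBound, hm]
    exact mul_le_mul (le_max_left _ _) (by linarith [Real.add_one_le_exp ξ]) hξ0 hκ0.le
  · rw [expBound, hm, mul_assoc]
    refine mul_le_mul (le_max_right _ _) ?_ (mul_nonneg (Real.exp_pos _).le hξ0) hκ0.le
    have h1 := Real.add_one_le_exp (ξ - τ)
    have h2 : Real.exp ξ = Real.exp τ * Real.exp (ξ - τ) := by rw [← Real.exp_add]; ring_nf
    rw [h2]
    exact mul_le_mul_of_nonneg_left (by linarith) (Real.exp_pos _).le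

/-- No pointwise comparison is possible near 0, where the logarithm is unbounded. Instead √(S r y) ≤
(m + S r y / m) / 2 with y = -log u is integrated. The integral of y over [α, 1] is at most 1 - α,
while that of u ^ (r / 2) is at least m (1 - α). -/
lemma exists_lintegral_Icc_le : ∃ K < 1, 0 ≤ K ∧
    ∫⁻ u in Icc α 1, ENNReal.ofReal (√(expBound (r * Real.log β) * |Real.log (u ^ r)|)) ≤
      ENNReal.ofReal K * ∫⁻ u in Icc α 1, ENNReal.ofReal (√(u ^ r)) := by
  have hr := h.pos
  have hα := h.nonneg
  have hα1 := h.le_one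
  have hlt := h.mul_expBound_lt
  set S := expBound (r * Real.log β) with hS
  have hS0 : 0 < S := expBound_pos _
  set m := (1 + r / 2)⁻¹ with hm
  have hm0 : 0 < m := by positivity
  have hrS : r * S < m ^ 2 := by
    rw [hm, inv_pow, lt_inv_comm₀ (by positivity) (by positivity)]
    rw [← one_div, lt_div_iff₀ (by positivity)]
    linarith
  refine ⟨(1 + r * S / m ^ 2) / 2, ?_, by positivity, ?_⟩
  · have : r * S / m ^ 2 < 1 := (div_lt_one (by positivity)).2 hrS
    linarith
  have h1 : ∫⁻ u in Icc α 1, ENNReal.ofReal (√(u ^ r)) = ENNReal.ofReal (m * (1 - α ^ (r / 2 + 1))) := by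
    have e : ∫ u in α..1, u ^ (r / 2) = m * (1 - α ^ (r / 2 + 1)) := by
      rw [integral_rpow (Or.inl (by linarith)), Real.one_rpow, hm, add_comm (r / 2) 1]
      field_simp
    rw [← e, intervalIntegral.integral_of_le hα1, ← integral_Icc_eq_integral_Ioc,
      ofReal_integral_eq_lintegral_ofReal]
    · refine setLIntegral_congr_fun measurableSet_Icc fun u hu => ?_
      rw [Real.sqrt_eq_rpow, ← Real.rpow_mul (hα.trans hu.1)]
      ring_nf
    · exact (Continuous.integrableOn_Icc (by fun_prop (disch := positivity)))
    · exact (ae_restrict_iff' measurableSet_Icc).2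
        (ae_of_all _ fun u hu => Real.rpow_nonneg (hα.trans hu.1) _)
  have h2 : ∫⁻ u in Icc α 1, ENNReal.ofReal (√(S * |Real.log (u ^ r)|)) ≤
      ENNReal.ofReal ((m + r * S / m) / 2 * (1 - α)) := by
    have hle : ∫ u in α..1, (m / 2 + -(r * S / m / 2) * Real.log u) ≤
        (m + r * S / m) / 2 * (1 - α) := by
      rw [intervalIntegral.integral_add (by simp)
        (intervalIntegral.intervalIntegrable_log'.const_mul _), intervalIntegral.integral_const_mul,
        integral_log, intervalIntegral.integral_const]
      have h3 : α * Real.log α ≤ 0 := mul_nonpos_of_nonneg_of_nonpos hα (Real.log_nonpos hα hα1)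
      have h4 : 0 ≤ r * S / m / 2 := by positivity
      simp only [smul_eq_mul, Real.log_one]
      nlinarith [mul_nonpos_of_nonneg_of_nonpos h4 h3]
    refine le_trans ?_ (ENNReal.ofReal_le_ofReal hle)
    rw [intervalIntegral.integral_of_le hα1, ← integral_Icc_eq_integral_Ioc,
      ofReal_integral_eq_lintegral_ofReal]
    · refine setLIntegral_mono' measurableSet_Icc fun u hu => ENNReal.ofReal_le_ofReal ?_
      have hu0 : 0 ≤ u := hα.trans hu.1
      have hlog : |Real.log (u ^ r)| = r * -Real.log u := by
        rcases hu0.eq_or_lt with h0 | h0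
        · simp [← h0, Real.zero_rpow hr.ne']
        · rw [Real.log_rpow h0, abs_mul, abs_of_pos hr, abs_of_nonpos (Real.log_nonpos hu0 hu.2)]
      rw [hlog]
      set y := -Real.log u with hy
      have hy0 : 0 ≤ y := by have := Real.log_nonpos hu0 hu.2; linarith
      have e : m / 2 + -(r * S / m / 2) * Real.log u = (m ^ 2 + r * S * y) / (2 * m) := by
        rw [hy]; field_simp
      rw [e]
      refine Real.sqrt_le_iff.2 ⟨by positivity, ?_⟩
      rw [div_pow, le_div_iff₀ (by positivity)]
      nlinarith [sq_nonneg (m ^ 2 - r * S * y)]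
    · have : IntervalIntegrable (fun u => m / 2 + -(r * S / m / 2) * Real.log u) volume α 1 :=
        IntervalIntegrable.add (by simp) (intervalIntegral.intervalIntegrable_log'.const_mul _)
      rw [intervalIntegrable_iff_integrableOn_Ioc_of_le hα1] at this
      exact (integrableOn_Icc_iff_integrableOn_Ioc (by simp)).2 this
    · refine (ae_restrict_iff' measurableSet_Icc).2 (ae_of_all _ fun u hu => ?_)
      have := Real.log_nonpos (hα.trans hu.1) hu.2
      have h4 : 0 ≤ r * S / m / 2 := by positivity
      simp only [Pi.zero_apply]
      nlinarith
  rw [h1, ← ENNReal.ofReal_mul (by positivity)]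
  refine h2.trans (ENNReal.ofReal_le_ofReal ?_)
  have h5 : α ^ (r / 2 + 1) ≤ α := by
    have := Real.rpow_le_rpow_of_exponent_ge_of_imp hα hα1 (show (1 : ℝ) ≤ r / 2 + 1 by linarith)
      (fun _ _ => by linarith)
    simpa using this
  have e2 : (1 + r * S / m ^ 2) / 2 * (m * (1 - α ^ (r / 2 + 1))) =
      (m + r * S / m) / 2 * (1 - α ^ (r / 2 + 1)) := by field_simp
  rw [e2]
  exact mul_le_mul_of_nonneg_left (by linarith) (by positivity)

lemma exists_lintegral_le : ∃ K < 1,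
    ∫⁻ u in Icc α β, ENNReal.ofReal (√(expBound (r * Real.log β) * |Real.log (u ^ r)|)) ≤
      K * ∫⁻ u in Icc α β, ENNReal.ofReal (√(u ^ r)) := by
  obtain ⟨K₁, h1, h10, h2⟩ := h.exists_lintegral_Icc_le
  obtain ⟨K₂, h3, h30, h4⟩ := h.exists_lintegral_Ioc_le
  refine ⟨ENNReal.ofReal (max K₁ K₂), ?_, ?_⟩
  · rw [ENNReal.ofReal_lt_one]
    exact max_lt h1 h3
  rw [← Icc_union_Ioc_eq_Icc h.le_one h.one_le, lintegral_union measurableSet_Ioc, lintegral_union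
    measurableSet_Ioc, mul_add]
  · refine add_le_add (h2.trans ?_) (h4.trans ?_) <;> gcongr
    · exact le_max_left _ _
    · exact le_max_right _ _
  all_goals
    rw [Set.disjoint_left]
    intro x hx hx2
    exact absurd hx.2 (not_le.2 hx2.1)

/-- For almost every `a`, the power `a ^ (u ^ r)` lies in the closed interval for almost every `u`
in [α, β]; continuity in `u` carries this to the endpoint `β`. -/
lemma ae_rpow_mem {μ : Measure ℝ} (hμ : IsPowerFixed α β r μ) :
    ∀ᵐ a ∂μ, a ^ (β ^ r) ∈ Icc (α ^ r) (β ^ r) := by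
  have hr := h.pos
  set C := Icc (α ^ r) (β ^ r) with hC
  have hm : MeasurableSet Cᶜ := measurableSet_Icc.compl
  have h1 := hμ.fixed (Cᶜ.indicator 1) (measurable_one.indicator hm)
  have h2 : ∫⁻ u in Icc α β, Cᶜ.indicator (1 : ℝ → ENNReal) (u ^ r) = 0 := by
    rw [setLIntegral_congr_fun (g := 0) measurableSet_Icc]
    · simp
    · intro u hu
      have h3 : u ^ r ∈ C := ⟨Real.rpow_le_rpow h.nonneg hu.1 hr.le,
        Real.rpow_le_rpow (h.nonneg.trans hu.1) hu.2 hr.le⟩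
      simp [h3]
  have hm2 : Measurable fun p : ℝ × ℝ => Cᶜ.indicator (1 : ℝ → ENNReal) (p.1 ^ (p.2 ^ r)) :=
    (measurable_one.indicator hm).comp (by fun_prop)
  rw [h2, lintegral_eq_zero_iff hm2.lintegral_prod_right'] at h1
  filter_upwards [h1, hμ.ae_pos] with a ha ha0
  have hm3 : Measurable fun u : ℝ => Cᶜ.indicator (1 : ℝ → ENNReal) (a ^ (u ^ r)) :=
    (measurable_one.indicator hm).comp (by fun_prop)
  simp only [Pi.zero_apply] at ha
  rw [lintegral_eq_zero_iff hm3, Filter.EventuallyEq, ae_restrict_iff' measurableSet_Icc] at ha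
  have hcont : Continuous fun u : ℝ => a ^ (u ^ r) := by
    have : Continuous fun u : ℝ => Real.exp (Real.log a * u ^ r) := by fun_prop (disch := positivity)
    exact this.congr fun u => (Real.rpow_def_of_pos ha0 _).symm
  by_contra hcon
  have hopen : IsOpen (Ioo α β ∩ (fun u : ℝ => a ^ (u ^ r)) ⁻¹' Cᶜ) :=
    isOpen_Ioo.inter (isClosed_Icc.isOpen_compl.preimage hcont)
  have hne : (Ioo α β ∩ (fun u : ℝ => a ^ (u ^ r)) ⁻¹' Cᶜ).Nonempty := by
    have e1 : ∀ᶠ u in 𝓝[<] β, a ^ (u ^ r) ∈ Cᶜ :=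
      (hcont.continuousAt.eventually (isClosed_Icc.isOpen_compl.mem_nhds hcon)).filter_mono
        nhdsWithin_le_nhds
    have e2 : ∀ᶠ u in 𝓝[<] β, u ∈ Ioo α β := Ioo_mem_nhdsLT h.lt
    exact (e2.and e1).exists
  refine (hopen.measure_pos volume hne).ne' (measure_mono_null ?_ ha)
  rintro u ⟨hu1, hu2⟩ hu3
  have h5 := hu3 (Ioo_subset_Icc_self hu1)
  rw [indicator_of_mem (show a ^ (u ^ r) ∈ Cᶜ from hu2)] at h5
  simp at h5

lemma ae_log_mul_exp_le {μ : Measure ℝ} (hμ : IsPowerFixed α β r μ) :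
    ∀ᵐ a ∂μ, Real.log a * Real.exp (r * Real.log β) ≤ r * Real.log β := by
  filter_upwards [h.ae_rpow_mem hμ, hμ.ae_pos] with a ha ha0
  have h1 := Real.log_le_log (Real.rpow_pos_of_pos ha0 _) ha.2
  rwa [Real.log_rpow ha0, Real.log_rpow h.beta_pos, mul_comm, ← h.exp_eq] at h1

/-- Testing the fixed-point equation with √(S |log t|) factors the left side, because log (a ^ (u ^
r)) = u ^ r * log a: the mean of √(S |log A|) times the integral of √(u ^ r) equals the integral of
√(S |log (u ^ r)|). -/
lemma lintegral_sqrt_lt_one {μ : Measure ℝ} (hμ : IsPowerFixed α β r μ) :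
    ∫⁻ a, ENNReal.ofReal (√(expBound (r * Real.log β) * |Real.log a|)) ∂μ < 1 := by
  set S := expBound (r * Real.log β)
  obtain ⟨K, hK, hle⟩ := h.exists_lintegral_le
  have h1 := hμ.fixed (fun t => ENNReal.ofReal (√(S * |Real.log t|))) (by fun_prop)
  rw [← h1] at hle
  set N := ∫⁻ u in Icc α β, ENNReal.ofReal (√(u ^ r)) with hN
  have hcont : Continuous fun u : ℝ => √(u ^ r) := by
    have := h.pos
    fun_prop (disch := positivity)
  have hNtop : N ≠ ⊤ := (hcont.integrableOn_Icc.lintegral_lt_top).ne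
  have hN0 : N ≠ 0 := by
    rw [hN, Ne, lintegral_eq_zero_iff (by fun_prop), Filter.EventuallyEq,
      ae_restrict_iff' measurableSet_Icc]
    intro hz
    have : volume (Ioo α β) = 0 := by
      refine measure_mono_null (fun u hu => ?_) hz
      intro hcon
      have := hcon (Ioo_subset_Icc_self hu)
      simp only [Pi.zero_apply, ENNReal.ofReal_eq_zero, ← not_lt] at this
      exact this (Real.sqrt_pos.2 (Real.rpow_pos_of_pos (h.nonneg.trans_lt hu.1) _))
    simp at this
    exact absurd h.lt (not_lt.2 this)
  have h2 : ∫⁻ a, (∫⁻ u in Icc α β, ENNReal.ofReal (√(S * |Real.log (a ^ u ^ r)|))) ∂μ =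
      (∫⁻ a, ENNReal.ofReal (√(S * |Real.log a|)) ∂μ) * N := by
    rw [← lintegral_mul_const' _ _ hNtop]
    refine lintegral_congr_ae ?_
    filter_upwards [hμ.ae_pos] with a ha
    rw [hN, ← lintegral_const_mul' _ _ ENNReal.ofReal_ne_top]
    refine setLIntegral_congr_fun measurableSet_Icc fun u hu => ?_
    have hu0 : 0 ≤ u ^ r := Real.rpow_nonneg (h.nonneg.trans hu.1) _
    rw [← ENNReal.ofReal_mul (Real.sqrt_nonneg _), ← Real.sqrt_mul
      (mul_nonneg (expBound_pos _).le (abs_nonneg _)), Real.log_rpow ha, abs_mul, abs_of_nonneg hu0]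
    congr 2
    ring
  rw [h2, ENNReal.mul_le_mul_iff_left hN0 hNtop] at hle
  exact hle.trans_lt hK

theorem isInverseTowerDistribution {Ω₀ : Type*} [MeasurableSpace Ω₀] {P₀ : Measure Ω₀}
    [IsProbabilityMeasure P₀] {U : Ω₀ → ℝ} (hU : pdf.IsUniform U (Icc α β) P₀ volume)
    {μ : Measure ℝ} (hμ : IsPowerFixed α β r μ) :
    IsInverseTowerDistribution (fun ω => U ω ^ r) P₀ μ := by
  have := hμ.prob
  have hUm : AEMeasurable U P₀ := pdf.IsUniform.aemeasurable (by simp [h.lt]) (by simp) hU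
  have hlaw := map_rpow_of_isUniform (r := r) h.lt hU
  refine isInverseTowerDistribution_of_contracting (by fun_prop)
    (b := Real.exp (r * Real.log β)) (Real.one_le_exp h.mul_log_nonneg)
    (ℓ := fun a => √(expBound (r * Real.log β) * |Real.log a|)) (fun a => Real.sqrt_nonneg _)
    (by fun_prop) (h.lintegral_sqrt_lt_one hμ) ?_ ?_ ?_
  · filter_upwards [hμ.ae_pos, h.ae_log_mul_exp_le hμ] with a h1 h2
    exact isContractingBase_of_log_mul_exp_le h.mul_log_nonneg h1 h2
  · rw [hlaw, h.exp_eq]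
    refine Measure.ae_smul_measure ?_ _
    rw [ae_map_iff (p := fun t => t ∈ Ioc 0 (β ^ r)) (by fun_prop) measurableSet_Ioc, ae_restrict_iff' measurableSet_Icc]
    -- The point u = 0, present when α = 0, must be discarded: the contraction interval excludes 0.
    have : ∀ᵐ u : ℝ ∂volume, u ≠ 0 := by simp [ae_iff]
    filter_upwards [this] with u hu0 hu
    exact ⟨Real.rpow_pos_of_pos (lt_of_le_of_ne (h.nonneg.trans hu.1) hu0.symm) _,
      Real.rpow_le_rpow (h.nonneg.trans hu.1) hu.2 h.pos.le⟩
  · intro k hk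
    rw [hlaw]
    simp only [lintegral_smul_measure, smul_eq_mul]
    rw [lintegral_const_mul' _ _ (ENNReal.inv_ne_top.2 (by simpa using h.lt)),
      lintegral_map hk (by fun_prop), ← hμ.fixed k hk]
    congr 1
    refine lintegral_congr fun a => ?_
    rw [lintegral_map (f := fun t => k (a ^ t)) (by fun_prop) (by fun_prop)]

end TowerParam

/-! ### Khinchine mixtures and existence of a solution. -/

lemma lintegral_Ioc_mul {α β z : ℝ} (hz : 0 ≤ z) (k : ℝ → ENNReal) :
    ∫⁻ y in Ioc (α * z) (β * z), k y =
      ENNReal.ofReal z * ∫⁻ u in Ioc α β, k (u * z) := by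
  rcases hz.eq_or_lt with rfl | hz
  · simp
  rw [← lintegral_const_mul' _ _ ENNReal.ofReal_ne_top, ← Set.image_mul_right_Ioc _ _ hz,
    lintegral_image_eq_lintegral_abs_deriv_mul (f' := fun _ => z) measurableSet_Ioc
      (fun x _ => by simpa using ((hasDerivAt_id x).mul_const z).hasDerivWithinAt)
      (fun x _ y _ h => by simpa [hz.ne'] using h)]
  simp [abs_of_pos hz]

lemma antitone_mul_pow {q g : ℝ} (hq0 : 0 ≤ q) (hq1 : q < 1) (hg : 0 ≤ g) :
    Antitone fun n : ℕ => g * q ^ n := fun _ _ hmn =>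
  mul_le_mul_of_nonneg_left (pow_le_pow_of_le_one hq0 hq1.le hmn) hg

lemma Ioc_zero_eq_iUnion {q g : ℝ} (hq0 : 0 ≤ q) (hq1 : q < 1) (hg : 0 ≤ g) :
    Ioc 0 g = ⋃ n : ℕ, Ioc (g * q ^ (n + 1)) (g * q ^ n) := by
  have hanti := antitone_mul_pow hq0 hq1 hg
  ext y
  simp only [mem_iUnion, mem_Ioc]
  constructor
  · rintro ⟨hy0, hyg⟩
    have hex : ∃ n : ℕ, g * q ^ n < y := by
      have : Tendsto (fun n : ℕ => g * q ^ n) atTop (𝓝 0) := by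
        simpa using (tendsto_pow_atTop_nhds_zero_of_lt_one hq0 hq1).const_mul g
      exact (this.eventually (gt_mem_nhds hy0)).exists
    classical
    have h0 : Nat.find hex ≠ 0 := by
      intro h
      have := Nat.find_spec hex
      rw [h] at this
      simp at this
      exact absurd hyg (not_le.2 this)
    obtain ⟨n, hn⟩ := Nat.exists_eq_succ_of_ne_zero h0
    refine ⟨n, ?_, ?_⟩
    · have := Nat.find_spec hex
      rwa [hn] at this
    · exact not_lt.1 (Nat.find_min hex (by omega : n < Nat.find hex))
  · rintro ⟨n, h1, h2⟩
    refine ⟨lt_of_le_of_lt (by positivity) h1, h2.trans ?_⟩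
    simpa using hanti (Nat.zero_le n)

lemma lintegral_Ioc_zero_eq_tsum {q g : ℝ} (hq0 : 0 ≤ q) (hq1 : q < 1) (hg : 0 ≤ g)
    (k : ℝ → ENNReal) :
    ∫⁻ y in Ioc 0 g, k y = ∑' n : ℕ, ∫⁻ y in Ioc (g * q ^ (n + 1)) (g * q ^ n), k y := by
  rw [Ioc_zero_eq_iUnion hq0 hq1 hg, lintegral_iUnion (fun n => measurableSet_Ioc)]
  exact (antitone_mul_pow hq0 hq1 hg).pairwise_disjoint_on_Ioc_succ

/-- **Khinchine's representation**: a nonincreasing integrable density on `(0, ∞)` is the density of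
a mixture of the uniform laws on `[α * z, β * z]`, `z > 0`. -/
theorem exists_mixture_of_antitoneOn {α β : ℝ} (hα : 0 ≤ α) (hαβ : α < β) {h : ℝ → ℝ}
    (hm : Measurable h) (hh : AntitoneOn h (Ioi 0))
    (hint : ∫⁻ y in Ioi 0, ENNReal.ofReal (h y) ≠ ⊤) :
    ∃ κ : Measure ℝ, κ (Iic 0) = 0 ∧ ∀ k : ℝ → ENNReal, Measurable k →
      ∫⁻ z, (∫⁻ u in Icc α β, k (u * z)) ∂κ = ∫⁻ y in Ioi 0, k y * ENNReal.ofReal (h y) := by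
  have hβ : 0 < β := hα.trans_lt hαβ
  -- Layer-cake decomposition: by monotonicity each superlevel set of `h` is, up to a null set, an
  -- interval starting at 0, of length `g s`.
  set G : ℝ → ENNReal := fun s => volume ({y | s < h y} ∩ Ioi 0) with hG
  have hGm : Measurable G := by
    refine Antitone.measurable fun s t hst => measure_mono ?_
    exact inter_subset_inter_left _ fun y hy => lt_of_le_of_lt hst hy
  set g : ℝ → ℝ := fun s => (G s).toReal with hg
  have hgm : Measurable g := hGm.ennreal_toReal
  have hGtop : ∀ s, 0 < s → G s ≠ ⊤ := by
    intro s hs hcon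
    have h1 := mul_meas_ge_le_lintegral (μ := volume.restrict (Ioi 0)) hm.ennreal_ofReal
      (ENNReal.ofReal s)
    have h2 : G s ≤ (volume.restrict (Ioi 0)) {x | ENNReal.ofReal s ≤ ENNReal.ofReal (h x)} := by
      rw [Measure.restrict_apply' measurableSet_Ioi]
      refine measure_mono (inter_subset_inter_left _ fun y hy => ?_)
      exact ENNReal.ofReal_le_ofReal (le_of_lt hy)
    rw [hcon, top_le_iff] at h2
    rw [h2, ENNReal.mul_top (by simpa using hs), top_le_iff] at h1
    exact hint h1
  have hset : ∀ s, 0 < s → (({y | s < h y} ∩ Ioi 0 : Set ℝ)) =ᵐ[volume] Ioc 0 (g s) := by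
    intro s hs
    have hsub : {y | s < h y} ∩ Ioi 0 ⊆ Ioc 0 (g s) := by
      rintro y ⟨hy, hy0⟩
      refine ⟨hy0, ?_⟩
      have : Ioc 0 y ⊆ {y | s < h y} ∩ Ioi 0 := fun x hx =>
        ⟨lt_of_lt_of_le hy (hh hx.1 hy0 hx.2), hx.1⟩
      have h1 := measure_mono (μ := volume) this
      rw [Real.volume_Ioc, sub_zero] at h1
      exact (ENNReal.ofReal_le_iff_le_toReal (hGtop s hs)).1 h1
    refine ae_eq_of_subset_of_measure_ge hsub ?_ ?_ (by simp)
    · rw [Real.volume_Ioc, sub_zero, hg, ENNReal.ofReal_toReal (hGtop s hs)]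
    · exact ((measurableSet_lt measurable_const hm).inter measurableSet_Ioi).nullMeasurableSet
  set q := α / β with hq
  have hq0 : 0 ≤ q := by positivity
  have hq1 : q < 1 := (div_lt_one hβ).2 hαβ
  -- The intervals (α z n, β z n] tile (0, g s], since α z n = β z (n + 1). For α = 0 the term n = 0
  -- alone covers everything.
  set z : ℕ → ℝ → ℝ := fun n s => g s * q ^ n / β with hz
  have hzm : ∀ n, Measurable (z n) := fun n => (hgm.mul_const _).div_const _
  have hz0 : ∀ n s, 0 ≤ z n s := fun n s => by
    have : 0 ≤ g s := ENNReal.toReal_nonneg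
    positivity
  refine ⟨Measure.sum fun n => ((volume.restrict (Ioi 0)).withDensity
    fun s => ENNReal.ofReal (z n s)).map (z n), ?_, fun k hk => ?_⟩
  · rw [Measure.sum_apply _ measurableSet_Iic, ENNReal.tsum_eq_zero]
    intro n
    rw [Measure.map_apply (hzm n) measurableSet_Iic,
      withDensity_apply _ ((hzm n) measurableSet_Iic), setLIntegral_congr_fun (g := 0)
      ((hzm n) measurableSet_Iic)]
    · simp
    · intro s hs
      simpa using hs
  · have hkm : Measurable fun z : ℝ => ∫⁻ u in Icc α β, k (u * z) := by
      have : Measurable fun p : ℝ × ℝ => k (p.2 * p.1) := by fun_prop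
      exact this.lintegral_prod_right'
    rw [lintegral_sum_measure]
    have h1 : ∀ n, ∫⁻ y, (∫⁻ u in Icc α β, k (u * y)) ∂(((volume.restrict (Ioi 0)).withDensity
        fun s => ENNReal.ofReal (z n s)).map (z n)) =
        ∫⁻ s in Ioi 0, (∫⁻ y in Ioc (g s * q ^ (n + 1)) (g s * q ^ n), k y) := by
      intro n
      have hkm2 : Measurable fun s => ∫⁻ u in Icc α β, k (u * z n s) := hkm.comp (hzm n)
      rw [lintegral_map hkm (hzm n), lintegral_withDensity_eq_lintegral_mul _
        (hzm n).ennreal_ofReal hkm2]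
      refine lintegral_congr fun s => ?_
      simp only [Pi.mul_apply]
      rw [setLIntegral_congr Ioc_ae_eq_Icc.symm, ← lintegral_Ioc_mul (hz0 n s)]
      congr 3
      · simp only [hz, hq, pow_succ]; field_simp
      · simp only [hz]; field_simp
    have hswap : ∀ n, Measurable fun s => ∫⁻ y in Ioc (g s * q ^ (n + 1)) (g s * q ^ n), k y := by
      intro n
      have : Measurable fun p : ℝ × ℝ =>
          (Ioc (g p.1 * q ^ (n + 1)) (g p.1 * q ^ n)).indicator k p.2 := by
        have hs : MeasurableSet {p : ℝ × ℝ | p.2 ∈ Ioc (g p.1 * q ^ (n + 1)) (g p.1 * q ^ n)} := by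
          change MeasurableSet
            ({p : ℝ × ℝ | g p.1 * q ^ (n + 1) < p.2} ∩ {p : ℝ × ℝ | p.2 ≤ g p.1 * q ^ n})
          exact (measurableSet_lt (by fun_prop) (by fun_prop)).inter
            (measurableSet_le (by fun_prop) (by fun_prop))
        exact (hk.comp measurable_snd).indicator hs
      have := this.lintegral_prod_right' (ν := volume)
      simpa only [lintegral_indicator measurableSet_Ioc] using this
    simp_rw [h1]
    rw [← lintegral_tsum fun n => (hswap n).aemeasurable]
    have h2 : ∀ s ∈ Ioi (0 : ℝ), ∑' n : ℕ, ∫⁻ y in Ioc (g s * q ^ (n + 1)) (g s * q ^ n), k y =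
        ∫⁻ y in Ioi 0, {y | s < h y}.indicator k y := by
      intro s hs
      rw [← lintegral_Ioc_zero_eq_tsum hq0 hq1 ENNReal.toReal_nonneg,
        setLIntegral_congr (hset s hs).symm,
        lintegral_indicator (measurableSet_lt measurable_const hm), Measure.restrict_restrict
        (measurableSet_lt measurable_const hm)]
    rw [setLIntegral_congr_fun measurableSet_Ioi h2, lintegral_lintegral_swap]
    · refine lintegral_congr fun y => ?_
      have h3 : ∀ s, {y | s < h y}.indicator k y = (Iio (h y)).indicator (fun _ => k y) s := by
        intro s
        simp [indicator]
      simp_rw [h3]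
      rw [lintegral_indicator measurableSet_Iio, lintegral_const, Measure.restrict_restrict
        measurableSet_Iio, Measure.restrict_apply_univ, Iio_inter_Ioi, Real.volume_Ioo, sub_zero]
    · have hs : MeasurableSet {p : ℝ × ℝ | p.1 < h p.2} :=
        measurableSet_lt measurable_fst (hm.comp measurable_snd)
      exact ((hk.comp measurable_snd).indicator hs).aemeasurable

/-- The points `y > 0` for which `exp (σ * y ^ r / r)` lies in `(α, β)`. -/
def sideSet (α β r σ : ℝ) : Set ℝ := {y | 0 < y ∧ Real.exp (σ * y ^ r / r) ∈ Ioo α β}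

lemma measurableSet_sideSet (α β r σ : ℝ) : MeasurableSet (sideSet α β r σ) :=
  measurableSet_Ioi.inter (measurableSet_Ioo.preimage (by fun_prop))

/-- The density, with respect to `y = |log (u ^ r)| ^ (1 / r)`, of Lebesgue measure on one of the
two sides of `1` in `(α, β)`. -/
noncomputable def sideDensity (α β r σ : ℝ) : ℝ → ℝ :=
  (sideSet α β r σ).indicator fun y => y ^ (r - 1) * Real.exp (σ * y ^ r / r)

lemma measurable_sideDensity (α β r σ : ℝ) : Measurable (sideDensity α β r σ) :=
  Measurable.indicator (by fun_prop) (measurableSet_sideSet α β r σ)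

/-- Substitution u = exp (σ y ^ r / r), for which u ^ r = exp (σ y ^ r) and du = y ^ (r - 1) u dy up
to sign. -/
lemma lintegral_sideDensity {α β r σ : ℝ} (hα : 0 ≤ α) (hr : 0 < r) (hσ : σ = 1 ∨ σ = -1)
    (k : ℝ → ENNReal) :
    ∫⁻ y in Ioi 0, k (Real.exp (σ * y ^ r)) * ENNReal.ofReal (sideDensity α β r σ y) =
      ∫⁻ u in Ioo α β ∩ {u | 0 < σ * Real.log u}, k (u ^ r) := by
  have hσ2 : σ * σ = 1 := by rcases hσ with rfl | rfl <;> norm_num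
  have hσ0 : σ ≠ 0 := by rintro rfl; simp at hσ2
  have himg : (fun y => Real.exp (σ * y ^ r / r)) '' sideSet α β r σ =
      Ioo α β ∩ {u | 0 < σ * Real.log u} := by
    ext u
    constructor
    · rintro ⟨y, ⟨hy0, hy⟩, rfl⟩
      refine ⟨hy, ?_⟩
      simp only [mem_ofPred_eq, Real.log_exp]
      have : σ * (σ * y ^ r / r) = y ^ r / r := by linear_combination (y ^ r / r) * hσ2
      rw [this]
      exact div_pos (Real.rpow_pos_of_pos hy0 _) hr
    · rintro ⟨hu, hu2⟩
      have hu0 : 0 < u := hα.trans_lt hu.1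
      have hp : 0 < r * (σ * Real.log u) := mul_pos hr hu2
      have hy : Real.exp (σ * ((r * (σ * Real.log u)) ^ (1 / r)) ^ r / r) = u := by
        rw [← Real.rpow_mul hp.le, one_div_mul_cancel hr.ne', Real.rpow_one]
        have : σ * (r * (σ * Real.log u)) / r = Real.log u := by
          field_simp
          linear_combination Real.log u * hσ2
        rw [this, Real.exp_log hu0]
      refine ⟨(r * (σ * Real.log u)) ^ (1 / r), ⟨Real.rpow_pos_of_pos hp _, ?_⟩, hy⟩
      rwa [hy]
  rw [← himg, lintegral_image_eq_lintegral_abs_deriv_mul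
    (f' := fun y => Real.exp (σ * y ^ r / r) * (σ * (r * y ^ (r - 1)) / r))
    (measurableSet_sideSet α β r σ)]
  · have h1 : ∀ y, k (Real.exp (σ * y ^ r)) * ENNReal.ofReal (sideDensity α β r σ y) =
        (sideSet α β r σ).indicator (fun y => k (Real.exp (σ * y ^ r)) *
          ENNReal.ofReal (y ^ (r - 1) * Real.exp (σ * y ^ r / r))) y := by
      intro y
      by_cases hy : y ∈ sideSet α β r σ <;> simp [sideDensity, hy]
    simp_rw [h1]
    rw [lintegral_indicator (measurableSet_sideSet α β r σ), Measure.restrict_restrict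
      (measurableSet_sideSet α β r σ), inter_eq_left.2 (fun y hy => hy.1)]
    refine setLIntegral_congr_fun (measurableSet_sideSet α β r σ) fun y hy => ?_
    have habs : |σ| = 1 := by rcases hσ with rfl | rfl <;> simp
    have e1 : |Real.exp (σ * y ^ r / r) * (σ * (r * y ^ (r - 1)) / r)| =
        y ^ (r - 1) * Real.exp (σ * y ^ r / r) := by
      have : σ * (r * y ^ (r - 1)) / r = σ * y ^ (r - 1) := by field_simp
      rw [this, abs_mul, abs_mul, habs, Real.abs_exp, abs_of_pos (Real.rpow_pos_of_pos hy.1 _)]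
      ring
    have e2 : Real.exp (σ * y ^ r / r) ^ r = Real.exp (σ * y ^ r) := by
      rw [← Real.exp_mul, div_mul_cancel₀ _ hr.ne']
    simp only [e1, e2]
    rw [mul_comm]
  · intro y hy
    exact (((Real.hasDerivAt_rpow_const (Or.inl hy.1.ne')).const_mul σ).div_const r).exp
      |>.hasDerivWithinAt
  · intro x hx y hy hxy
    simp only [Real.exp_eq_exp] at hxy
    rw [div_left_inj' hr.ne', mul_right_inj' hσ0] at hxy
    exact (Real.rpow_left_inj hx.1.le hy.1.le hr.ne').1 hxy

namespace TowerParam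

variable {α β r : ℝ} (h : TowerParam α β r)
include h

/-- The logarithmic derivative (r - 1 + y ^ r) / y is nonpositive when y ^ r ≤ 1 - r, and on the
support y ^ r < r log β ≤ 1 - r: here the bound on `r` enters. The support starts at 0 because α ≤
1. The proof replaces the derivative by the tangent inequality for exp. -/
lemma sideDensity_antitoneOn_pos : AntitoneOn (sideDensity α β r 1) (Ioi 0) := by
  intro x hx y hy hxy
  have hr := h.pos
  have hx0 : 0 < x := hx
  have hy0 : 0 < y := hy
  have hxr : x ^ r ≤ y ^ r := Real.rpow_le_rpow hx0.le hxy hr.le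
  by_cases hyJ : y ∈ sideSet α β r 1
  · have hxJ : x ∈ sideSet α β r 1 := by
      refine ⟨hx0, lt_of_le_of_lt h.le_one ?_, lt_of_le_of_lt ?_ hyJ.2.2⟩
      · rw [Real.one_lt_exp_iff]
        have := Real.rpow_pos_of_pos hx0 r
        positivity
      · rw [Real.exp_le_exp]
        gcongr
    rw [sideDensity, indicator_of_mem hxJ, indicator_of_mem hyJ, Real.rpow_def_of_pos hx0,
      Real.rpow_def_of_pos hy0 (r - 1), ← Real.exp_add, ← Real.exp_add, Real.exp_le_exp]
    have hv : y ^ r ≤ 1 - r := by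
      have h1 : 1 * y ^ r / r < Real.log β := (Real.lt_log_iff_exp_lt h.beta_pos).2 hyJ.2.2
      rw [one_mul, div_lt_iff₀ hr] at h1
      linarith [h.mul_log_le]
    have hv1 : 0 < x ^ r := Real.rpow_pos_of_pos hx0 r
    have hv2 : 0 < y ^ r := Real.rpow_pos_of_pos hy0 r
    have h2 : 1 - x ^ r / y ^ r ≤ r * (Real.log y - Real.log x) := by
      have := Real.add_one_le_exp (r * (Real.log x - Real.log y))
      have e : Real.exp (r * (Real.log x - Real.log y)) = x ^ r / y ^ r := by
        rw [Real.rpow_def_of_pos hx0, Real.rpow_def_of_pos hy0, ← Real.exp_sub]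
        ring_nf
      rw [e] at this
      linarith
    have h3 : y ^ r - x ^ r ≤ (1 - r) * (r * (Real.log y - Real.log x)) := by
      calc y ^ r - x ^ r = y ^ r * (1 - x ^ r / y ^ r) := by field_simp
        _ ≤ (1 - r) * (1 - x ^ r / y ^ r) := by
            refine mul_le_mul_of_nonneg_right hv ?_
            rw [sub_nonneg, div_le_one hv2]
            exact hxr
        _ ≤ _ := mul_le_mul_of_nonneg_left h2 (by linarith [h.r_le_one])
    have h4 : (y ^ r - x ^ r) / r ≤ (1 - r) * (Real.log y - Real.log x) := by
      rw [div_le_iff₀ hr]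
      linarith
    rw [sub_div] at h4
    rw [one_mul, one_mul]
    linarith
  · rw [sideDensity, indicator_of_notMem hyJ]
    exact indicator_nonneg (fun z hz => mul_nonneg (Real.rpow_nonneg hz.1.le _)
      (Real.exp_pos _).le) x

/-- Both factors decrease because r ≤ 1, and the support starts at 0 because β ≥ 1. -/
lemma sideDensity_antitoneOn_neg : AntitoneOn (sideDensity α β r (-1)) (Ioi 0) := by
  intro x hx y hy hxy
  have hr := h.pos
  have hx0 : 0 < x := hx
  have hy0 : 0 < y := hy
  have hxr : x ^ r ≤ y ^ r := Real.rpow_le_rpow hx0.le hxy hr.le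
  have hle : Real.exp (-1 * y ^ r / r) ≤ Real.exp (-1 * x ^ r / r) := by
    rw [Real.exp_le_exp, div_le_div_iff_of_pos_right hr]
    linarith
  by_cases hyJ : y ∈ sideSet α β r (-1)
  · have hxJ : x ∈ sideSet α β r (-1) := by
      refine ⟨hx0, lt_of_lt_of_le hyJ.2.1 hle, lt_of_lt_of_le ?_ h.one_le⟩
      rw [Real.exp_lt_one_iff]
      have := Real.rpow_pos_of_pos hx0 r
      exact div_neg_of_neg_of_pos (by linarith) hr
    rw [sideDensity, indicator_of_mem hxJ, indicator_of_mem hyJ]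
    exact mul_le_mul (Real.rpow_le_rpow_of_nonpos hx0 hxy (by linarith [h.r_le_one])) hle
      (Real.exp_pos _).le (Real.rpow_nonneg hx0.le _)
  · rw [sideDensity, indicator_of_notMem hyJ]
    exact indicator_nonneg (fun z hz => mul_nonneg (Real.rpow_nonneg hz.1.le _)
      (Real.exp_pos _).le) x

/-- With a = exp (σ z ^ r) one has a ^ (u ^ r) = exp (σ (u z) ^ r), so a Khinchine mixture over `z`
pushes forward to a solution on one side. -/
lemma exists_side_measure {σ : ℝ} (hσ : σ = 1 ∨ σ = -1) : ∃ ν : Measure ℝ, ν (Iic 0) = 0 ∧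
    ∀ k : ℝ → ENNReal, Measurable k → ∫⁻ a, (∫⁻ u in Icc α β, k (a ^ (u ^ r))) ∂ν =
      ∫⁻ u in Ioo α β ∩ {u | 0 < σ * Real.log u}, k (u ^ r) := by
  have hanti : AntitoneOn (sideDensity α β r σ) (Ioi 0) := by
    rcases hσ with rfl | rfl
    · exact h.sideDensity_antitoneOn_pos
    · exact h.sideDensity_antitoneOn_neg
  have hfin : ∫⁻ y in Ioi 0, ENNReal.ofReal (sideDensity α β r σ y) ≠ ⊤ := by
    have h1 := lintegral_sideDensity (β := β) h.nonneg h.pos hσ 1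
    simp only [Pi.one_apply, one_mul, lintegral_one, Measure.restrict_apply_univ] at h1
    rw [h1]
    exact ((measure_mono inter_subset_left).trans_lt (measure_Ioo_lt_top (a := α) (b := β))).ne
  obtain ⟨κ, hκ0, hκ⟩ := exists_mixture_of_antitoneOn h.nonneg h.lt
    (measurable_sideDensity α β r σ) hanti hfin
  refine ⟨κ.map fun z => Real.exp (σ * z ^ r), ?_, fun k hk => ?_⟩
  · rw [Measure.map_apply (by fun_prop) measurableSet_Iic]
    have : (fun z : ℝ => Real.exp (σ * z ^ r)) ⁻¹' Iic 0 = ∅ := by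
      ext z
      simp [Real.exp_pos]
    simp [this]
  · have hkm : Measurable fun a : ℝ => ∫⁻ u in Icc α β, k (a ^ (u ^ r)) := by
      have : Measurable fun p : ℝ × ℝ => k (p.1 ^ (p.2 ^ r)) := by fun_prop
      exact this.lintegral_prod_right'
    rw [lintegral_map hkm (by fun_prop), ← lintegral_sideDensity h.nonneg h.pos hσ,
      ← hκ (fun y => k (Real.exp (σ * y ^ r))) (by fun_prop)]
    have hae : ∀ᵐ z ∂κ, 0 < z := by
      rw [ae_iff]
      simpa [not_lt, Set.Iic] using hκ0
    refine lintegral_congr_ae ?_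
    filter_upwards [hae] with z hz
    refine setLIntegral_congr_fun measurableSet_Icc fun u hu => ?_
    rw [← Real.exp_mul, Real.mul_rpow (h.nonneg.trans hu.1) hz.le]
    ring_nf

/-- Existence of an inverse tower distribution, as a solution of the fixed-point equation. -/
theorem exists_isPowerFixed : ∃ μ : Measure ℝ, IsPowerFixed α β r μ := by
  obtain ⟨ν₁, h10, h1⟩ := h.exists_side_measure (Or.inl rfl)
  obtain ⟨ν₂, h20, h2⟩ := h.exists_side_measure (Or.inr rfl)
  have hfix : ∀ k : ℝ → ENNReal, Measurable k →
      ∫⁻ a, (∫⁻ u in Icc α β, k (a ^ (u ^ r))) ∂(ν₁ + ν₂) = ∫⁻ u in Icc α β, k (u ^ r) := by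
    intro k hk
    rw [lintegral_add_measure, h1 k hk, h2 k hk, ← lintegral_union, ← inter_union_distrib_left]
    · refine setLIntegral_congr ?_
      have h0 : ∀ᵐ u : ℝ ∂volume, u ≠ 1 ∧ u ≠ α ∧ u ≠ β := by
        have : ∀ c : ℝ, ∀ᵐ u : ℝ ∂volume, u ≠ c := fun c => by simp [ae_iff]
        filter_upwards [this 1, this α, this β] with u h1 h2 h3 using ⟨h1, h2, h3⟩
      filter_upwards [h0] with u ⟨hu1, hu2, hu3⟩
      refine propext ⟨fun hu => Ioo_subset_Icc_self hu.1, fun hu => ?_⟩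
      have hu4 : u ∈ Ioo α β := ⟨lt_of_le_of_ne hu.1 hu2.symm, lt_of_le_of_ne hu.2 hu3⟩
      refine ⟨hu4, ?_⟩
      have hu0 : 0 < u := h.nonneg.trans_lt hu4.1
      rcases lt_or_gt_of_ne hu1 with hlt | hgt
      · right
        have := Real.log_neg hu0 hlt
        simp only [mem_ofPred_eq]
        linarith
      · left
        have := Real.log_pos hgt
        simp only [mem_ofPred_eq]
        linarith
    · exact measurableSet_Ioo.inter (measurableSet_lt measurable_const (by fun_prop))
    · rw [Set.disjoint_left]
      rintro u ⟨_, hu1⟩ ⟨_, hu2⟩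
      simp only [mem_ofPred_eq] at hu1 hu2
      linarith
  refine ⟨ν₁ + ν₂, ⟨?_⟩, by simp [h10, h20], hfix⟩
  -- The constant test function forces total mass one.
  have h3 := hfix 1 measurable_one
  simp only [Pi.one_apply, lintegral_one, Measure.restrict_apply_univ, lintegral_const] at h3
  rw [Real.volume_Icc] at h3
  have h4 : ENNReal.ofReal (β - α) ≠ 0 := by simpa using h.lt
  exact (ENNReal.mul_right_inj h4 ENNReal.ofReal_ne_top).1 (h3.trans (mul_one _).symm)

end TowerParam

/-! ### The fixed-point equation on each side of 1, in density form. -/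

/-- The law of `σ * log A` on `(0, ∞)`, for `A` of law `μ`. -/
noncomputable def sideLaw (μ : Measure ℝ) (σ : ℝ) : Measure ℝ :=
  (μ.map fun a => σ * Real.log a).restrict (Ioi 0)

instance (μ : Measure ℝ) [IsFiniteMeasure μ] (σ : ℝ) : IsFiniteMeasure (sideLaw μ σ) := by
  unfold sideLaw
  infer_instance

/-- The pair of a set of values for `u` and its size-biasing weight `u`. -/
noncomputable def sizeBias (S : Set ℝ) (u : ℝ) : ENNReal := S.indicator (fun u => ENNReal.ofReal u) u

lemma measurable_sizeBias {S : Set ℝ} (hS : MeasurableSet S) : Measurable (sizeBias S) :=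
  ENNReal.measurable_ofReal.indicator hS

/-- Since u ^ r > 0, the sign of log (a ^ (u ^ r)) is that of log a, so the two half-lines decouple.
The set `S` is a version of [α, β] avoiding 0, with endpoints left free for later choice. -/
lemma IsPowerFixed.lintegral_sideLaw {α β r : ℝ} {μ : Measure ℝ} (h : IsPowerFixed α β r μ)
    {S : Set ℝ} (hS : MeasurableSet S) (hS0 : S ⊆ Ioi 0) (hSae : S =ᵐ[volume] Icc α β) (σ : ℝ)
    {k : ℝ → ENNReal} (hk : Measurable k) :
    ∫⁻ d, (∫⁻ u in S, k (d * u ^ r)) ∂sideLaw μ σ =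
      ∫⁻ u in S ∩ {u | 0 < σ * (r * Real.log u)}, k (σ * (r * Real.log u)) := by
  have hk1 : Measurable fun t => (Ioi (0 : ℝ)).indicator k (σ * Real.log t) :=
    (hk.indicator measurableSet_Ioi).comp (by fun_prop)
  have hm : Measurable fun d : ℝ => ∫⁻ u in S, k (d * u ^ r) := by
    have : Measurable fun p : ℝ × ℝ => k (p.1 * p.2 ^ r) := by fun_prop
    exact this.lintegral_prod_right'
  have h1 := h.fixed _ hk1
  simp_rw [← setLIntegral_congr hSae] at h1
  have hms : MeasurableSet {u : ℝ | 0 < σ * (r * Real.log u)} :=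
    measurableSet_lt measurable_const (by fun_prop)
  have h2 : ∫⁻ u in S, (Ioi (0 : ℝ)).indicator k (σ * Real.log (u ^ r)) =
      ∫⁻ u in S ∩ {u | 0 < σ * (r * Real.log u)}, k (σ * (r * Real.log u)) := by
    rw [inter_comm, ← Measure.restrict_restrict hms, ← lintegral_indicator hms]
    refine setLIntegral_congr_fun hS fun u hu => ?_
    have hu0 : 0 < u := hS0 hu
    simp only [Real.log_rpow hu0]
    simp only [indicator, mem_Ioi, mem_ofPred_eq]
  rw [← h2, ← h1, sideLaw, ← lintegral_indicator measurableSet_Ioi,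
    lintegral_map (hm.indicator measurableSet_Ioi) (by fun_prop)]
  refine lintegral_congr_ae ?_
  filter_upwards [h.ae_pos] with a ha
  have h3 : ∀ u ∈ S, (Ioi (0 : ℝ)).indicator k (σ * Real.log (a ^ u ^ r)) =
      (Ioi (0 : ℝ)).indicator (fun _ => k (σ * Real.log a * u ^ r)) (σ * Real.log a) := by
    intro u hu
    have hu0 : 0 < u ^ r := Real.rpow_pos_of_pos (hS0 hu) r
    have e : σ * (u ^ r * Real.log a) = σ * Real.log a * u ^ r := by ring
    rw [Real.log_rpow ha, e]
    by_cases hc : 0 < σ * Real.log a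
    · simp [hc, mul_pos hc hu0]
    · have : ¬0 < σ * Real.log a * u ^ r := fun h => hc (pos_of_mul_pos_left h hu0.le)
      simp [hc, this]
  rw [setLIntegral_congr_fun hS h3]
  by_cases hc : 0 < σ * Real.log a
  · simp [hc]
  · simp [hc]

/-- Substituting y = d u ^ r turns |r| y du into u dy, which is the source of the size bias. -/
lemma lintegral_scaled_rpow {S : Set ℝ} (hS : MeasurableSet S) (hS0 : S ⊆ Ioi 0) {r d : ℝ}
    (hr : r ≠ 0) (hd : 0 < d) (k : ℝ → ENNReal) :
    ∫⁻ u in S, k (d * u ^ r) * ENNReal.ofReal (|r| * (d * u ^ r)) =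
      ∫⁻ y in Ioi 0, k y * sizeBias S ((y / d) ^ (1 / r)) := by
  have hinv : ∀ u, 0 < u → (d * u ^ r / d) ^ (1 / r) = u := fun u hu => by
    rw [mul_div_cancel_left₀ _ hd.ne', ← Real.rpow_mul hu.le, mul_one_div_cancel hr, Real.rpow_one]
  have hmT : MeasurableSet ((fun y : ℝ => (y / d) ^ (1 / r)) ⁻¹' S) := hS.preimage (by fun_prop)
  have himg : (fun u => d * u ^ r) '' S = (fun y : ℝ => (y / d) ^ (1 / r)) ⁻¹' S ∩ Ioi 0 := by
    ext y
    constructor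
    · rintro ⟨u, hu, rfl⟩
      exact ⟨by simpa only [mem_preimage, hinv u (hS0 hu)] using hu,
        mul_pos hd (Real.rpow_pos_of_pos (hS0 hu) r)⟩
    · rintro ⟨hy, hy0⟩
      refine ⟨_, hy, ?_⟩
      have : 0 < y / d := div_pos hy0 hd
      simp only []
      rw [← Real.rpow_mul this.le, one_div_mul_cancel hr, Real.rpow_one]
      field_simp
  have h1 := lintegral_image_eq_lintegral_abs_deriv_mul (f := fun u => d * u ^ r)
    (f' := fun u => d * (r * u ^ (r - 1))) hS
    (fun u hu => ((Real.hasDerivAt_rpow_const (Or.inl (hS0 hu).ne')).const_mul d).hasDerivWithinAt)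
    (fun u hu v hv huv => by rw [← hinv u (hS0 hu), ← hinv v (hS0 hv)]; simp only [] at huv; rw [huv])
    (fun y => k y * sizeBias S ((y / d) ^ (1 / r)))
  have h2 : ∫⁻ y in Ioi 0, k y * sizeBias S ((y / d) ^ (1 / r)) =
      ∫⁻ y in (fun u => d * u ^ r) '' S, k y * sizeBias S ((y / d) ^ (1 / r)) := by
    rw [himg, ← Measure.restrict_restrict hmT, ← lintegral_indicator hmT]
    refine lintegral_congr fun y => ?_
    by_cases hy : (y / d) ^ (1 / r) ∈ S <;> simp only [sizeBias, indicator, mem_preimage, hy] <;> simp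
  rw [h2, h1]
  refine setLIntegral_congr_fun hS fun u hu => ?_
  have hu0 : 0 < u := hS0 hu
  rw [hinv u hu0, sizeBias, indicator_of_mem hu,
    mul_left_comm (ENNReal.ofReal _) (k _), ← ENNReal.ofReal_mul (abs_nonneg _),
    abs_mul, abs_mul, abs_of_pos hd, abs_of_pos (Real.rpow_pos_of_pos hu0 _)]
  congr 2
  rw [Real.rpow_sub_one hu0.ne']
  field_simp

lemma lintegral_scaled_log {S : Set ℝ} (hS : MeasurableSet S) (hS0 : S ⊆ Ioi 0) {r σ : ℝ}
    (hr : r ≠ 0) (hσ : σ = 1 ∨ σ = -1) (k : ℝ → ENNReal) :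
    ∫⁻ u in S ∩ {u | 0 < σ * (r * Real.log u)},
        k (σ * (r * Real.log u)) * ENNReal.ofReal (|r| * (σ * (r * Real.log u))) =
      ∫⁻ y in Ioi 0, k y * (ENNReal.ofReal y * sizeBias S (Real.exp (σ * y / r))) := by
  have hσ2 : σ * σ = 1 := by rcases hσ with rfl | rfl <;> norm_num
  have habs : |σ| = 1 := by rcases hσ with rfl | rfl <;> simp
  have hinv : ∀ u, 0 < u → Real.exp (σ * (σ * (r * Real.log u)) / r) = u := fun u hu => by
    rw [← mul_assoc, hσ2, one_mul, mul_div_cancel_left₀ _ hr, Real.exp_log hu]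
  have hmT : MeasurableSet ((fun y : ℝ => Real.exp (σ * y / r)) ⁻¹' S) := hS.preimage (by fun_prop)
  have hms : MeasurableSet (S ∩ {u : ℝ | 0 < σ * (r * Real.log u)}) :=
    hS.inter (measurableSet_lt measurable_const (by fun_prop))
  have himg : (fun u => σ * (r * Real.log u)) '' (S ∩ {u | 0 < σ * (r * Real.log u)}) =
      (fun y : ℝ => Real.exp (σ * y / r)) ⁻¹' S ∩ Ioi 0 := by
    ext y
    constructor
    · rintro ⟨u, ⟨hu, hu1⟩, rfl⟩
      exact ⟨by simpa only [mem_preimage, hinv u (hS0 hu)] using hu, hu1⟩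
    · rintro ⟨hy, hy0⟩
      have e : σ * (r * Real.log (Real.exp (σ * y / r))) = y := by
        rw [Real.log_exp, mul_div_cancel₀ _ hr, ← mul_assoc, hσ2, one_mul]
      refine ⟨_, ⟨hy, ?_⟩, e⟩
      rw [mem_ofPred_eq, e]
      exact hy0
  have h1 := lintegral_image_eq_lintegral_abs_deriv_mul (f := fun u => σ * (r * Real.log u))
    (f' := fun u => σ * (r * u⁻¹)) hms
    (fun u hu => (((Real.hasDerivAt_log (hS0 hu.1).ne').const_mul r).const_mul σ).hasDerivWithinAt)
    (fun u hu v hv huv => by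
      rw [← hinv u (hS0 hu.1), ← hinv v (hS0 hv.1)]; simp only [] at huv; rw [huv])
    (fun y => k y * (ENNReal.ofReal y * sizeBias S (Real.exp (σ * y / r))))
  have h2 : ∫⁻ y in Ioi 0, k y * (ENNReal.ofReal y * sizeBias S (Real.exp (σ * y / r))) =
      ∫⁻ y in (fun u => σ * (r * Real.log u)) '' (S ∩ {u | 0 < σ * (r * Real.log u)}),
        k y * (ENNReal.ofReal y * sizeBias S (Real.exp (σ * y / r))) := by
    rw [himg, ← Measure.restrict_restrict hmT, ← lintegral_indicator hmT]
    refine lintegral_congr fun y => ?_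
    by_cases hy : Real.exp (σ * y / r) ∈ S <;> simp only [sizeBias, indicator, mem_preimage, hy] <;> simp
  rw [h2, h1]
  refine setLIntegral_congr_fun hms fun u hu => ?_
  have hu0 : 0 < u := hS0 hu.1
  have hu1 : 0 < σ * (r * Real.log u) := hu.2
  rw [hinv u hu0, sizeBias, indicator_of_mem hu.1, ← ENNReal.ofReal_mul hu1.le,
    mul_left_comm (ENNReal.ofReal _) (k _),
    ← ENNReal.ofReal_mul (abs_nonneg _), abs_mul, abs_mul, habs, abs_inv, abs_of_pos hu0]
  congr 2
  field_simp

/-- The fixed-point equation for the law of `A`, in terms of densities. -/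
theorem IsPowerFixed.density_eq {α β r : ℝ} {μ : Measure ℝ} (h : IsPowerFixed α β r μ)
    {S : Set ℝ} (hS : MeasurableSet S) (hS0 : S ⊆ Ioi 0) (hSae : S =ᵐ[volume] Icc α β)
    (hr : r ≠ 0) {σ : ℝ} (hσ : σ = 1 ∨ σ = -1) :
    ∀ᵐ y, 0 < y → ∫⁻ d, sizeBias S ((y / d) ^ (1 / r)) ∂sideLaw μ σ =
      ENNReal.ofReal y * sizeBias S (Real.exp (σ * y / r)) := by
  have := h.prob
  suffices H : (fun y => ∫⁻ d, sizeBias S ((y / d) ^ (1 / r)) ∂sideLaw μ σ) =ᵐ[volume.restrict (Ioi 0)]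
      fun y => ENNReal.ofReal y * sizeBias S (Real.exp (σ * y / r)) from
    (ae_restrict_iff' measurableSet_Ioi).1 H
  have hsm := measurable_sizeBias hS
  have hmp : Measurable fun p : ℝ × ℝ => sizeBias S ((p.1 / p.2) ^ (1 / r)) :=
    hsm.comp (by fun_prop)
  refine ae_eq_of_forall_setLIntegral_eq_of_sigmaFinite hmp.lintegral_prod_right'
    (ENNReal.measurable_ofReal.mul (hsm.comp (by fun_prop))) fun s hs _ => ?_
  set k : ℝ → ENNReal := s.indicator 1 with hk
  have hkm : Measurable k := measurable_one.indicator hs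
  -- The extra factor |r| y cancels the Jacobians on both sides, leaving integrals against dy that
  -- can be compared on every set `s`.
  have h1 := h.lintegral_sideLaw hS hS0 hSae σ (k := fun y => k y * ENNReal.ofReal (|r| * y))
    (by fun_prop)
  rw [lintegral_scaled_log hS hS0 hr hσ] at h1
  have h2 : ∫⁻ d, (∫⁻ u in S, k (d * u ^ r) * ENNReal.ofReal (|r| * (d * u ^ r))) ∂sideLaw μ σ =
      ∫⁻ d, (∫⁻ y in Ioi 0, k y * sizeBias S ((y / d) ^ (1 / r))) ∂sideLaw μ σ := by
    refine lintegral_congr_ae ?_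
    have : ∀ᵐ d ∂sideLaw μ σ, d ∈ Ioi (0 : ℝ) := ae_restrict_mem measurableSet_Ioi
    filter_upwards [this] with d hd
    exact lintegral_scaled_rpow hS hS0 hr hd k
  rw [h2, lintegral_lintegral_swap] at h1
  · have e : ∀ f : ℝ → ENNReal, ∫⁻ y in Ioi 0, k y * f y = ∫⁻ y in s, f y ∂volume.restrict (Ioi 0) := by
      intro f
      rw [← lintegral_indicator hs]
      refine lintegral_congr fun y => ?_
      by_cases hy : y ∈ s <;> simp [hk, hy]
    rw [← e, ← e, ← h1]
    refine lintegral_congr fun y => ?_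
    rw [lintegral_const_mul]
    exact hsm.comp (by fun_prop)
  · have : Measurable fun p : ℝ × ℝ => k p.2 * sizeBias S ((p.2 / p.1) ^ (1 / r)) :=
      (hkm.comp measurable_snd).mul (hsm.comp (by fun_prop))
    exact this.aemeasurable

/-! ### Measures with prescribed window masses. -/

/-- The window `(v, v / c]` (read as `(v, ∞)` for `c = 0`). -/
def window (c v : ℝ) : Set ℝ := {x | c * x ≤ v ∧ v < x}

lemma measurableSet_window (c v : ℝ) : MeasurableSet (window c v) := by
  change MeasurableSet ({x | c * x ≤ v} ∩ {x | v < x})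
  exact (measurableSet_le (by fun_prop) measurable_const).inter
    (measurableSet_lt measurable_const measurable_id)

lemma exists_mem_Ioo_of_ae {p : ℝ → Prop} (hp : ∀ᵐ v, p v) {a b : ℝ} (hab : a < b) :
    ∃ v ∈ Ioo a b, p v := by
  by_contra hcon
  push Not at hcon
  have h1 : volume (Ioo a b) = 0 := measure_mono_null (fun v hv => hcon v hv) hp
  simp at h1
  exact absurd hab (not_lt.2 h1)

lemma window_mem_nhds {c v x : ℝ} (h1 : c * x < v) (h2 : v < x) : window c v ∈ 𝓝 x := by
  have ho : IsOpen ({x : ℝ | c * x < v} ∩ {x | v < x}) :=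
    (isOpen_lt (by fun_prop) continuous_const).inter (isOpen_lt continuous_const continuous_id)
  exact Filter.mem_of_superset (ho.mem_nhds ⟨h1, h2⟩) fun y hy => ⟨hy.1.le, hy.2⟩

section Window

variable {M : Measure ℝ} {c : ℝ}

/-- Nullity is local, and each x > b is interior to the window of some admissible `v` slightly below
x. -/
lemma measure_Ioi_eq_zero_of_window (hc1 : c < 1) {b : ℝ} (hb : 0 ≤ b)
    (h : ∀ᵐ v, b < v → M (window c v) = 0) : M (Ioi b) = 0 := by
  refine measure_null_of_locally_null _ fun x hx => ?_
  have hx' : b < x := hx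
  have hx0 : 0 < x := hb.trans_lt hx
  obtain ⟨v, ⟨hv1, hv2⟩, hv⟩ := exists_mem_Ioo_of_ae h
    (max_lt hx' (by nlinarith : c * x < x))
  exact ⟨window c v, mem_nhdsWithin_of_mem_nhds
    (window_mem_nhds ((le_max_right _ _).trans_lt hv1) hv2), hv ((le_max_left _ _).trans_lt hv1)⟩

lemma measure_lower_eq_zero_of_window (hc0 : 0 ≤ c) (hc1 : c < 1) {a : ℝ}
    (h : ∀ᵐ v, 0 < v → v < a → M (window c v) = 0) : M {x | 0 < x ∧ c * x < a} = 0 := by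
  refine measure_null_of_locally_null _ fun x hx => ?_
  have hx0 : 0 < x := hx.1
  obtain ⟨v, ⟨hv1, hv2⟩, hv⟩ := exists_mem_Ioo_of_ae h
    (lt_min (by nlinarith : c * x < x) hx.2)
  exact ⟨window c v, mem_nhdsWithin_of_mem_nhds
    (window_mem_nhds hv1 (hv2.trans_le (min_le_left _ _))),
    hv ((mul_nonneg hc0 hx0.le).trans_lt hv1) (hv2.trans_le (min_le_right _ _))⟩

/-- As `v` grows the window loses points on the left and gains only points of the null set, so its
mass cannot increase. -/
lemma not_strictMonoOn_of_window {d b : ℝ} (hdb : d < b) {φ : ℝ → ℝ}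
    (hnull : M {x | d < c * x} = 0) (hφ0 : ∀ v ∈ Ioo d b, 0 ≤ φ v)
    (h : ∀ᵐ v, v ∈ Ioo d b → M (window c v) = ENNReal.ofReal (φ v)) :
    ¬StrictMonoOn φ (Ioo d b) := by
  intro hφ
  obtain ⟨v₁, hv1, h1⟩ := exists_mem_Ioo_of_ae h hdb
  obtain ⟨v₂, hv2, h2⟩ := exists_mem_Ioo_of_ae h hv1.2
  have hv2' : v₂ ∈ Ioo d b := ⟨hv1.1.trans hv2.1, hv2.2⟩
  have hsub : window c v₂ ⊆ window c v₁ ∪ {x | d < c * x} := by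
    intro x hx
    by_cases hx1 : c * x ≤ v₁
    · exact Or.inl ⟨hx1, hv2.1.trans hx.2⟩
    · exact Or.inr (hv1.1.trans (not_le.1 hx1))
  have h3 : M (window c v₂) ≤ M (window c v₁) := by
    refine (measure_mono hsub).trans ((measure_union_le _ _).trans ?_)
    rw [hnull, add_zero]
  rw [h1 hv1, h2 hv2', ENNReal.ofReal_le_ofReal_iff (hφ0 _ hv1)] at h3
  exact absurd (hφ hv1 hv2' hv2.1) (not_lt.2 h3)

/-- Mirror image at the lower edge: the points lost on the left are null, so the mass cannot
decrease. -/
lemma not_strictAntiOn_of_window {a d : ℝ} (had : a < d) (ha : 0 ≤ a) (hcd : ∀ v < d, c * v < a)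
    (hc0 : 0 ≤ c) {φ : ℝ → ℝ}
    (hnull : M {x | 0 < x ∧ c * x < a} = 0) (hφ0 : ∀ v ∈ Ioo a d, 0 ≤ φ v)
    (h : ∀ᵐ v, v ∈ Ioo a d → M (window c v) = ENNReal.ofReal (φ v)) :
    ¬StrictAntiOn φ (Ioo a d) := by
  intro hφ
  obtain ⟨v₁, hv1, h1⟩ := exists_mem_Ioo_of_ae h had
  obtain ⟨v₂, hv2, h2⟩ := exists_mem_Ioo_of_ae h hv1.2
  have hv2' : v₂ ∈ Ioo a d := ⟨hv1.1.trans hv2.1, hv2.2⟩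
  have hsub : window c v₁ ⊆ window c v₂ ∪ {x | 0 < x ∧ c * x < a} := by
    intro x hx
    by_cases hx1 : v₂ < x
    · exact Or.inl ⟨hx.1.trans hv2.1.le, hx1⟩
    · refine Or.inr ⟨(ha.trans_lt hv1.1).trans hx.2, ?_⟩
      exact (mul_le_mul_of_nonneg_left (not_lt.1 hx1) hc0).trans_lt (hcd _ hv2.2)
  have h3 : M (window c v₁) ≤ M (window c v₂) := by
    refine (measure_mono hsub).trans ((measure_union_le _ _).trans ?_)
    rw [hnull, add_zero]
  rw [h1 hv1, h2 hv2', ENNReal.ofReal_le_ofReal_iff (hφ0 _ hv2')] at h3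
  exact absurd (hφ hv1 hv2' hv2.1) (not_lt.2 h3)

lemma sum_measure_window (hc0 : 0 < c) (hc1 : c < 1) {v : ℝ} (hv : 0 < v) (n : ℕ) :
    ∑ j ∈ Finset.range n, M (window c (v / c ^ j)) = M {x | v < x ∧ c ^ n * x ≤ v} := by
  induction n with
  | zero =>
    have : {x : ℝ | v < x ∧ c ^ 0 * x ≤ v} = ∅ := by
      ext x
      simp
    rw [this]
    simp
  | succ n ih =>
    rw [Finset.sum_range_succ, ih, ← measure_union _ (measurableSet_window _ _)]
    · congr 1
      ext x
      have hcn : 0 < c ^ n := pow_pos hc0 n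
      have hcn1 : c ^ n ≤ 1 := pow_le_one₀ hc0.le hc1.le
      simp only [window, mem_union, mem_ofPred_eq, le_div_iff₀ hcn, div_lt_iff₀ hcn, pow_succ]
      constructor
      · rintro (⟨h1, h2⟩ | ⟨h1, h2⟩)
        · refine ⟨h1, le_trans ?_ h2⟩
          nlinarith [mul_pos hcn (hv.trans h1)]
        · refine ⟨?_, by linarith⟩
          rcases lt_or_ge 0 x with hx | hx
          · nlinarith
          · nlinarith
      · rintro ⟨h1, h2⟩
        by_cases h3 : c ^ n * x ≤ v
        · exact Or.inl ⟨h1, h3⟩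
        · exact Or.inr ⟨by linarith, by linarith⟩
    · rw [Set.disjoint_left]
      rintro x ⟨_, h1⟩ ⟨_, h2⟩
      rw [div_lt_iff₀ (pow_pos hc0 n)] at h2
      linarith

lemma ae_forall_mul {p : ℝ → Prop} (hp : ∀ᵐ v, p v) {f : ℕ → ℝ} (hf : ∀ j, f j ≠ 0) :
    ∀ᵐ v : ℝ, ∀ j, p (v * f j) := by
  refine ae_all_iff.2 fun j => ?_
  have hq : Measure.QuasiMeasurePreserving (fun v : ℝ => v * f j) volume volume := by
    refine ⟨by fun_prop, ?_⟩
    rw [Real.map_volume_mul_right (hf j)]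
    exact Measure.smul_absolutelyContinuous
  exact hq.ae hp

/-- The densities `v ^ p * exp (η * v)` occurring for `log (U ^ r)`. -/
noncomputable def expDensity (p η v : ℝ) : ℝ := v ^ p * Real.exp (η * v)

lemma expDensity_pos {p η v : ℝ} (hv : 0 < v) : 0 < expDensity p η v :=
  mul_pos (Real.rpow_pos_of_pos hv _) (Real.exp_pos _)

lemma hasDerivAt_expDensity {p η v : ℝ} (hv : 0 < v) :
    HasDerivAt (expDensity p η) (v ^ (p - 1) * Real.exp (η * v) * (p + η * v)) v := by
  have h1 := Real.hasDerivAt_rpow_const (p := p) (Or.inl hv.ne')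
  have h2 : HasDerivAt (fun v => Real.exp (η * v)) (Real.exp (η * v) * η) v := by
    simpa using ((hasDerivAt_id v).const_mul η).exp
  refine (h1.mul h2).congr_deriv ?_
  have : v ^ p = v ^ (p - 1) * v := by
    rw [Real.rpow_sub_one hv.ne']
    field_simp
  rw [this]
  ring

lemma continuousOn_expDensity {p η : ℝ} : ContinuousOn (expDensity p η) (Ioi 0) :=
  fun _ hv => (hasDerivAt_expDensity hv).continuousAt.continuousWithinAt

lemma strictMonoOn_expDensity {p η a b : ℝ} (ha : 0 ≤ a) (h : ∀ v ∈ Ioo a b, 0 < p + η * v) :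
    StrictMonoOn (expDensity p η) (Ioo a b) := by
  refine strictMonoOn_of_deriv_pos (convex_Ioo a b)
    (continuousOn_expDensity.mono fun v hv => ha.trans_lt hv.1) fun v hv => ?_
  rw [interior_Ioo] at hv
  have hv0 : 0 < v := ha.trans_lt hv.1
  rw [(hasDerivAt_expDensity hv0).deriv]
  exact mul_pos (mul_pos (Real.rpow_pos_of_pos hv0 _) (Real.exp_pos _)) (h v hv)

lemma strictAntiOn_expDensity {p η a b : ℝ} (ha : 0 ≤ a) (h : ∀ v ∈ Ioo a b, p + η * v < 0) :
    StrictAntiOn (expDensity p η) (Ioo a b) := by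
  refine strictAntiOn_of_deriv_neg (convex_Ioo a b)
    (continuousOn_expDensity.mono fun v hv => ha.trans_lt hv.1) fun v hv => ?_
  rw [interior_Ioo] at hv
  have hv0 : 0 < v := ha.trans_lt hv.1
  rw [(hasDerivAt_expDensity hv0).deriv]
  exact mul_neg_of_pos_of_neg (mul_pos (Real.rpow_pos_of_pos hv0 _) (Real.exp_pos _)) (h v hv)

lemma analyticOnNhd_expDensity_div {p : ℝ} {q : ℝ} (hq : 0 < q) :
    AnalyticOnNhd ℝ (fun v => expDensity p (-1) (v / q)) (Ioi 0) := by
  intro v hv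
  have hv0 : 0 < v / q := div_pos hv hq
  have h1 : AnalyticAt ℝ (fun v : ℝ => v / q) v := analyticAt_id.div_const
  have h2 : AnalyticAt ℝ (fun v : ℝ => Real.exp (-1 * (v / q))) v :=
    (analyticAt_const.mul h1).rexp
  have h3 : AnalyticAt ℝ (fun v : ℝ => Real.exp (Real.log (v / q) * p)) v :=
    ((h1.log hv0).mul analyticAt_const).rexp
  refine (h3.mul h2).congr ?_
  filter_upwards [Ioi_mem_nhds hv] with w hw
  simp only [expDensity, Pi.mul_apply]
  rw [Real.rpow_def_of_pos (div_pos hw hq)]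

lemma tendsto_expDensity_atTop (p : ℝ) : Tendsto (expDensity p (-1)) atTop (𝓝 0) := by
  have := tendsto_rpow_mul_exp_neg_mul_atTop_nhds_zero p 1 one_pos
  exact this.congr fun x => by rw [expDensity]

/-- No measure has window masses `v ^ p * exp (-v)` for `v` in a compact subinterval `[a, b]` of
`(0, ∞)` and zero window masses elsewhere. -/
lemma not_window_compact (hc0 : 0 < c) (hc1 : c < 1) {a b p : ℝ} (ha : 0 < a) (hab : a < b)
    (hlow : ∀ᵐ v, 0 < v → v < a → M (window c v) = 0)
    (hhigh : ∀ᵐ v, b < v → M (window c v) = 0)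
    (h : ∀ᵐ v, v ∈ Ioo a b → M (window c v) = ENNReal.ofReal (expDensity p (-1) v)) : False := by
  have hN1 := measure_Ioi_eq_zero_of_window hc1 (ha.trans hab).le hhigh
  have hN2 := measure_lower_eq_zero_of_window hc0.le hc1 hlow
  have hex : ∃ n : ℕ, b * c ^ n ≤ a := by
    have : Tendsto (fun n : ℕ => b * c ^ n) atTop (𝓝 0) := by
      simpa using (tendsto_pow_atTop_nhds_zero_of_lt_one hc0.le hc1).const_mul b
    obtain ⟨n, hn⟩ := (this.eventually (gt_mem_nhds ha)).exists
    exact ⟨n, hn.le⟩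
  classical
  obtain ⟨n, hn⟩ : ∃ n, Nat.find hex = n + 1 := by
    refine Nat.exists_eq_succ_of_ne_zero fun h0 => ?_
    have := Nat.find_spec hex
    rw [h0, pow_zero, mul_one] at this
    linarith
  have hn1 : b * c ^ (n + 1) ≤ a := by
    have := Nat.find_spec hex
    rwa [hn] at this
  have hn2 : a < b * c ^ n := not_le.1 (Nat.find_min hex (by omega : n < Nat.find hex))
  have hac : a < a / c := by rw [lt_div_iff₀ hc0]; nlinarith
  -- For `v` in (a, a') the points v / c ^ j, j ≤ n, all lie in (a, b), and their windows tile (v, v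
  -- / c ^ (n + 1)]. By minimality of n + 1 this reaches beyond `b`, and what lies below `v` is null
  -- since c v < a. The sum `S v` is therefore the total mass.
  set a' := min (b * c ^ n) (a / c) with ha'
  have haa' : a < a' := lt_min hn2 hac
  set S : ℝ → ℝ := fun v => ∑ j ∈ Finset.range (n + 1), expDensity p (-1) (v / c ^ j) with hS
  have hae : ∀ᵐ v, v ∈ Ioo a a' → S v = (M (Ioi 0)).toReal := by
    have h1 := ae_forall_mul h (f := fun j => (c ^ j)⁻¹) fun j => (inv_pos.2 (pow_pos hc0 j)).ne'
    filter_upwards [h1] with v hv hva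
    have hv0 : 0 < v := ha.trans hva.1
    have h2 : ∀ j ∈ Finset.range (n + 1), M (window c (v / c ^ j)) =
        ENNReal.ofReal (expDensity p (-1) (v / c ^ j)) := by
      intro j hj
      have hcj : 0 < c ^ j := pow_pos hc0 j
      have := hv j
      rw [← div_eq_mul_inv] at this
      refine this ⟨?_, ?_⟩
      · rw [lt_div_iff₀ hcj]
        have : c ^ j ≤ 1 := pow_le_one₀ hc0.le hc1.le
        nlinarith [hva.1]
      · rw [div_lt_iff₀ hcj]
        have h3 : c ^ n ≤ c ^ j := pow_le_pow_of_le_one hc0.le hc1.le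
          (Nat.lt_succ_iff.1 (Finset.mem_range.1 hj))
        have h4 : v < b * c ^ n := hva.2.trans_le (min_le_left _ _)
        nlinarith
    have h3 := sum_measure_window (M := M) hc0 hc1 hv0 (n + 1)
    rw [Finset.sum_congr rfl h2, ← ENNReal.ofReal_sum_of_nonneg
      (fun j _ => (expDensity_pos (div_pos hv0 (pow_pos hc0 j))).le)] at h3
    have h4 : M {x | v < x ∧ c ^ (n + 1) * x ≤ v} = M (Ioi 0) := by
      refine le_antisymm (measure_mono fun x hx => hv0.trans hx.1) ?_
      have hsub : Ioi 0 ⊆ {x | v < x ∧ c ^ (n + 1) * x ≤ v} ∪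
          ({x | 0 < x ∧ c * x < a} ∪ Ioi b) := by
        intro x hx
        have hx0 : 0 < x := hx
        by_cases h5 : v < x
        · by_cases h6 : c ^ (n + 1) * x ≤ v
          · exact Or.inl ⟨h5, h6⟩
          · refine Or.inr (Or.inr ?_)
            have h7 : 0 < c ^ (n + 1) := pow_pos hc0 _
            have h8 : b * c ^ (n + 1) < c ^ (n + 1) * x :=
              (hn1.trans_lt hva.1).trans (not_le.1 h6)
            exact lt_of_mul_lt_mul_left (by linarith) h7.le
        · refine Or.inr (Or.inl ⟨hx0, ?_⟩)
          have h6 : v < a / c := hva.2.trans_le (min_le_right _ _)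
          rw [lt_div_iff₀ hc0] at h6
          nlinarith [not_lt.1 h5]
      refine (measure_mono hsub).trans ((measure_union_le _ _).trans ?_)
      have := measure_union_le (μ := M) {x | 0 < x ∧ c * x < a} (Ioi b)
      rw [hN1, hN2, add_zero, nonpos_iff_eq_zero] at this
      rw [this, add_zero]
    rw [← h4, ← h3, ENNReal.toReal_ofReal]
    exact Finset.sum_nonneg fun j _ => (expDensity_pos (div_pos hv0 (pow_pos hc0 j))).le
  -- Being constant on an interval, the analytic function `S` is constant on (0, ∞); but it is
  -- positive and tends to 0 at infinity.
  have han : AnalyticOnNhd ℝ S (Ioi 0) := by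
    have := Finset.analyticOnNhd_fun_sum (𝕜 := ℝ) (s := Ioi 0) (Finset.range (n + 1))
      (f := fun j v => expDensity p (-1) (v / c ^ j))
      fun j _ => analyticOnNhd_expDensity_div (pow_pos hc0 j)
    exact this
  set v₀ := (a + a') / 2 with hv₀
  have hv₀a : v₀ ∈ Ioo a a' := ⟨by linarith, by linarith⟩
  have hfreq : ∃ᶠ v in 𝓝[≠] v₀, S v = (M (Ioi 0)).toReal := by
    rw [frequently_iff]
    intro W hW
    have hW2 : W ∩ Ioo a a' ∈ 𝓝[>] v₀ := by
      have h1 : W ∈ 𝓝[>] v₀ := nhdsWithin_mono _ (fun x hx => ne_of_gt hx) hW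
      exact inter_mem h1 (mem_nhdsWithin_of_mem_nhds (Ioo_mem_nhds hv₀a.1 hv₀a.2))
    obtain ⟨w, hw1, hw2⟩ := mem_nhdsGT_iff_exists_Ioo_subset.1 hW2
    obtain ⟨v, hv1, hv2⟩ := exists_mem_Ioo_of_ae hae hw1
    exact ⟨v, (hw2 hv1).1, hv2 (hw2 hv1).2⟩
  have heq := han.eqOn_of_preconnected_of_frequently_eq
    (g := fun _ => (M (Ioi 0)).toReal) analyticOnNhd_const (convex_Ioi 0).isPreconnected
    (show v₀ ∈ Ioi (0 : ℝ) from ha.trans hv₀a.1) hfreq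
  have hlim : Tendsto S atTop (𝓝 0) := by
    have : Tendsto S atTop (𝓝 (∑ _j ∈ Finset.range (n + 1), (0 : ℝ))) :=
      tendsto_finsetSum _ fun j _ => (tendsto_expDensity_atTop p).comp
        (tendsto_id.atTop_div_const (pow_pos hc0 j))
    simpa using this
  have hconst : Tendsto S atTop (𝓝 (M (Ioi 0)).toReal) := by
    refine tendsto_const_nhds.congr' ?_
    filter_upwards [eventually_gt_atTop 0] with v hv
    exact (heq hv).symm
  have h0 := tendsto_nhds_unique hlim hconst
  have h1 := heq (show (1 : ℝ) ∈ Ioi (0 : ℝ) from mem_Ioi.2 one_pos)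
  have h2 : 0 < S 1 := Finset.sum_pos
    (fun j _ => expDensity_pos (div_pos one_pos (pow_pos hc0 j))) ⟨0, by simp⟩
  simp only [] at h1
  linarith

/-- No measure has window masses `v ^ p * exp (-v)`, `p > 0`, for `v` in `(0, b)` and zero window
masses above `b`. -/
lemma not_window_bounded (hc0 : 0 < c) (hc1 : c < 1) {b p : ℝ} (hb : 0 < b) (hp : 0 < p)
    (hhigh : ∀ᵐ v, b < v → M (window c v) = 0)
    (h : ∀ᵐ v, v ∈ Ioo 0 b → M (window c v) = ENNReal.ofReal (expDensity p (-1) v)) : False := by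
  have hN := measure_Ioi_eq_zero_of_window hc1 hb.le hhigh
  -- The windows at v c ^ j, j ≥ 0, tile (0, v / c]. For `v` in (c b, b) this interval carries the
  -- whole mass, so `Φ v` is the total mass there.
  set Φ : ℝ → ℝ := fun v => ∑' j : ℕ, expDensity p (-1) (v * c ^ j) with hΦ
  have hcp0 : 0 ≤ c ^ p := (Real.rpow_pos_of_pos hc0 p).le
  have hcp1 : c ^ p < 1 := Real.rpow_lt_one hc0.le hc1 hp
  have hbound : ∀ (j : ℕ), ∀ v ∈ Icc 0 b, ‖expDensity p (-1) (v * c ^ j)‖ ≤ b ^ p * (c ^ p) ^ j := by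
    intro j v hv
    have hcj : 0 < c ^ j := pow_pos hc0 j
    have h0 : 0 ≤ v * c ^ j := mul_nonneg hv.1 hcj.le
    rw [expDensity, norm_mul, Real.norm_of_nonneg (Real.rpow_nonneg h0 _),
      Real.norm_of_nonneg (Real.exp_pos _).le]
    have h1 : Real.exp (-1 * (v * c ^ j)) ≤ 1 := by
      rw [Real.exp_le_one_iff]
      linarith
    have h2 : (c ^ j) ^ p = (c ^ p) ^ j := by
      rw [← Real.rpow_natCast, ← Real.rpow_mul hc0.le, mul_comm, Real.rpow_mul hc0.le,
        Real.rpow_natCast]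
    calc _ ≤ (v * c ^ j) ^ p * 1 := mul_le_mul_of_nonneg_left h1 (Real.rpow_nonneg h0 _)
      _ = v ^ p * (c ^ p) ^ j := by rw [mul_one, Real.mul_rpow hv.1 hcj.le, h2]
      _ ≤ _ := mul_le_mul_of_nonneg_right (Real.rpow_le_rpow hv.1 hv.2 hp.le) (pow_nonneg hcp0 j)
  have hsum : Summable fun j : ℕ => b ^ p * (c ^ p) ^ j :=
    (summable_geometric_of_lt_one hcp0 hcp1).mul_left _
  have hcont : ContinuousOn Φ (Icc 0 b) := by
    refine continuousOn_tsum (fun j => ?_) hsum hbound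
    have : Continuous fun v : ℝ => expDensity p (-1) (v * c ^ j) := by
      unfold expDensity
      exact ((continuous_id.mul continuous_const).rpow_const fun _ => Or.inr hp.le).mul (by fun_prop)
    exact this.continuousOn
  have hsm : ∀ v ∈ Icc 0 b, Summable fun j : ℕ => expDensity p (-1) (v * c ^ j) := fun v hv =>
    Summable.of_norm_bounded hsum fun j => hbound j v hv
  have hcb : c * b < b := by nlinarith
  have hcb0 : 0 < c * b := mul_pos hc0 hb
  have hae : ∀ᵐ v, v ∈ Icc (c * b) b → Φ v = (M (Ioi 0)).toReal := by
    have h1 := ae_forall_mul h (f := fun j => c ^ j) fun j => (pow_pos hc0 j).ne'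
    have h0 : ∀ᵐ v : ℝ, v ≠ c * b ∧ v ≠ b := by
      have : ∀ d : ℝ, ∀ᵐ v : ℝ, v ≠ d := fun d => by simp [ae_iff]
      filter_upwards [this (c * b), this b] with v h1 h2 using ⟨h1, h2⟩
    filter_upwards [h1, h0] with v hv ⟨hvne1, hvne2⟩ hvb
    have hv1 : c * b < v := lt_of_le_of_ne hvb.1 hvne1.symm
    have hv2 : v < b := lt_of_le_of_ne hvb.2 hvne2
    have hv0 : 0 < v := hcb0.trans hv1
    have h2 : ∀ j : ℕ, M (Ioc (v / c * c ^ (j + 1)) (v / c * c ^ j)) =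
        ENNReal.ofReal (expDensity p (-1) (v * c ^ j)) := by
      intro j
      have hcj : 0 < c ^ j := pow_pos hc0 j
      rw [← hv j ⟨mul_pos hv0 hcj, ?_⟩]
      · congr 1
        ext x
        have e1 : v / c * c ^ (j + 1) = v * c ^ j := by rw [pow_succ]; field_simp
        have e2 : v / c * c ^ j = v * c ^ j / c := by ring
        rw [mem_Ioc, e1, e2, le_div_iff₀ hc0, window, mem_ofPred_eq, mul_comm x c]
        exact and_comm
      · have : c ^ j ≤ 1 := pow_le_one₀ hc0.le hc1.le
        nlinarith
    have hvc : 0 ≤ v / c := (div_pos hv0 hc0).le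
    have h3 : M (Ioc 0 (v / c)) = ENNReal.ofReal (Φ v) := by
      rw [Ioc_zero_eq_iUnion hc0.le hc1 hvc, measure_iUnion
        (f := fun n : ℕ => Ioc (v / c * c ^ (n + 1)) (v / c * c ^ n))
        (antitone_mul_pow hc0.le hc1 hvc).pairwise_disjoint_on_Ioc_succ
        fun _ => measurableSet_Ioc]
      simp_rw [h2]
      exact (ENNReal.ofReal_tsum_of_nonneg (fun j => (expDensity_pos (mul_pos hv0
        (pow_pos hc0 j))).le) (hsm v ⟨hv0.le, hvb.2⟩)).symm
    have h4 : M (Ioc 0 (v / c)) = M (Ioi 0) := by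
      refine le_antisymm (measure_mono fun x hx => hx.1) ?_
      have hsub : Ioi 0 ⊆ Ioc 0 (v / c) ∪ Ioi b := by
        intro x hx
        by_cases h5 : x ≤ v / c
        · exact Or.inl ⟨hx, h5⟩
        · refine Or.inr (lt_trans ?_ (not_le.1 h5))
          rw [lt_div_iff₀ hc0]
          linarith
      refine (measure_mono hsub).trans ((measure_union_le _ _).trans ?_)
      rw [hN, add_zero]
    rw [← h4, h3, ENNReal.toReal_ofReal]
    exact tsum_nonneg fun j => (expDensity_pos (mul_pos hv0 (pow_pos hc0 j))).le
  -- Continuity, which rests on p > 0, extends the identity to both endpoints, where Φ b exceeds Φ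
  -- (c b) by the positive first term.
  have heq : EqOn Φ (fun _ => (M (Ioi 0)).toReal) (Icc (c * b) b) :=
    Measure.eqOn_Icc_of_ae_eq volume hcb.ne ((ae_restrict_iff' measurableSet_Icc).2 hae)
      (hcont.mono (Icc_subset_Icc_left hcb0.le)) continuousOn_const
  have h1 := heq ⟨hcb.le, le_rfl⟩
  have h2 := heq ⟨le_rfl, hcb.le⟩
  have h3 : Φ b = expDensity p (-1) b + Φ (c * b) := by
    simp only [hΦ]
    rw [(hsm b ⟨hb.le, le_rfl⟩).tsum_eq_zero_add, pow_zero, mul_one]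
    congr 2
    funext j
    rw [pow_succ]
    ring_nf
  have h4 := expDensity_pos (p := p) (η := -1) hb
  simp only [] at h1 h2
  linarith

end Window

/-! ### Necessity of the parameter range. -/

/-- The law `sideLaw μ σ` with density `d ^ (-1 / r)`. -/
noncomputable def weightedSideLaw (r : ℝ) (μ : Measure ℝ) (σ : ℝ) : Measure ℝ :=
  (sideLaw μ σ).withDensity fun d => ENNReal.ofReal (d ^ (-(1 / r)))

/-- The size-bias weight (y / d) ^ (1 / r) factors into a power of y and d ^ (-1 / r). Absorbing the
latter into the measure turns the density equation into the mass of a set. -/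
lemma IsPowerFixed.weightedSideLaw_eq {α β r : ℝ} {μ : Measure ℝ} (h : IsPowerFixed α β r μ)
    {S : Set ℝ} (hS : MeasurableSet S) (hS0 : S ⊆ Ioi 0) (hSae : S =ᵐ[volume] Icc α β)
    (hr : r ≠ 0) {σ : ℝ} (hσ : σ = 1 ∨ σ = -1) :
    ∀ᵐ y, 0 < y → weightedSideLaw r μ σ {d | 0 < d ∧ (y / d) ^ (1 / r) ∈ S} =
      S.indicator (fun u => ENNReal.ofReal (y ^ (1 - 1 / r) * u)) (Real.exp (σ * y / r)) := by
  filter_upwards [h.density_eq hS hS0 hSae hr hσ] with y hy hy0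
  have hB : MeasurableSet {d : ℝ | 0 < d ∧ (y / d) ^ (1 / r) ∈ S} := by
    change MeasurableSet (Ioi 0 ∩ (fun d : ℝ => (y / d) ^ (1 / r)) ⁻¹' S)
    exact measurableSet_Ioi.inter (hS.preimage (by fun_prop))
  have hyr : 0 < y ^ (1 / r) := Real.rpow_pos_of_pos hy0 _
  have h1 : ∫⁻ d, sizeBias S ((y / d) ^ (1 / r)) ∂sideLaw μ σ =
      ENNReal.ofReal (y ^ (1 / r)) * weightedSideLaw r μ σ {d | 0 < d ∧ (y / d) ^ (1 / r) ∈ S} := by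
    rw [weightedSideLaw, withDensity_apply _ hB, ← lintegral_indicator hB,
      ← lintegral_const_mul' _ _ ENNReal.ofReal_ne_top]
    refine lintegral_congr_ae ?_
    have : ∀ᵐ d ∂sideLaw μ σ, d ∈ Ioi (0 : ℝ) := ae_restrict_mem measurableSet_Ioi
    filter_upwards [this] with d hd
    have hd0 : 0 < d := hd
    by_cases hds : (y / d) ^ (1 / r) ∈ S
    · rw [sizeBias, indicator_of_mem hds, indicator_of_mem
          (show d ∈ {d : ℝ | 0 < d ∧ (y / d) ^ (1 / r) ∈ S} from ⟨hd0, hds⟩),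
        ← ENNReal.ofReal_mul hyr.le, Real.div_rpow hy0.le hd0.le, Real.rpow_neg hd0.le, div_eq_mul_inv]
    · rw [sizeBias, indicator_of_notMem hds, indicator_of_notMem (fun h => hds h.2), mul_zero]
  rw [h1] at hy
  have hc0 : ENNReal.ofReal (y ^ (1 / r)) ≠ 0 := by simpa using hyr
  refine (ENNReal.mul_right_inj hc0 ENNReal.ofReal_ne_top).1 ((hy hy0).trans ?_)
  by_cases hs : Real.exp (σ * y / r) ∈ S
  · rw [sizeBias, indicator_of_mem hs, indicator_of_mem hs, ← ENNReal.ofReal_mul hy0.le,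
      ← ENNReal.ofReal_mul hyr.le, ← mul_assoc, ← Real.rpow_add hy0]
    simp
  · rw [sizeBias, indicator_of_notMem hs, indicator_of_notMem hs, mul_zero, mul_zero]

lemma IsPowerFixed.exists_window_of_set {α β r : ℝ} {μ : Measure ℝ} (h : IsPowerFixed α β r μ)
    {S : Set ℝ} (hS : MeasurableSet S) (hS0 : S ⊆ Ioi 0) (hSae : S =ᵐ[volume] Icc α β)
    (hr : r ≠ 0) {σ η t₀ t₁ : ℝ} (hσ : σ = 1 ∨ σ = -1) (hη : σ * |r| = η * r) (ht₁ : 0 < t₁)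
    (ht : ∀ x, 0 < x → (x ^ (1 / r) ∈ S ↔ t₀ ≤ x ∧ x < t₁)) :
    ∃ M : Measure ℝ, ∀ᵐ v, 0 < v → M (window (t₀ / t₁) v) =
      S.indicator (fun _ => ENNReal.ofReal (expDensity (1 - 1 / r) η v)) (Real.exp (η * v)) := by
  have hr0 : 0 < |r| := abs_pos.2 hr
  refine ⟨ENNReal.ofReal (|r| ^ (-(1 - 1 / r))) •
    (weightedSideLaw r μ σ).map fun d => t₁ * d / |r|, ?_⟩
  have h1 := ae_forall_mul (h.weightedSideLaw_eq hS hS0 hSae hr hσ) (f := fun _ => |r|)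
    fun _ => hr0.ne'
  filter_upwards [h1] with v hv hv0
  have h2 := hv 0 (mul_pos hv0 hr0)
  have hpre : (fun d => t₁ * d / |r|) ⁻¹' window (t₀ / t₁) v =
      {d | 0 < d ∧ (v * |r| / d) ^ (1 / r) ∈ S} := by
    ext d
    simp only [mem_preimage, window, mem_ofPred_eq]
    constructor
    · rintro ⟨h3, h4⟩
      have hd : 0 < d := by
        have : 0 < t₁ * d / |r| := hv0.trans h4
        have := (div_pos_iff_of_pos_right hr0).1 this
        exact pos_of_mul_pos_right this ht₁.le
      refine ⟨hd, (ht _ (by positivity)).2 ⟨?_, ?_⟩⟩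
      · rw [le_div_iff₀ hd]
        have e : t₀ / t₁ * (t₁ * d / |r|) = t₀ * d / |r| := by field_simp
        rwa [e, div_le_iff₀ hr0] at h3
      · rw [div_lt_iff₀ hd]
        rwa [lt_div_iff₀ hr0] at h4
    · rintro ⟨hd, h3⟩
      obtain ⟨h4, h5⟩ := (ht _ (by positivity)).1 h3
      have e : t₀ / t₁ * (t₁ * d / |r|) = t₀ * d / |r| := by field_simp
      rw [e, div_le_iff₀ hr0, lt_div_iff₀ hr0]
      exact ⟨(le_div_iff₀ hd).1 h4, (div_lt_iff₀ hd).1 h5⟩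
  have he : σ * (v * |r|) / r = η * v := by
    rw [div_eq_iff hr]
    linear_combination v * hη
  rw [he] at h2
  rw [Measure.smul_apply, Measure.map_apply (by fun_prop) (measurableSet_window _ _), hpre, h2,
    smul_eq_mul]
  by_cases hs : Real.exp (η * v) ∈ S
  · rw [indicator_of_mem hs, indicator_of_mem hs, ← ENNReal.ofReal_mul (Real.rpow_nonneg hr0.le _),
      expDensity]
    congr 1
    rw [Real.mul_rpow hv0.le hr0.le, Real.rpow_neg hr0.le]
    have := (Real.rpow_pos_of_pos hr0 (1 - 1 / r)).ne'
    field_simp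
  · rw [indicator_of_notMem hs, indicator_of_notMem hs, mul_zero]

lemma ae_eq_Icc_of_Ioo_subset {S : Set ℝ} {α β : ℝ} (h1 : Ioo α β ⊆ S) (h2 : S ⊆ Icc α β) :
    S =ᵐ[volume] Icc α β :=
  (LE.le.eventuallyLE h2).antisymm
    (Ioo_ae_eq_Icc.symm.le.trans (LE.le.eventuallyLE h1))

/-- The half-open version of [α, β] is chosen so that u ^ r ranges over [t₀, t₁), matching the
window. For r < 0 the order is reversed and t₁ = α ^ r, hence the assumption α > 0. The sign `η` is
the side of 1 on which u lies, and `σ` is the corresponding sign of log (u ^ r). -/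
lemma IsPowerFixed.exists_window {α β r : ℝ} {μ : Measure ℝ} (h : IsPowerFixed α β r μ)
    (hα : 0 ≤ α) (hαβ : α < β) (hr : r ≠ 0) (hrα : 0 < r ∨ 0 < α) {η : ℝ} (hη : η = 1 ∨ η = -1) :
    ∃ (M : Measure ℝ) (c : ℝ), 0 ≤ c ∧ c < 1 ∧ (0 < α → 0 < c) ∧ (α = 0 → c = 0) ∧
      (∀ᵐ v, 0 < v → Real.exp (η * v) ∈ Ioo α β →
        M (window c v) = ENNReal.ofReal (expDensity (1 - 1 / r) η v)) ∧
      (∀ᵐ v, 0 < v → Real.exp (η * v) ∉ Icc α β → M (window c v) = 0) := by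
  have hβ : 0 < β := hα.trans_lt hαβ
  suffices H : ∃ (S : Set ℝ) (σ t₀ t₁ : ℝ), MeasurableSet S ∧ S ⊆ Ioi 0 ∧ Ioo α β ⊆ S ∧
      S ⊆ Icc α β ∧ (σ = 1 ∨ σ = -1) ∧ σ * |r| = η * r ∧ 0 < t₁ ∧ 0 ≤ t₀ ∧ t₀ < t₁ ∧
      (0 < α → 0 < t₀) ∧ (α = 0 → t₀ = 0) ∧
      ∀ x, 0 < x → (x ^ (1 / r) ∈ S ↔ t₀ ≤ x ∧ x < t₁) by
    obtain ⟨S, σ, t₀, t₁, hS, hS0, hS1, hS2, hσ, hση, ht1, ht0, ht01, hα1, hα0, ht⟩ := H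
    obtain ⟨M, hM⟩ := h.exists_window_of_set hS hS0 (ae_eq_Icc_of_Ioo_subset hS1 hS2) hr hσ hση
      ht1 ht
    refine ⟨M, t₀ / t₁, div_nonneg ht0 ht1.le, (div_lt_one ht1).2 ht01,
      fun h0 => div_pos (hα1 h0) ht1, fun h0 => by rw [hα0 h0, zero_div], ?_, ?_⟩
    · filter_upwards [hM] with v hv hv0 hmem
      rw [hv hv0, indicator_of_mem (hS1 hmem)]
    · filter_upwards [hM] with v hv hv0 hmem
      rw [hv hv0, indicator_of_notMem fun hm => hmem (hS2 hm)]
  have hw : ∀ x : ℝ, 0 < x → (x ^ (1 / r)) ^ r = x := fun x hx => by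
    rw [← Real.rpow_mul hx.le, one_div_mul_cancel hr, Real.rpow_one]
  rcases lt_or_gt_of_ne hr with hneg | hpos
  · have hα0 : 0 < α := hrα.resolve_left (not_lt.2 hneg.le)
    refine ⟨Ioc α β, -η, β ^ r, α ^ r, measurableSet_Ioc, fun x hx => hα0.trans hx.1,
      Ioo_subset_Ioc_self, Ioc_subset_Icc_self, ?_, ?_, Real.rpow_pos_of_pos hα0 _,
      (Real.rpow_pos_of_pos hβ _).le, Real.rpow_lt_rpow_of_neg hα0 hαβ hneg,
      fun _ => Real.rpow_pos_of_pos hβ _, fun h0 => absurd h0 hα0.ne', fun x hx => ?_⟩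
    · rcases hη with rfl | rfl <;> simp
    · rw [abs_of_neg hneg]; ring
    · have hx0 : 0 < x ^ (1 / r) := Real.rpow_pos_of_pos hx _
      rw [mem_Ioc, ← Real.rpow_lt_rpow_iff_of_neg hx0 hα0 hneg,
        ← Real.rpow_le_rpow_iff_of_neg hβ hx0 hneg, hw x hx]
      exact and_comm
  · refine ⟨Ioi 0 ∩ Ico α β, η, α ^ r, β ^ r, measurableSet_Ioi.inter measurableSet_Ico,
      inter_subset_left, fun x hx => ⟨hα.trans_lt hx.1, hx.1.le, hx.2⟩,
      inter_subset_right.trans Ico_subset_Icc_self, hη, ?_, Real.rpow_pos_of_pos hβ _,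
      Real.rpow_nonneg hα _, Real.rpow_lt_rpow hα hαβ hpos,
      fun h0 => Real.rpow_pos_of_pos h0 _, fun h0 => by rw [h0, Real.zero_rpow hr], fun x hx => ?_⟩
    · rw [abs_of_pos hpos]
    · have hx0 : 0 < x ^ (1 / r) := Real.rpow_pos_of_pos hx _
      rw [mem_inter_iff, mem_Ico, ← Real.rpow_le_rpow_iff hα hx0.le hpos,
        ← Real.rpow_lt_rpow_iff hx0.le hβ.le hpos, hw x hx]
      exact and_iff_right hx0

/-- If `U` exceeds `1` with positive probability, the upper and lower edges of the law give
necessary conditions. -/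
lemma IsPowerFixed.le_of_one_lt {α β r : ℝ} {μ : Measure ℝ} (h : IsPowerFixed α β r μ)
    (hα : 0 ≤ α) (hαβ : α < β) (hr : r ≠ 0) (hrα : 0 < r ∨ 0 < α) (hβ1 : 1 < β) :
    1 - 1 / r + Real.log β ≤ 0 ∧ α ≤ 1 := by
  obtain ⟨M, c, hc0, hc1, hαc, -, hin, hout⟩ := h.exists_window hα hαβ hr hrα (Or.inl rfl)
  simp only [one_mul] at hin hout
  have hβ : 0 < β := hα.trans_lt hαβ
  set p := 1 - 1 / r
  set b := Real.log β with hb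
  have hb0 : 0 < b := Real.log_pos hβ1
  have hexp : ∀ v, v < b → Real.exp v < β := fun v hv => (Real.lt_log_iff_exp_lt hβ).1 hv
  have hlog : Real.log α < b := by
    rcases hα.eq_or_lt with h0 | h0
    · rwa [← h0, Real.log_zero]
    · exact Real.log_lt_log h0 hαβ
  have hexp2 : ∀ v, Real.log α < v → α < Real.exp v := fun v hv => by
    rcases hα.eq_or_lt with h0 | h0
    · rw [← h0]
      exact Real.exp_pos v
    · exact (Real.log_lt_iff_lt_exp h0).1 hv
  have hp : p + b ≤ 0 := by
    by_contra hcon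
    push Not at hcon
    have hN : M (Ioi b) = 0 := by
      refine measure_Ioi_eq_zero_of_window hc1 hb0.le ?_
      filter_upwards [hout] with v hv hvb
      exact hv (hb0.trans hvb) fun hmem => absurd ((Real.log_lt_iff_lt_exp hβ).1 hvb)
        (not_lt.2 hmem.2)
    -- Above c b the right end of the window passes `b`; above -p the derivative of the density is
    -- positive; above 0 and log α the density formula applies.
    set d := max (max (c * b) (-p)) (max 0 (Real.log α)) with hd
    have hdb : d < b := max_lt (max_lt (by nlinarith) (by linarith)) (max_lt hb0 hlog)
    have hd0 : 0 ≤ d := (le_max_left _ _).trans (le_max_right _ _)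
    refine not_strictMonoOn_of_window (M := M) (c := c) hdb ?_ (fun v hv => (expDensity_pos (hd0.trans_lt hv.1)).le)
      ?_ (strictMonoOn_expDensity (p := p) (η := 1) hd0 fun v hv => ?_)
    · refine measure_mono_null (fun x hx => ?_) hN
      have h1 : d < c * x := hx
      have h2 : c * b < c * x := ((le_max_left _ _).trans (le_max_left _ _)).trans_lt h1
      exact lt_of_mul_lt_mul_left h2 hc0
    · filter_upwards [hin] with v hv hvd
      exact hv (hd0.trans_lt hvd.1) ⟨hexp2 _ (((le_max_right _ _).trans (le_max_right _ _)).trans_lt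
        hvd.1), hexp _ hvd.2⟩
    · have : -p < v := ((le_max_right _ _).trans (le_max_left _ _)).trans_lt hv.1
      linarith
  refine ⟨hp, ?_⟩
  by_contra hcon
  push Not at hcon
  have hα0 : 0 < α := one_pos.trans hcon
  have hcpos := hαc hα0
  set a := Real.log α with ha
  have ha0 : 0 < a := Real.log_pos hcon
  have hN : M {x | 0 < x ∧ c * x < a} = 0 := by
    refine measure_lower_eq_zero_of_window hc0 hc1 ?_
    filter_upwards [hout] with v hv hv0 hva
    exact hv hv0 fun hmem => absurd ((Real.lt_log_iff_exp_lt hα0).1 hva) (not_lt.2 hmem.1)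
  have hac : a < a / c := by rw [lt_div_iff₀ hcpos]; nlinarith
  -- The inequality p + log β ≤ 0 just proved makes the density strictly decreasing up to log β,
  -- contrary to what the lower edge allows.
  refine not_strictAntiOn_of_window (lt_min hlog hac) ha0.le (fun v hv => ?_) hc0 hN
    (fun v hv => (expDensity_pos (ha0.trans hv.1)).le) ?_
    (strictAntiOn_expDensity (p := p) (η := 1) ha0.le fun v hv => ?_)
  · have := hv.trans_le (min_le_right _ _)
    rw [lt_div_iff₀ hcpos] at this
    linarith
  · filter_upwards [hin] with v hv hva
    exact hv (ha0.trans hva.1) ⟨hexp2 _ hva.1, hexp _ (hva.2.trans_le (min_le_left _ _))⟩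
  · have := hv.2.trans_le (min_le_left b (a / c))
    linarith

/-- Here the masses are v ^ p * exp (-v). For α = 0 the windows are half-lines, whose mass cannot
grow with `v`: this excludes a gap below -log β as well as p > 0. For α > 0 the tiling lemmas
`not_window_compact` and `not_window_bounded` exclude the same two cases. -/
lemma IsPowerFixed.eq_one_of_le_one {α β r : ℝ} {μ : Measure ℝ} (h : IsPowerFixed α β r μ)
    (hα : 0 ≤ α) (hαβ : α < β) (hr : r ≠ 0) (hrα : 0 < r ∨ 0 < α) (hβ1 : β ≤ 1) :
    β = 1 ∧ 1 - 1 / r ≤ 0 := by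
  obtain ⟨M, c, hc0, hc1, hαc, hαc0, hin, hout⟩ := h.exists_window hα hαβ hr hrα (Or.inr rfl)
  have hβ : 0 < β := hα.trans_lt hαβ
  set p := 1 - 1 / r
  have hexpβ : ∀ v, Real.exp (-1 * v) < β ↔ -Real.log β < v := fun v => by
    rw [← Real.lt_log_iff_exp_lt hβ]
    constructor <;> intro h <;> linarith
  have hlogβ : 0 ≤ -Real.log β := by linarith [Real.log_nonpos hβ.le hβ1]
  rcases hα.eq_or_lt with h0 | hα0
  · have hc : c = 0 := hαc0 h0.symm
    have hin2 : ∀ᵐ v, -Real.log β < v → M (window c v) = ENNReal.ofReal (expDensity p (-1) v) := by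
      filter_upwards [hin] with v hv hvb
      exact hv (hlogβ.trans_lt hvb) ⟨by rw [← h0]; exact Real.exp_pos _, (hexpβ v).2 hvb⟩
    have hβeq : β = 1 := by
      by_contra hne
      have hlt : 0 < -Real.log β := by
        have := Real.log_neg hβ (lt_of_le_of_ne hβ1 hne)
        linarith
      have hN : M {x | 0 < x ∧ c * x < -Real.log β} = 0 := by
        refine measure_lower_eq_zero_of_window hc0 hc1 ?_
        filter_upwards [hout] with v hv hv0 hva
        refine hv hv0 fun hmem => ?_
        have : ¬ -1 * v ≤ Real.log β := by linarith
        exact this ((Real.le_log_iff_exp_le hβ).2 hmem.2)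
      obtain ⟨v, hv1, hv2⟩ := exists_mem_Ioo_of_ae hin2 (lt_add_one (-Real.log β))
      have hv0 : 0 < v := hlt.trans hv1.1
      have h1 : M (window c v) = 0 := by
        refine measure_mono_null (fun x hx => ?_) hN
        refine ⟨hv0.trans hx.2, ?_⟩
        rw [hc, zero_mul]
        exact hlt
      rw [hv2 hv1.1, ENNReal.ofReal_eq_zero] at h1
      exact absurd (expDensity_pos hv0) (not_lt.2 h1)
    refine ⟨hβeq, ?_⟩
    by_contra hcon
    push Not at hcon
    refine not_strictMonoOn_of_window (M := M) (c := c) hcon ?_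
      (fun v hv => (expDensity_pos hv.1).le) ?_
      (strictMonoOn_expDensity (p := p) (η := -1) le_rfl fun v hv => by linarith [hv.2])
    · simp [hc]
    · filter_upwards [hin2] with v hv hvd
      refine hv ?_
      rw [hβeq, Real.log_one, neg_zero]
      exact hvd.1
  · have hcpos := hαc hα0
    have hexpα : ∀ v, α < Real.exp (-1 * v) ↔ v < -Real.log α := fun v => by
      rw [← Real.log_lt_iff_lt_exp hα0]
      constructor <;> intro h <;> linarith
    have hlog : -Real.log β < -Real.log α := by linarith [Real.log_lt_log hα0 hαβ]
    have hhigh : ∀ᵐ v, -Real.log α < v → M (window c v) = 0 := by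
      filter_upwards [hout] with v hv hvb
      refine hv (hlogβ.trans_lt (hlog.trans hvb)) fun hmem => ?_
      have : ¬ Real.log α ≤ -1 * v := by linarith
      exact this ((Real.log_le_iff_le_exp hα0).2 hmem.1)
    have hin2 : ∀ᵐ v, v ∈ Ioo (-Real.log β) (-Real.log α) →
        M (window c v) = ENNReal.ofReal (expDensity p (-1) v) := by
      filter_upwards [hin] with v hv hvb
      exact hv (hlogβ.trans_lt hvb.1) ⟨(hexpα v).2 hvb.2, (hexpβ v).2 hvb.1⟩
    have hβeq : β = 1 := by
      by_contra hne
      have hlt : 0 < -Real.log β := by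
        have := Real.log_neg hβ (lt_of_le_of_ne hβ1 hne)
        linarith
      refine not_window_compact hcpos hc1 hlt hlog ?_ hhigh hin2
      filter_upwards [hout] with v hv hv0 hva
      refine hv hv0 fun hmem => ?_
      have : ¬ -1 * v ≤ Real.log β := by linarith
      exact this ((Real.le_log_iff_exp_le hβ).2 hmem.2)
    refine ⟨hβeq, ?_⟩
    by_contra hcon
    push Not at hcon
    rw [hβeq, Real.log_one, neg_zero] at hin2 hlog
    exact not_window_bounded hcpos hc1 hlog hcon hhigh hin2

/-- The sets being measured grow with y, while their masses y ^ (1 - 1 / r) * exp (y / r) are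
positive and tend to 0. -/
lemma not_isPowerFixed_zero_of_neg {β r : ℝ} {μ : Measure ℝ} (hβ : 0 < β) (hr : r < 0) :
    ¬IsPowerFixed 0 β r μ := by
  intro h
  have h1 := h.weightedSideLaw_eq (S := Ioc 0 β) measurableSet_Ioc (fun x hx => hx.1)
    Ioc_ae_eq_Icc hr.ne (σ := 1) (Or.inl rfl)
  set f : ℝ → ℝ := fun y => y ^ (1 - 1 / r) * Real.exp (1 * y / r) with hf
  have hf0 : ∀ y, 0 < y → 0 < f y := fun y hy =>
    mul_pos (Real.rpow_pos_of_pos hy _) (Real.exp_pos _)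
  have hlim : Tendsto f atTop (𝓝 0) := by
    refine (tendsto_rpow_mul_exp_neg_mul_atTop_nhds_zero (1 - 1 / r) (-(1 / r)) ?_).congr fun y => ?_
    · rw [neg_pos]
      exact div_neg_of_pos_of_neg one_pos hr
    · rw [hf]
      ring_nf
  have hev : ∀ᶠ y in atTop, Real.exp (1 * y / r) < β := by
    have : Tendsto (fun y : ℝ => Real.exp (1 * y / r)) atTop (𝓝 0) := by
      refine Real.tendsto_exp_atBot.comp ?_
      simp only [one_mul]
      exact tendsto_id.atTop_div_const_of_neg hr
    exact this.eventually (gt_mem_nhds hβ)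
  obtain ⟨Y, hY⟩ := eventually_atTop.1 (hev.and (eventually_gt_atTop 0))
  have hval : ∀ᵐ y, Y ≤ y → weightedSideLaw r μ 1 {d | 0 < d ∧ (y / d) ^ (1 / r) ∈ Ioc 0 β} =
      ENNReal.ofReal (f y) := by
    filter_upwards [h1] with y hy hyY
    obtain ⟨h2, h3⟩ := hY y hyY
    rw [hy h3, indicator_of_mem (show _ ∈ Ioc 0 β from ⟨Real.exp_pos _, h2.le⟩)]
  obtain ⟨y₁, hy1, hv1⟩ := exists_mem_Ioo_of_ae hval (lt_add_one Y)
  have hy10 : 0 < y₁ := (hY y₁ hy1.1.le).2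
  obtain ⟨Z, hZ⟩ := eventually_atTop.1 (hlim.eventually (gt_mem_nhds (hf0 y₁ hy10)))
  obtain ⟨y₂, hy2, hv2⟩ := exists_mem_Ioo_of_ae hval (lt_add_one (max Z y₁))
  have hy12 : y₁ < y₂ := (le_max_right _ _).trans_lt hy2.1
  have hle : weightedSideLaw r μ 1 {d | 0 < d ∧ (y₁ / d) ^ (1 / r) ∈ Ioc 0 β} ≤
      weightedSideLaw r μ 1 {d | 0 < d ∧ (y₂ / d) ^ (1 / r) ∈ Ioc 0 β} := by
    refine measure_mono fun d hd => ⟨hd.1, ?_, ?_⟩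
    · exact Real.rpow_pos_of_pos (div_pos (hy10.trans hy12) hd.1) _
    · refine le_trans ?_ hd.2.2
      refine Real.rpow_le_rpow_of_nonpos (div_pos hy10 hd.1) ?_ ?_
      · exact div_le_div_of_nonneg_right hy12.le hd.1.le
      · exact (div_neg_of_pos_of_neg one_pos hr).le
  rw [hv1 hy1.1.le, hv2 (hy1.1.le.trans hy12.le),
    ENNReal.ofReal_le_ofReal_iff (hf0 y₂ (hy10.trans hy12)).le] at hle
  exact absurd (hZ y₂ ((le_max_left _ _).trans hy2.1.le)) (not_lt.2 hle)

/-- Necessity of the parameter range. -/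
theorem IsPowerFixed.towerParam {α β r : ℝ} {μ : Measure ℝ} (h : IsPowerFixed α β r μ)
    (hα : 0 ≤ α) (hαβ : α < β) (hr : r ≠ 0) : TowerParam α β r := by
  have hβ : 0 < β := hα.trans_lt hαβ
  have hrα : 0 < r ∨ 0 < α := by
    by_contra hcon
    push Not at hcon
    have h0 : α = 0 := le_antisymm hcon.2 hα
    subst h0
    exact not_isPowerFixed_zero_of_neg hβ (lt_of_le_of_ne hcon.1 hr) h
  have hmain : α ≤ 1 ∧ 1 ≤ β ∧ 1 - 1 / r + Real.log β ≤ 0 := by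
    rcases lt_or_ge 1 β with h1 | h1
    · obtain ⟨h2, h3⟩ := h.le_of_one_lt hα hαβ hr hrα h1
      exact ⟨h3, h1.le, h2⟩
    · obtain ⟨h2, h3⟩ := h.eq_one_of_le_one hα hαβ hr hrα h1
      refine ⟨(hαβ.trans_le h1).le, h2.ge, ?_⟩
      rw [h2, Real.log_one, add_zero]
      exact h3
  obtain ⟨h1, h2, h3⟩ := hmain
  have hlog := Real.log_nonneg h2
  -- A negative `r` would make 1 - 1 / r + log β positive.
  have hr0 : 0 < r := by
    by_contra hcon
    have : 1 / r < 0 := div_neg_of_pos_of_neg one_pos (lt_of_le_of_ne (not_lt.1 hcon) hr)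
    linarith
  refine ⟨hα, hαβ, h1, h2, hr0, ?_⟩
  have h4 : r * (1 - 1 / r + Real.log β) ≤ 0 := mul_nonpos_of_nonneg_of_nonpos hr0.le h3
  have h5 : r * (1 - 1 / r + Real.log β) = r * (1 + Real.log β) - 1 := by
    field_simp
    ring
  linarith

/-! ### The recursion for the distribution function, and its uniqueness. -/

/-- The fixed-point equation for the law of `A`, in terms of tails. -/
lemma IsPowerFixed.tail_eq {α β r : ℝ} {μ : Measure ℝ} (h : IsPowerFixed α β r μ)
    {S B₁ B₂ : Set ℝ} (hS : MeasurableSet S) (hS0 : S ⊆ Ioi 0) (hSae : S =ᵐ[volume] Icc α β)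
    (hB₁ : MeasurableSet B₁) (hB₂ : MeasurableSet B₂) (hr : 0 < r)
    (hB : ∀ x, 0 < x → volume (S ∩ Ioi x) + sizeBias S x +
      B₁.indicator (fun _ => ENNReal.ofReal α) x = B₂.indicator (fun _ => ENNReal.ofReal β) x)
    {σ : ℝ} (hσ : σ = 1 ∨ σ = -1) :
    ∀ᵐ y, 0 < y → volume (S ∩ {u | y < σ * (r * Real.log u)}) +
        ENNReal.ofReal y * sizeBias S (Real.exp (σ * y / r)) +
        ENNReal.ofReal α * sideLaw μ σ {d | (y / d) ^ (1 / r) ∈ B₁} =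
      ENNReal.ofReal β * sideLaw μ σ {d | (y / d) ^ (1 / r) ∈ B₂} := by
  filter_upwards [h.density_eq hS hS0 hSae hr.ne' hσ] with y hy hy0
  have hsm := measurable_sizeBias hS
  have hmB : ∀ {B : Set ℝ}, MeasurableSet B → MeasurableSet {d : ℝ | (y / d) ^ (1 / r) ∈ B} :=
    fun hB => hB.preimage (by fun_prop)
  have h1 := h.lintegral_sideLaw hS hS0 hSae σ (k := (Ioi y).indicator 1)
    (measurable_one.indicator measurableSet_Ioi)
  have hms : MeasurableSet {u : ℝ | y < σ * (r * Real.log u)} :=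
    measurableSet_lt measurable_const (by fun_prop)
  have h2 : ∫⁻ u in S ∩ {u | 0 < σ * (r * Real.log u)},
      (Ioi y).indicator (1 : ℝ → ENNReal) (σ * (r * Real.log u)) =
      volume (S ∩ {u | y < σ * (r * Real.log u)}) := by
    have e : ∀ u : ℝ, (Ioi y).indicator (1 : ℝ → ENNReal) (σ * (r * Real.log u)) =
        {u : ℝ | y < σ * (r * Real.log u)}.indicator 1 u := fun u => by
      simp [indicator]
    simp_rw [e]
    rw [lintegral_indicator_one hms, Measure.restrict_apply hms]
    congr 1
    ext u
    simp only [mem_inter_iff, mem_ofPred_eq]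
    constructor
    · exact fun h => ⟨h.2.1, h.1⟩
    · exact fun h => ⟨h.2, h.1, hy0.trans h.2⟩
  have h3 : ∀ d : ℝ, 0 < d → ∫⁻ u in S, (Ioi y).indicator (1 : ℝ → ENNReal) (d * u ^ r) =
      volume (S ∩ Ioi ((y / d) ^ (1 / r))) := by
    intro d hd
    have hmd : MeasurableSet {u : ℝ | y < d * u ^ r} :=
      measurableSet_lt measurable_const (by fun_prop)
    have e : ∀ u : ℝ, (Ioi y).indicator (1 : ℝ → ENNReal) (d * u ^ r) =
        {u : ℝ | y < d * u ^ r}.indicator 1 u := fun u => by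
      simp [indicator]
    simp_rw [e]
    rw [lintegral_indicator_one hmd, Measure.restrict_apply hmd, inter_comm]
    congr 1
    ext u
    refine and_congr_right fun hu => ?_
    have hu0 : 0 < u := hS0 hu
    rw [mem_ofPred_eq, mem_Ioi, one_div, Real.rpow_inv_lt_iff_of_pos (div_pos hy0 hd).le hu0.le hr,
      div_lt_iff₀ hd, mul_comm]
  have hae : ∀ᵐ d ∂sideLaw μ σ, d ∈ Ioi (0 : ℝ) := ae_restrict_mem measurableSet_Ioi
  have hmS : Measurable fun d : ℝ => sizeBias S ((y / d) ^ (1 / r)) := hsm.comp (by fun_prop)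
  have hm1 : Measurable fun d : ℝ =>
      ∫⁻ u in S, (Ioi y).indicator (1 : ℝ → ENNReal) (d * u ^ r) := by
    have : Measurable fun p : ℝ × ℝ => (Ioi y).indicator (1 : ℝ → ENNReal) (p.1 * p.2 ^ r) :=
      (measurable_one.indicator measurableSet_Ioi).comp (by fun_prop)
    exact this.lintegral_prod_right'
  have hc : ∀ {B : Set ℝ}, MeasurableSet B → ∀ γ : ℝ,
      ENNReal.ofReal γ * sideLaw μ σ {d | (y / d) ^ (1 / r) ∈ B} =
      ∫⁻ d, B.indicator (fun _ => ENNReal.ofReal γ) ((y / d) ^ (1 / r)) ∂sideLaw μ σ := by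
    intro B hB γ
    rw [← setLIntegral_const, ← lintegral_indicator (hmB hB)]
    rfl
  have hm2 : Measurable fun d : ℝ =>
      (∫⁻ u in S, (Ioi y).indicator (1 : ℝ → ENNReal) (d * u ^ r)) +
        sizeBias S ((y / d) ^ (1 / r)) := hm1.add hmS
  -- Adding the tail and density equations produces the integrand of `hB` at x = (y / d) ^ (1 / r):
  -- the non-constant parts cancel and only a step function remains.
  rw [← hy hy0, ← h2, ← h1, hc hB₁, hc hB₂, ← lintegral_add_left hm1, ← lintegral_add_left hm2]
  refine lintegral_congr_ae ?_
  filter_upwards [hae] with d hd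
  have hd0 : 0 < d := hd
  rw [h3 d hd0]
  exact hB _ (Real.rpow_pos_of_pos (div_pos hy0 hd0) _)

lemma sideLaw_apply {μ : Measure ℝ} {σ : ℝ} {B : Set ℝ} (hB : MeasurableSet B) :
    sideLaw μ σ B = μ {a | σ * Real.log a ∈ B ∧ 0 < σ * Real.log a} := by
  rw [sideLaw, Measure.restrict_apply hB, Measure.map_apply (by fun_prop)
    (hB.inter measurableSet_Ioi)]
  rfl

/-- The recursive formula, in the variable `s = β ^ r * log x`. -/
def RecursionAt (α β r : ℝ) (F : ℝ → ℝ) (s : ℝ) : Prop :=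
  F (Real.exp (s / β ^ r)) = Real.exp (s / r) / β * (1 - s) - α / β +
    α / β * F (Real.exp (s / β ^ r) ^ (β ^ r / α ^ r))

namespace TowerParam

variable {α β r : ℝ} (h : TowerParam α β r)
include h

lemma t_pos : 0 < β ^ r := Real.rpow_pos_of_pos h.beta_pos r

lemma exp_rpow_div (s : ℝ) :
    Real.exp (s / β ^ r) ^ (β ^ r / α ^ r) = Real.exp (s / α ^ r) := by
  rw [← Real.exp_mul, div_mul_div_cancel₀ h.t_pos.ne']

lemma recursionAt_iff {F : ℝ → ℝ} {s : ℝ} : RecursionAt α β r F s ↔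
    β * F (Real.exp (s / β ^ r)) = Real.exp (s / r) * (1 - s) - α +
      α * F (Real.exp (s / β ^ r) ^ (β ^ r / α ^ r)) := by
  have := h.beta_pos.ne'
  rw [RecursionAt, ← mul_right_inj' this]
  refine Eq.congr_right ?_
  rw [mul_add, mul_sub, ← mul_assoc, ← mul_assoc, mul_div_cancel₀ _ this, mul_div_cancel₀ _ this]

/-- With [α, β) the steps are strict: (y / d) ^ (1 / r) < γ means d > y / γ ^ r, so the side masses
are values of 1 - F. -/
lemma recursionAt_pos {μ : Measure ℝ} (hμ : IsPowerFixed α β r μ) :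
    ∀ᵐ y, 0 < y → Real.exp (y / r) < β → RecursionAt α β r (cdf μ) y := by
  have := hμ.prob
  have hr := h.pos
  have hβ := h.beta_pos
  have hα := h.nonneg
  have htail := hμ.tail_eq (S := Ioi 0 ∩ Ico α β) (B₁ := Iio α) (B₂ := Iio β)
    (measurableSet_Ioi.inter measurableSet_Ico) inter_subset_left
    (ae_eq_Icc_of_Ioo_subset (fun x hx => ⟨hα.trans_lt hx.1, hx.1.le, hx.2⟩)
      (inter_subset_right.trans Ico_subset_Icc_self)) measurableSet_Iio measurableSet_Iio hr ?_
    (σ := 1) (Or.inl rfl)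
  · filter_upwards [htail] with y hy hy0 hyβ
    have hy1 := hy hy0
    have hx1 : 1 < Real.exp (y / r) := Real.one_lt_exp_iff.2 (div_pos hy0 hr)
    simp only [one_mul] at hy1
    have e1 : (Ioi 0 ∩ Ico α β) ∩ {u | y < r * Real.log u} = Ioo (Real.exp (y / r)) β := by
      ext u
      simp only [mem_inter_iff, mem_Ioi, mem_Ico, mem_ofPred_eq, mem_Ioo]
      constructor
      · rintro ⟨⟨h0, h1, h2⟩, h3⟩
        refine ⟨?_, h2⟩
        rw [← Real.lt_log_iff_exp_lt h0, div_lt_iff₀ hr]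
        linarith
      · rintro ⟨h1, h2⟩
        have h0 : 0 < u := (Real.exp_pos _).trans h1
        refine ⟨⟨h0, h.le_one.trans (hx1.trans h1).le, h2⟩, ?_⟩
        rw [← Real.lt_log_iff_exp_lt h0, div_lt_iff₀ hr] at h1
        linarith
    have e2 : sizeBias (Ioi 0 ∩ Ico α β) (Real.exp (y / r)) = ENNReal.ofReal (Real.exp (y / r)) :=
      indicator_of_mem (show _ ∈ Ioi 0 ∩ Ico α β from
        ⟨Real.exp_pos _, h.le_one.trans hx1.le, hyβ⟩) _
    have e3 : ∀ γ : ℝ, 0 < γ → sideLaw μ 1 {d | (y / d) ^ (1 / r) ∈ Iio γ} =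
        ENNReal.ofReal (1 - cdf μ (Real.exp (y / γ ^ r))) := by
      intro γ hγ
      have hm : MeasurableSet {d : ℝ | (y / d) ^ (1 / r) ∈ Iio γ} :=
        measurableSet_Iio.preimage (by fun_prop)
      rw [sideLaw_apply hm]
      have : μ {a | 1 * Real.log a ∈ {d | (y / d) ^ (1 / r) ∈ Iio γ} ∧ 0 < 1 * Real.log a} =
          μ (Iic (Real.exp (y / γ ^ r)))ᶜ := by
        refine measure_congr ?_
        filter_upwards [hμ.ae_pos] with a ha
        refine propext ?_
        change ((y / (1 * Real.log a)) ^ (1 / r) < γ ∧ 0 < 1 * Real.log a) ↔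
          ¬ a ≤ Real.exp (y / γ ^ r)
        rw [not_le, one_mul, ← Real.lt_log_iff_exp_lt ha]
        have hγr := Real.rpow_pos_of_pos hγ r
        constructor
        · rintro ⟨h1, h2⟩
          rw [one_div, Real.rpow_inv_lt_iff_of_pos (div_pos hy0 h2).le hγ.le hr, div_lt_iff₀ h2] at h1
          rw [div_lt_iff₀ hγr]
          linarith
        · intro h1
          have h2 : 0 < Real.log a := (div_pos hy0 hγr).trans h1
          refine ⟨?_, h2⟩
          rw [one_div, Real.rpow_inv_lt_iff_of_pos (div_pos hy0 h2).le hγ.le hr, div_lt_iff₀ h2]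
          rw [div_lt_iff₀ hγr] at h1
          linarith
      rw [this, prob_compl_eq_one_sub measurableSet_Iic, ← ofReal_cdf,
        ENNReal.ofReal_sub _ (cdf_nonneg _ _), ENNReal.ofReal_one]
    have e4 : ENNReal.ofReal α * sideLaw μ 1 {d | (y / d) ^ (1 / r) ∈ Iio α} =
        ENNReal.ofReal (α * (1 - cdf μ (Real.exp (y / β ^ r) ^ (β ^ r / α ^ r)))) := by
      rcases hα.eq_or_lt with h0 | h0
      · simp [← h0]
      · rw [e3 α h0, ← ENNReal.ofReal_mul hα]
        congr 1
        rw [h.exp_rpow_div]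
    rw [e1, e2, e4, e3 β hβ, Real.volume_Ioo, ← ENNReal.ofReal_mul hy0.le,
      ← ENNReal.ofReal_add (by linarith) (by positivity), ← ENNReal.ofReal_add, ← ENNReal.ofReal_mul hβ.le,
      ENNReal.ofReal_eq_ofReal_iff] at hy1
    · rw [h.recursionAt_iff]
      linarith
    · have h1 := mul_nonneg hα (sub_nonneg.2 (cdf_le_one μ (Real.exp (y / β ^ r) ^ (β ^ r / α ^ r))))
      have h2 := mul_pos hy0 (Real.exp_pos (y / r))
      linarith
    · exact mul_nonneg hβ.le (sub_nonneg.2 (cdf_le_one _ _))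
    · have h2 := mul_pos hy0 (Real.exp_pos (y / r))
      linarith
    · exact mul_nonneg hα (sub_nonneg.2 (cdf_le_one _ _))
  · intro x hx
    have hlt := h.lt
    rcases lt_or_ge x α with h1 | h1
    · have e1 : (Ioi 0 ∩ Ico α β) ∩ Ioi x = Ico α β := by
        ext u
        simp only [mem_inter_iff, mem_Ioi, mem_Ico]
        constructor
        · exact fun h => h.1.2
        · exact fun h => ⟨⟨hx.trans (h1.trans_le h.1), h⟩, h1.trans_le h.1⟩
      rw [e1, sizeBias, indicator_of_notMem (fun hm => absurd hm.2.1 (not_le.2 h1)),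
        indicator_of_mem (mem_Iio.2 h1), indicator_of_mem (mem_Iio.2 (h1.trans hlt)), Real.volume_Ico,
        add_zero, ← ENNReal.ofReal_add (by linarith) hα, sub_add_cancel]
    · rw [indicator_of_notMem (show x ∉ Iio α from not_lt.2 h1), add_zero]
      rcases lt_or_ge x β with h2 | h2
      · have e1 : (Ioi 0 ∩ Ico α β) ∩ Ioi x = Ioo x β := by
          ext u
          simp only [mem_inter_iff, mem_Ioi, mem_Ico, mem_Ioo]
          constructor
          · exact fun h => ⟨h.2, h.1.2.2⟩
          · exact fun h => ⟨⟨hx.trans h.1, h1.trans h.1.le, h.2⟩, h.1⟩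
        rw [e1, sizeBias, indicator_of_mem (show x ∈ Ioi 0 ∩ Ico α β from ⟨hx, h1, h2⟩),
          indicator_of_mem (mem_Iio.2 h2), Real.volume_Ioo,
          ← ENNReal.ofReal_add (by linarith) hx.le, sub_add_cancel]
      · have e1 : (Ioi 0 ∩ Ico α β) ∩ Ioi x = ∅ := by
          ext u
          simp only [mem_inter_iff, mem_Ioi, mem_Ico, mem_empty_iff_false, iff_false]
          rintro ⟨⟨_, _, h3⟩, h4⟩
          linarith
        rw [e1, sizeBias, indicator_of_notMem (fun hm => absurd hm.2.2 (not_lt.2 h2)),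
          indicator_of_notMem (show x ∉ Iio β from not_lt.2 h2), measure_empty, add_zero]

/-- With (α, β] the steps are weak: -log a ≥ y / γ ^ r means a ≤ exp (-y / γ ^ r), so the side
masses are values of F itself. -/
lemma recursionAt_neg {μ : Measure ℝ} (hμ : IsPowerFixed α β r μ) :
    ∀ᵐ y, 0 < y → α < Real.exp (-y / r) → RecursionAt α β r (cdf μ) (-y) := by
  have := hμ.prob
  have hr := h.pos
  have hβ := h.beta_pos
  have hα := h.nonneg
  have htail := hμ.tail_eq (S := Ioc α β) (B₁ := Iic α) (B₂ := Iic β)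
    measurableSet_Ioc (fun x hx => hα.trans_lt hx.1)
    (ae_eq_Icc_of_Ioo_subset Ioo_subset_Ioc_self Ioc_subset_Icc_self) measurableSet_Iic
    measurableSet_Iic hr ?_ (σ := -1) (Or.inr rfl)
  · filter_upwards [htail] with y hy hy0 hyα
    have hy1 := hy hy0
    have hx1 : Real.exp (-y / r) < 1 :=
      Real.exp_lt_one_iff.2 (div_neg_of_neg_of_pos (by linarith) hr)
    rw [neg_one_mul] at hy1
    have e1 : Ioc α β ∩ {u | y < -1 * (r * Real.log u)} = Ioo α (Real.exp (-y / r)) := by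
      ext u
      simp only [mem_inter_iff, mem_Ioc, mem_ofPred_eq, mem_Ioo]
      constructor
      · rintro ⟨⟨h1, h2⟩, h3⟩
        refine ⟨h1, ?_⟩
        rw [← Real.log_lt_iff_lt_exp (hα.trans_lt h1), lt_div_iff₀ hr]
        linarith
      · rintro ⟨h1, h2⟩
        refine ⟨⟨h1, (h2.trans (hx1.trans_le h.one_le)).le⟩, ?_⟩
        rw [← Real.log_lt_iff_lt_exp (hα.trans_lt h1), lt_div_iff₀ hr] at h2
        linarith
    have e2 : sizeBias (Ioc α β) (Real.exp (-y / r)) = ENNReal.ofReal (Real.exp (-y / r)) :=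
      indicator_of_mem (show _ ∈ Ioc α β from ⟨hyα, hx1.le.trans h.one_le⟩) _
    have e3 : ∀ γ : ℝ, 0 < γ → sideLaw μ (-1) {d | (y / d) ^ (1 / r) ∈ Iic γ} =
        ENNReal.ofReal (cdf μ (Real.exp (-y / γ ^ r))) := by
      intro γ hγ
      have hm : MeasurableSet {d : ℝ | (y / d) ^ (1 / r) ∈ Iic γ} :=
        measurableSet_Iic.preimage (by fun_prop)
      rw [sideLaw_apply hm]
      have : {a | -1 * Real.log a ∈ {d | (y / d) ^ (1 / r) ∈ Iic γ} ∧ 0 < -1 * Real.log a} =ᵐ[μ]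
          Iic (Real.exp (-y / γ ^ r)) := by
        filter_upwards [hμ.ae_pos] with a ha
        refine propext ?_
        change ((y / (-1 * Real.log a)) ^ (1 / r) ≤ γ ∧ 0 < -1 * Real.log a) ↔
          a ≤ Real.exp (-y / γ ^ r)
        rw [← Real.log_le_iff_le_exp ha]
        have hγr := Real.rpow_pos_of_pos hγ r
        constructor
        · rintro ⟨h1, h2⟩
          rw [one_div, Real.rpow_inv_le_iff_of_pos (div_pos hy0 h2).le hγ.le hr, div_le_iff₀ h2] at h1
          rw [le_div_iff₀ hγr]
          linarith
        · intro h1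
          rw [le_div_iff₀ hγr] at h1
          have h2 : 0 < -1 * Real.log a := by
            by_contra hcon
            have : 0 ≤ Real.log a := by linarith
            have := mul_nonneg this hγr.le
            linarith
          refine ⟨?_, h2⟩
          rw [one_div, Real.rpow_inv_le_iff_of_pos (div_pos hy0 h2).le hγ.le hr, div_le_iff₀ h2]
          linarith
      rw [measure_congr this, ← ofReal_cdf]
    have e4 : ENNReal.ofReal α * sideLaw μ (-1) {d | (y / d) ^ (1 / r) ∈ Iic α} =
        ENNReal.ofReal (α * cdf μ (Real.exp (-y / β ^ r) ^ (β ^ r / α ^ r))) := by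
      rcases hα.eq_or_lt with h0 | h0
      · simp [← h0]
      · rw [e3 α h0, ← ENNReal.ofReal_mul hα]
        rw [h.exp_rpow_div]
    have h2 := mul_pos hy0 (Real.exp_pos (-y / r))
    rw [e1, e2, e4, e3 β hβ, Real.volume_Ioo, ← ENNReal.ofReal_mul hy0.le,
      ← ENNReal.ofReal_add (by linarith) h2.le, ← ENNReal.ofReal_add, ← ENNReal.ofReal_mul hβ.le,
      ENNReal.ofReal_eq_ofReal_iff] at hy1
    · rw [h.recursionAt_iff]
      linarith
    · have h1 := mul_nonneg hα (cdf_nonneg μ (Real.exp (-y / β ^ r) ^ (β ^ r / α ^ r)))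
      linarith
    · exact mul_nonneg hβ.le (cdf_nonneg _ _)
    · linarith
    · exact mul_nonneg hα (cdf_nonneg _ _)
  · intro x hx
    have hlt := h.lt
    rcases le_or_gt x α with h1 | h1
    · have e1 : Ioc α β ∩ Ioi x = Ioc α β := by
        ext u
        simp only [mem_inter_iff, mem_Ioi, mem_Ioc]
        exact and_iff_left_of_imp fun h => h1.trans_lt h.1
      rw [e1, sizeBias, indicator_of_notMem (fun hm => absurd hm.1 (not_lt.2 h1)),
        indicator_of_mem (mem_Iic.2 h1), indicator_of_mem (mem_Iic.2 (h1.trans hlt.le)),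
        Real.volume_Ioc, add_zero, ← ENNReal.ofReal_add (by linarith) hα, sub_add_cancel]
    · rw [indicator_of_notMem (show x ∉ Iic α from not_le.2 h1), add_zero]
      rcases le_or_gt x β with h2 | h2
      · have e1 : Ioc α β ∩ Ioi x = Ioc x β := by
          ext u
          simp only [mem_inter_iff, mem_Ioi, mem_Ioc]
          constructor
          · exact fun h => ⟨h.2, h.1.2⟩
          · exact fun h => ⟨⟨h1.trans h.1, h.2⟩, h.1⟩
        rw [e1, sizeBias, indicator_of_mem (show x ∈ Ioc α β from ⟨h1, h2⟩),
          indicator_of_mem (mem_Iic.2 h2), Real.volume_Ioc,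
          ← ENNReal.ofReal_add (by linarith) hx.le, sub_add_cancel]
      · have e1 : Ioc α β ∩ Ioi x = ∅ := by
          ext u
          simp only [mem_inter_iff, mem_Ioi, mem_Ioc, mem_empty_iff_false, iff_false]
          rintro ⟨⟨_, h3⟩, h4⟩
          linarith
        rw [e1, sizeBias, indicator_of_notMem (fun hm => absurd hm.2 (not_le.2 h2)),
          indicator_of_notMem (show x ∉ Iic β from not_le.2 h2), measure_empty, add_zero]

lemma recursionAt_ae {μ : Measure ℝ} (hμ : IsPowerFixed α β r μ) :
    ∀ᵐ s, s ≠ 0 → α < Real.exp (s / r) → Real.exp (s / r) < β → RecursionAt α β r (cdf μ) s := by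
  have hneg := ae_forall_mul (h.recursionAt_neg hμ) (f := fun _ => -1) (fun _ => by norm_num)
  filter_upwards [h.recursionAt_pos hμ, hneg] with s h1 h2 hs hα hβ
  rcases hs.lt_or_gt with h3 | h3
  · have h4 := h2 0
    simp only [mul_neg, mul_one, neg_neg] at h4
    exact h4 (by linarith) hα
  · exact h1 h3 hβ

/-- The recursive formula holds everywhere by right continuity. -/
lemma recursionAt_of_ne_zero {μ : Measure ℝ} (hμ : IsPowerFixed α β r μ) {s : ℝ} (hs : s ≠ 0)
    (hsα : α ≤ Real.exp (s / r)) (hsβ : Real.exp (s / r) < β) : RecursionAt α β r (cdf μ) s := by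
  have hr := h.pos
  -- The value c = 0 is α ^ r for α = 0; then t / 0 = 0 makes the function constant, and its
  -- coefficient α / β vanishes anyway.
  have hF : ∀ c : ℝ, 0 ≤ c →
      Tendsto (fun t => cdf μ (Real.exp (t / c))) (𝓝[>] s) (𝓝 (cdf μ (Real.exp (s / c)))) := by
    intro c hc
    refine ((cdf μ).right_continuous (Real.exp (s / c))).tendsto.comp
      (tendsto_nhdsWithin_iff.2 ⟨?_, ?_⟩)
    · have : Continuous fun t : ℝ => Real.exp (t / c) := by fun_prop
      exact this.continuousAt.tendsto.mono_left nhdsWithin_le_nhds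
    · filter_upwards [self_mem_nhdsWithin] with t ht
      exact Real.exp_le_exp.2 (div_le_div_of_nonneg_right (le_of_lt ht) hc)
  have hg : Tendsto (fun t : ℝ => Real.exp (t / r) / β * (1 - t) - α / β) (𝓝[>] s)
      (𝓝 (Real.exp (s / r) / β * (1 - s) - α / β)) := by
    have : Continuous fun t : ℝ => Real.exp (t / r) / β * (1 - t) - α / β := by fun_prop
    exact this.continuousAt.tendsto.mono_left nhdsWithin_le_nhds
  by_contra hcon
  rw [RecursionAt, h.exp_rpow_div, ← sub_eq_zero] at hcon
  have h1 := ((hF _ h.t_pos.le).sub (hg.add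
    ((hF _ (Real.rpow_nonneg h.nonneg r)).const_mul (α / β)))).eventually_ne hcon
  have h2 : ∀ᶠ t in 𝓝[>] s, t ≠ 0 :=
    (continuousAt_id.eventually_ne hs).filter_mono nhdsWithin_le_nhds
  have h3 : ∀ᶠ t in 𝓝[>] s, Real.exp (t / r) < β := by
    have : Continuous fun t : ℝ => Real.exp (t / r) := by fun_prop
    exact (this.continuousAt.eventually (Iio_mem_nhds hsβ)).filter_mono nhdsWithin_le_nhds
  obtain ⟨u, hu, hsub⟩ := mem_nhdsGT_iff_exists_Ioo_subset.1 ((h1.and h2).and h3)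
  obtain ⟨t, ht, hrec⟩ := exists_mem_Ioo_of_ae (h.recursionAt_ae hμ) (mem_Ioi.1 hu)
  obtain ⟨⟨h4, h5⟩, h6⟩ := hsub ht
  have h7 := hrec h5 (hsα.trans_lt (Real.exp_lt_exp.2 (div_lt_div_of_pos_right ht.1 hr))) h6
  rw [RecursionAt, h.exp_rpow_div] at h7
  exact h4 (sub_eq_zero.2 h7)

lemma lower_rpow : (α ^ (r / β ^ r)) ^ (β ^ r) = α ^ r := by
  rw [← Real.rpow_mul h.nonneg, div_mul_cancel₀ _ h.t_pos.ne']

lemma upper_rpow : (β ^ (r / β ^ r)) ^ (β ^ r) = β ^ r := by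
  rw [← Real.rpow_mul h.beta_pos.le, div_mul_cancel₀ _ h.t_pos.ne']

lemma ae_mem_Icc {μ : Measure ℝ} (hμ : IsPowerFixed α β r μ) :
    ∀ᵐ a ∂μ, a ∈ Icc (α ^ (r / β ^ r)) (β ^ (r / β ^ r)) := by
  filter_upwards [h.ae_rpow_mem hμ, hμ.ae_pos] with a ha ha0
  rw [← h.lower_rpow, mem_Icc, Real.rpow_le_rpow_iff (Real.rpow_nonneg h.nonneg _) ha0.le h.t_pos]
    at ha
  refine ⟨ha.1, ?_⟩
  have := ha.2
  nth_rewrite 2 [← h.upper_rpow] at this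
  rwa [Real.rpow_le_rpow_iff ha0.le (Real.rpow_nonneg h.beta_pos.le _) h.t_pos] at this

/-- For t > 0 one has a ^ t ≤ 1 exactly when a ≤ 1, so A ≤ 1 is as likely as U ≤ 1. -/
lemma cdf_one {μ : Measure ℝ} (hμ : IsPowerFixed α β r μ) :
    cdf μ 1 = (1 - α) / (β - α) := by
  have := hμ.prob
  have hr := h.pos
  have hk : Measurable ((Iic (1 : ℝ)).indicator (1 : ℝ → ENNReal)) :=
    measurable_one.indicator measurableSet_Iic
  have h1 := hμ.fixed _ hk
  have h2 : ∫⁻ u in Icc α β, (Iic (1 : ℝ)).indicator (1 : ℝ → ENNReal) (u ^ r) =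
      ENNReal.ofReal (1 - α) := by
    rw [← Real.volume_Icc, ← lintegral_indicator_one measurableSet_Icc,
      ← lintegral_indicator measurableSet_Icc]
    refine lintegral_congr fun u => ?_
    by_cases hu : u ∈ Icc α β
    · have hu0 := h.nonneg.trans hu.1
      rw [indicator_of_mem hu]
      have : u ^ r ∈ Iic (1 : ℝ) ↔ u ∈ Icc α 1 := by
        rw [mem_Iic, mem_Icc, ← Real.one_rpow r, Real.rpow_le_rpow_iff hu0 zero_le_one hr, Real.one_rpow]
        exact ⟨fun h => ⟨hu.1, h⟩, fun h => h.2⟩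
      simp only [indicator, this]
      split_ifs <;> rfl
    · rw [indicator_of_notMem hu, indicator_of_notMem]
      exact fun hcon => hu ⟨hcon.1, hcon.2.trans h.one_le⟩
  have h3 : ∫⁻ a, (∫⁻ u in Icc α β, (Iic (1 : ℝ)).indicator (1 : ℝ → ENNReal) (a ^ (u ^ r))) ∂μ =
      μ (Iic 1) * ENNReal.ofReal (β - α) := by
    rw [← lintegral_indicator_one measurableSet_Iic, ← lintegral_mul_const _ hk]
    refine lintegral_congr_ae ?_
    filter_upwards [hμ.ae_pos] with a ha
    rw [← Real.volume_Icc, ← setLIntegral_const]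
    refine setLIntegral_congr_fun_ae measurableSet_Icc ?_
    have h0 : ∀ᵐ u : ℝ ∂volume, u ≠ 0 := by simp [ae_iff]
    filter_upwards [h0] with u hu0 hu
    have hu1 : 0 < u ^ r := Real.rpow_pos_of_pos (lt_of_le_of_ne (h.nonneg.trans hu.1) hu0.symm) _
    have : a ^ (u ^ r) ∈ Iic (1 : ℝ) ↔ a ∈ Iic (1 : ℝ) := by
      rw [mem_Iic, mem_Iic]
      constructor
      · intro hle
        by_contra hcon
        exact absurd hle (not_le.2 (Real.one_lt_rpow (not_le.1 hcon) hu1))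
      · exact fun hle => Real.rpow_le_one ha.le hle hu1.le
    simp only [indicator, this]
    rfl
  have hlt := h.lt
  have h4 := h.le_one
  rw [h2, h3, ← ofReal_cdf, ← ENNReal.ofReal_mul (cdf_nonneg _ _), ENNReal.ofReal_eq_ofReal_iff
    (mul_nonneg (cdf_nonneg _ _) (by linarith)) (by linarith)] at h1
  rw [eq_div_iff (by linarith), h1]

theorem satisfiesTowerRecursion_cdf {μ : Measure ℝ} (hμ : IsPowerFixed α β r μ) :
    SatisfiesTowerRecursion α β r (cdf μ) := by
  have := hμ.prob
  have hr := h.pos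
  have ht := h.t_pos
  have hae := h.ae_mem_Icc hμ
  intro x
  split_ifs with h1 h2 h3
  · rw [cdf_eq_real, measureReal_eq_zero_iff]
    have hdis : ∀ᵐ a ∂μ, a ∉ Iic x := by
      filter_upwards [hae] with a ha hax
      exact absurd (ha.1.trans hax) (not_le.2 h1)
    exact measure_eq_zero_iff_ae_notMem.2 hdis
  · rw [cdf_eq_real, measureReal_def, (prob_compl_eq_zero_iff measurableSet_Iic).1 ?_, ENNReal.toReal_one]
    refine measure_eq_zero_iff_ae_notMem.2 ?_
    filter_upwards [hae] with a ha hax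
    exact hax (ha.2.trans h2)
  · rw [h3, h.cdf_one hμ]
  · rw [not_lt] at h1
    rw [not_le] at h2
    have hx0 : 0 ≤ x := (Real.rpow_nonneg h.nonneg _).trans h1
    rcases hx0.eq_or_lt with h0 | h0
    -- The point x = 0 lies in the interval only for α = 0, where both sides vanish.
    · have hα0 : α = 0 := by
        by_contra hcon
        have := Real.rpow_pos_of_pos (lt_of_le_of_ne h.nonneg (Ne.symm hcon)) (r / β ^ r)
        linarith
      have : cdf μ x = 0 := by
        rw [cdf_eq_real, measureReal_eq_zero_iff, ← h0, hμ.pos]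
      rw [this, hα0, ← h0, Real.zero_rpow (div_pos ht hr).ne']
      simp
    · have e1 : Real.exp (β ^ r * Real.log x / β ^ r) = x := by
        rw [mul_div_cancel_left₀ _ ht.ne', Real.exp_log h0]
      have e2 : Real.exp (β ^ r * Real.log x / r) = x ^ (β ^ r / r) := by
        rw [Real.rpow_def_of_pos h0]
        congr 1
        ring
      have hinv : ∀ γ : ℝ, 0 ≤ γ → (γ ^ (r / β ^ r)) ^ (β ^ r / r) = γ := fun γ hγ => by
        rw [← Real.rpow_mul hγ, div_mul_div_cancel₀ ht.ne', div_self hr.ne', Real.rpow_one]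
      have hrec := h.recursionAt_of_ne_zero hμ (s := β ^ r * Real.log x)
        (mul_ne_zero ht.ne' (Real.log_ne_zero_of_pos_of_ne_one h0 h3)) ?_ ?_
      · rwa [RecursionAt, e1, e2] at hrec
      · rw [e2]
        exact (hinv α h.nonneg).symm.trans_le
          (Real.rpow_le_rpow (Real.rpow_nonneg h.nonneg _) h1 (div_pos ht hr).le)
      · rw [e2]
        exact (Real.rpow_lt_rpow h0.le h2 (div_pos ht hr)).trans_eq (hinv β h.beta_pos.le)

lemma exists_pow_escape (hα : 0 < α) {x : ℝ} (hx : 0 < x) (hx1 : x ≠ 1) :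
    ∃ n : ℕ, x ^ ((β ^ r / α ^ r) ^ n) < α ^ (r / β ^ r) ∨
      β ^ (r / β ^ r) ≤ x ^ ((β ^ r / α ^ r) ^ n) := by
  have he : 1 < β ^ r / α ^ r :=
    (one_lt_div (Real.rpow_pos_of_pos hα r)).2 (Real.rpow_lt_rpow hα.le h.lt h.pos)
  rcases hx1.lt_or_gt with h1 | h1
  · obtain ⟨n, hn⟩ := pow_unbounded_of_one_lt (Real.log (α ^ (r / β ^ r)) / Real.log x) he
    refine ⟨n, Or.inl ?_⟩
    rw [div_lt_iff_of_neg (Real.log_neg hx h1), ← Real.log_rpow hx] at hn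
    exact (Real.log_lt_log_iff (Real.rpow_pos_of_pos hx _) (Real.rpow_pos_of_pos hα _)).1 hn
  · obtain ⟨n, hn⟩ := pow_unbounded_of_one_lt (Real.log (β ^ (r / β ^ r)) / Real.log x) he
    refine ⟨n, Or.inr ?_⟩
    rw [div_lt_iff₀ (Real.log_pos h1), ← Real.log_rpow hx] at hn
    exact ((Real.log_lt_log_iff (Real.rpow_pos_of_pos h.beta_pos _)
      (Real.rpow_pos_of_pos hx _)).1 hn).le

/-- For α = 0 the formula is explicit. Otherwise the exponent β ^ r / α ^ r > 1 drives every
positive x ≠ 1 out of the interval in finitely many steps, to prescribed values; the induction is on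
that number of steps. -/
theorem satisfiesTowerRecursion_unique {F G : ℝ → ℝ} (hF : SatisfiesTowerRecursion α β r F)
    (hG : SatisfiesTowerRecursion α β r G) : F = G := by
  have hstep : ∀ x, (α ^ (r / β ^ r) ≤ x → x < β ^ (r / β ^ r) → x ≠ 1 →
      α / β * F (x ^ (β ^ r / α ^ r)) = α / β * G (x ^ (β ^ r / α ^ r))) → F x = G x := by
    intro x hx
    rw [hF x, hG x]
    split_ifs with h1 h2 h3
    · rfl
    · rfl
    · rfl
    · rw [hx (not_lt.1 h1) (not_le.1 h2) h3]
  ext x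
  rcases h.nonneg.eq_or_lt with h0 | h0
  · exact hstep x fun _ _ _ => by simp [← h0]
  have key : ∀ n : ℕ, ∀ y : ℝ, 0 < y → (y ^ ((β ^ r / α ^ r) ^ n) < α ^ (r / β ^ r) ∨
      β ^ (r / β ^ r) ≤ y ^ ((β ^ r / α ^ r) ^ n)) → F y = G y := by
    intro n
    induction n with
    | zero =>
      intro y hy hesc
      rw [pow_zero, Real.rpow_one] at hesc
      refine hstep y fun h1 h2 _ => ?_
      rcases hesc with h3 | h3 <;> linarith
    | succ n ih =>
      intro y hy hesc
      refine hstep y fun _ _ _ => ?_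
      rw [ih _ (Real.rpow_pos_of_pos hy _)]
      rwa [← Real.rpow_mul hy.le, ← pow_succ']
  by_cases hx : 0 < x ∧ x ≠ 1
  · obtain ⟨n, hn⟩ := h.exists_pow_escape h0 hx.1 hx.2
    exact key n x hx.1 hn
  · exact hstep x fun h1 _ h3 =>
      absurd ⟨(Real.rpow_pos_of_pos h0 _).trans_le h1, h3⟩ hx

end TowerParam

/-! ### The case r = 0 and the conclusion. -/

lemma IsPowerFixed.eq_dirac_one {α β : ℝ} (hαβ : α < β) {μ : Measure ℝ}
    (h : IsPowerFixed α β 0 μ) : μ = Measure.dirac 1 := by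
  ext s hs
  have h1 := h.fixed (s.indicator 1) (measurable_one.indicator hs)
  have hvol : volume (Icc α β) ≠ 0 ∧ volume (Icc α β) ≠ ⊤ := by
    rw [Real.volume_Icc]
    exact ⟨by simpa using hαβ, ENNReal.ofReal_ne_top⟩
  simp only [Real.rpow_zero, Real.rpow_one, lintegral_const, Measure.restrict_apply_univ] at h1
  rw [lintegral_mul_const _ (measurable_one.indicator hs), lintegral_indicator_one hs,
    ENNReal.mul_left_inj hvol.1 hvol.2] at h1
  rw [h1, Measure.dirac_apply' _ hs]

lemma isInverseTowerDistribution_one_dirac {Ω₀ : Type*} [MeasurableSpace Ω₀] (P₀ : Measure Ω₀)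
    [IsProbabilityMeasure P₀] :
    IsInverseTowerDistribution (fun _ => (1 : ℝ)) P₀ (Measure.dirac 1) := by
  have hmap : P₀.map (fun _ => (1 : ℝ)) = Measure.dirac 1 := by
    rw [Measure.map_const, measure_univ, one_smul]
  refine isInverseTowerDistribution_of_contracting (b := 1) (ℓ := fun _ => 0) (by fun_prop) le_rfl
    (fun _ => le_rfl) measurable_const (by simp) ?_ ?_ ?_
  · rw [ae_dirac_eq]
    exact ⟨one_pos, fun x _ => by simp, fun x _ y _ => by simp⟩
  · rw [hmap, ae_dirac_eq]
    exact ⟨one_pos, le_rfl⟩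
  · intro k hk
    simp [hmap]

lemma towerParam_of_mem {α β r : ℝ} (hα : 0 ≤ α) (hαβ : α < β) (hr : r ≠ 0)
    (h1 : (1 : ℝ) ∈ Icc α β) (h2 : r ∈ Icc 0 (1 / (1 + Real.log β))) : TowerParam α β r := by
  have hlog := Real.log_nonneg h1.2
  exact ⟨hα, hαβ, h1.1, h1.2, lt_of_le_of_ne h2.1 hr.symm, (le_div_iff₀ (by linarith)).1 h2.2⟩

lemma TowerParam.mem_Icc {α β r : ℝ} (h : TowerParam α β r) :
    (1 : ℝ) ∈ Icc α β ∧ r ∈ Icc 0 (1 / (1 + Real.log β)) := by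
  have hlog := h.log_nonneg
  exact ⟨⟨h.le_one, h.one_le⟩, h.pos.le, (le_div_iff₀ (by linarith)).2 h.le⟩

theorem mainTheorem2 {Ω₀ : Type*} [MeasurableSpace Ω₀] (P₀ : Measure Ω₀) [IsProbabilityMeasure P₀]
    (α β r : ℝ) (hα : 0 ≤ α) (hαβ : α < β)
    (U : Ω₀ → ℝ) (hU : pdf.IsUniform U (Icc α β) P₀ volume) :
    (HasTowerDistribution (fun ω => U ω ^ r) P₀ ↔
      r = 0 ∨ ((1 : ℝ) ∈ Icc α β ∧ r ∈ Icc 0 (1 / (1 + Real.log β)))) ∧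
    (r = 0 → ∀ μ : Measure ℝ,
      IsInverseTowerDistribution (fun ω => U ω ^ r) P₀ μ ↔ μ = Measure.dirac 1) ∧
    (r ≠ 0 → (1 : ℝ) ∈ Icc α β → r ∈ Icc 0 (1 / (1 + Real.log β)) →
      ∃ F : ℝ → ℝ,
        SatisfiesTowerRecursion α β r F ∧
        (∀ G : ℝ → ℝ, SatisfiesTowerRecursion α β r G → G = F) ∧
        ∀ μ : Measure ℝ, IsInverseTowerDistribution (fun ω => U ω ^ r) P₀ μ ↔
          (IsProbabilityMeasure μ ∧ ∀ x : ℝ, cdf μ x = F x)) := by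
  have hzero : r = 0 → ∀ μ : Measure ℝ,
      IsInverseTowerDistribution (fun ω => U ω ^ r) P₀ μ ↔ μ = Measure.dirac 1 := by
    rintro rfl μ
    refine ⟨fun h => (h.isPowerFixed hαβ hU).eq_dirac_one hαβ, ?_⟩
    rintro rfl
    simpa only [Real.rpow_zero] using isInverseTowerDistribution_one_dirac P₀
  refine ⟨⟨?_, ?_⟩, hzero, ?_⟩
  · rintro ⟨μ, hμ⟩
    by_cases hr : r = 0
    · exact Or.inl hr
    · exact Or.inr ((hμ.isPowerFixed hαβ hU).towerParam hα hαβ hr).mem_Icc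
  · intro h
    by_cases hr : r = 0
    · exact ⟨_, (hzero hr _).2 rfl⟩
    · obtain ⟨h1, h2⟩ := h.resolve_left hr
      have hp := towerParam_of_mem hα hαβ hr h1 h2
      obtain ⟨μ, hμ⟩ := hp.exists_isPowerFixed
      exact ⟨μ, hp.isInverseTowerDistribution hU hμ⟩
  · intro hr h1 h2
    have hp := towerParam_of_mem hα hαβ hr h1 h2
    obtain ⟨ν, hν⟩ := hp.exists_isPowerFixed
    have hrec := hp.satisfiesTowerRecursion_cdf hν
    refine ⟨cdf ν, hrec, fun G hG => hp.satisfiesTowerRecursion_unique hG hrec,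
      fun μ => ⟨fun hμ => ?_, ?_⟩⟩
    -- Uniqueness of the law is inherited from the recursion: every inverse tower distribution has a
    -- distribution function solving it.
    · have hfix := hμ.isPowerFixed hαβ hU
      exact ⟨hfix.prob, congrFun (hp.satisfiesTowerRecursion_unique
        (hp.satisfiesTowerRecursion_cdf hfix) hrec)⟩
    · rintro ⟨hprob, hcdf⟩
      have := hν.prob
      have : μ = ν := Measure.eq_of_cdf μ ν (StieltjesFunction.ext hcdf)
      exact this ▸ hp.isInverseTowerDistribution hU hν
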